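/- Let $\theta\in\mathbb R$ be irrational and $\mathbb T=\mathbb R/\mathbb Z$ with Lebesgue measure. Let $\mathbb Z$ act on $C(\mathbb T)$ by $(\alpha_n f)(z)=f(z-n\theta)$, and let $A_\theta=C^*(\mathbb Z,\mathbb T)$ be the crossed product $C^*$-algebra (the irrational rotation algebra), generated by $C(\mathbb T)$ and the unitaries $U^n$, $n\in\mathbb Z$, that implement the action. Let $A_\theta^\infty=\mathcal S(\mathbb Z,C^\infty(\mathbb T))$ be the space of functions $F(n,z)$ on $\mathbb Z\times\mathbb T$, smooth in $z$, with $$\|F\|_{j,k}=\sum_n(1+|n|)^k\,\|\partial_z^jF(n,\cdot)\|_\infty<\infty\quad\text{for all } j,k\ge 0,$$ with the topology given by these seminorms and with $$(F*G)(n,z)=\sum_mF(m,z)\,G(n-m,z-m\theta),\qquad F^*(n,z)=\overline{F(-n,z-n\theta)} .$$ It is mapped to $A_\theta$ by $F\mapsto\sum_nF(n,\cdot)U^n$. For a module $E$ over $A=A_\theta^\infty$ and $e\in E$, the algebraically cyclic submodule $Ae$ carries the quotient topology from $A$. It is contained in a $\star$-representation of $A_\theta$ on a Hilbert space $\mathcal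 H$ (respectively, in an $A_\theta$-module $X$) if there is an injective continuous linear map of $Ae$ into $\mathcal H$ (respectively, $X$) that intertwines the actions of $A$. Then the following hold. 1. $A_\theta^\infty$ is an $m$-convex Fréchet algebra, and the map above is a continuous injective unital $\star$-homomorphism with dense image. Moreover $A_\theta^\infty$ is spectral invariant in $A_\theta$: an element of $A_\theta^\infty$ is invertible in $A_\theta^\infty$ if and only if it is invertible in $A_\theta$. 2. $L^1(\mathbb T)$ is a Banach $A_\theta^\infty$-module (the action is jointly continuous) under $$(F\psi)(z)=\sum_nF(n,z)\,\psi(z-n\theta)\quad\text{for almost every } z,$$ and it is topologically irreducible: it is nonzero, and its only closed $A_\theta^\infty$-invariant subspaces are $\{0\}$ and $L^1(\mathbb T)$. 3. Let $p\in\mathbb T$ and let $\xi$ be any nonnegative function on $\mathbb T$ that is infinitely differentiable away from $p$ and grows like $|z-p|^{-1/2}$ at $p$ (that is, $c|z-p|^{-1/2}\le\xi(z)\le C|z-p|^{-1/2}$ for all $z\ne p$ near $p$, with constants $0<c\le C$); such $\xi$ exist for every $p$. Then $\xi\in L^1(\mathbb T)\setminus L^2(\mathbb T)$, and the algebraically cyclic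 submodule $F=A_\theta^\infty\xi\ni\xi$ of $L^1(\mathbb T)$ is not algebraically irreducible and is contained in no $\star$-representation of $A_\theta$ on a Hilbert space. 4. Consequently the implication "if every algebraically cyclic submodule of every topologically irreducible Banach $A$-module is contained in a $B$-module, then $A$ is spectral invariant in $B$", for a dense $m$-convex Fréchet subalgebra $A$ of a Banach algebra $B$, has a false converse: $A=A_\theta^\infty$ is spectral invariant in $B=A_\theta$, but it is not true that every algebraically cyclic submodule of every topologically irreducible Banach $A$-module is contained in a continuous Fréchet $B$-module. -/

import Mathlib

open Filter Topology MeasureTheory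
open scoped ContDiff ENNReal

noncomputable section

namespace RotationAlgebra

/-- The pullback to `ℝ` of a function on the circle `𝕋 = ℝ/ℤ`. -/
def lift (f : C(UnitAddCircle, ℂ)) : ℝ → ℂ := fun x => f (x : UnitAddCircle)

/-- `f ∈ C^∞(𝕋)`. -/
def IsSmooth (f : C(UnitAddCircle, ℂ)) : Prop := ContDiff ℝ ∞ (lift f)

/-- The sup norm of the `j`-th derivative of a function on the circle. -/
def derivSup (j : ℕ) (f : C(UnitAddCircle, ℂ)) : ℝ := ⨆ x : ℝ, ‖iteratedDeriv j (lift f) x‖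

/-- The automorphism of `C(𝕋)` induced by translation by `n θ`: `(rot θ n f)(z) = f (z - n θ)`. -/
def rot (θ : ℝ) (n : ℤ) : C(UnitAddCircle, ℂ) →⋆ₐ[ℂ] C(UnitAddCircle, ℂ) :=
  ContinuousMap.compStarAlgHom' ℂ ℂ
    ⟨fun z => z - n • (θ : UnitAddCircle), by fun_prop⟩

theorem rot_apply (θ : ℝ) (n : ℤ) (f : C(UnitAddCircle, ℂ)) (z : UnitAddCircle) :
    rot θ n f z = f (z - n • (θ : UnitAddCircle)) := rfl

theorem rot_zero (θ : ℝ) (f : C(UnitAddCircle, ℂ)) : rot θ 0 f = f := by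
  ext z; simp [rot_apply]

theorem rot_rot (θ : ℝ) (m n : ℤ) (f : C(UnitAddCircle, ℂ)) :
    rot θ m (rot θ n f) = rot θ (m + n) f := by
  ext z; simp only [rot_apply]; congr 1; rw [add_smul]; abel

theorem norm_rot_le (θ : ℝ) (n : ℤ) (f : C(UnitAddCircle, ℂ)) : ‖rot θ n f‖ ≤ ‖f‖ :=
  (ContinuousMap.norm_le _ (norm_nonneg _)).2 fun _ => f.norm_coe_le_norm _

theorem continuous_rot (θ : ℝ) (n : ℤ) : Continuous (rot θ n) :=
  AddMonoidHomClass.continuous_of_bound (rot θ n) 1 fun f => by simpa using norm_rot_le θ n f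

theorem lift_rot (θ : ℝ) (n : ℤ) (f : C(UnitAddCircle, ℂ)) :
    lift (rot θ n f) = fun x => lift f (x - n * θ) := by
  ext x
  simp [lift, rot_apply]

theorem lift_periodic (f : C(UnitAddCircle, ℂ)) : Function.Periodic (lift f) 1 := by
  intro x; simp [lift]

theorem norm_iter (j : ℕ) (g : ℝ → ℂ) (x : ℝ) :
    ‖iteratedFDeriv ℝ j g x‖ = ‖iteratedDeriv j g x‖ := norm_iteratedFDeriv_eq_norm_iteratedDeriv

theorem bddAbove_deriv {f : C(UnitAddCircle, ℂ)} (hf : IsSmooth f) (j : ℕ) :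
    BddAbove (Set.range fun x : ℝ => ‖iteratedDeriv j (lift f) x‖) := by
  have hp : Function.Periodic (iteratedDeriv j (lift f)) 1 := by
    intro x
    have h := congrFun (iteratedDeriv_comp_add_const j (lift f) 1) x
    have h2 : (fun z => lift f (z + 1)) = lift f := funext (lift_periodic f)
    rw [h2] at h
    exact h.symm
  have hc : Continuous (iteratedDeriv j (lift f)) :=
    ContDiff.continuous_iteratedDeriv j hf (by exact_mod_cast le_top)
  have hb := hp.isBounded_of_continuous one_ne_zero hc
  obtain ⟨C, hC⟩ := hb.exists_norm_le
  exact ⟨C, by rintro _ ⟨x, rfl⟩; exact hC _ ⟨x, rfl⟩⟩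

theorem le_derivSup {f : C(UnitAddCircle, ℂ)} (hf : IsSmooth f) (j : ℕ) (x : ℝ) :
    ‖iteratedDeriv j (lift f) x‖ ≤ derivSup j f := le_ciSup (bddAbove_deriv hf j) x

theorem derivSup_nonneg (j : ℕ) (f : C(UnitAddCircle, ℂ)) : 0 ≤ derivSup j f :=
  Real.iSup_nonneg fun _ => norm_nonneg _

theorem derivSup_le {f : C(UnitAddCircle, ℂ)} {j : ℕ} {C : ℝ}
    (h : ∀ x, ‖iteratedDeriv j (lift f) x‖ ≤ C) : derivSup j f ≤ C := ciSup_le h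

theorem norm_le_derivSup {f : C(UnitAddCircle, ℂ)} (hf : IsSmooth f) : ‖f‖ ≤ derivSup 0 f := by
  refine (ContinuousMap.norm_le _ (derivSup_nonneg _ _)).2 fun z => ?_
  obtain ⟨x, rfl⟩ := QuotientAddGroup.mk_surjective z
  simpa [lift] using le_derivSup hf 0 x

theorem lift_add (f g : C(UnitAddCircle, ℂ)) : lift (f + g) = lift f + lift g := rfl
theorem lift_mul (f g : C(UnitAddCircle, ℂ)) : lift (f * g) = fun x => lift f x * lift g x := rfl
theorem lift_smul (c : ℂ) (f : C(UnitAddCircle, ℂ)) : lift (c • f) = c • lift f := rfl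

theorem IsSmooth.zero : IsSmooth 0 := (contDiff_const : ContDiff ℝ ∞ fun _ : ℝ => (0 : ℂ))
theorem IsSmooth.one : IsSmooth 1 := (contDiff_const : ContDiff ℝ ∞ fun _ : ℝ => (1 : ℂ))

section
variable {f g : C(UnitAddCircle, ℂ)}

theorem IsSmooth.add (hf : IsSmooth f) (hg : IsSmooth g) : IsSmooth (f + g) :=
  ContDiff.add (f := lift f) (g := lift g) hf hg
theorem IsSmooth.mul (hf : IsSmooth f) (hg : IsSmooth g) : IsSmooth (f * g) :=
  ContDiff.mul (f := lift f) (g := lift g) hf hg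
theorem IsSmooth.smul (c : ℂ) (hf : IsSmooth f) : IsSmooth (c • f) :=
  ContDiff.const_smul (f := lift f) c hf
theorem IsSmooth.rot (θ : ℝ) (n : ℤ) (hf : IsSmooth f) : IsSmooth (rot θ n f) := by
  rw [IsSmooth, lift_rot]
  exact hf.comp (contDiff_id.sub contDiff_const)
theorem IsSmooth.star (hf : IsSmooth f) : IsSmooth (star f) :=
  Complex.conjLIE.contDiff.comp (f := lift f) hf

theorem derivSup_zero (j : ℕ) : derivSup j 0 = 0 := by
  have : lift 0 = fun _ => 0 := rfl
  simp [derivSup, this]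

theorem derivSup_add (hf : IsSmooth f) (hg : IsSmooth g) (j : ℕ) :
    derivSup j (f + g) ≤ derivSup j f + derivSup j g := by
  refine derivSup_le fun x => ?_
  rw [lift_add, iteratedDeriv_add (hf.of_le (by exact_mod_cast le_top)).contDiffAt
    (hg.of_le (by exact_mod_cast le_top)).contDiffAt]
  exact (norm_add_le _ _).trans (add_le_add (le_derivSup hf j x) (le_derivSup hg j x))

theorem derivSup_smul (c : ℂ) (f : C(UnitAddCircle, ℂ)) (j : ℕ) :
    derivSup j (c • f) = ‖c‖ * derivSup j f := by
  simp only [derivSup, lift_smul, iteratedDeriv_const_smul_field, norm_smul]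
  rw [Real.mul_iSup_of_nonneg (norm_nonneg _)]

theorem derivSup_rot (θ : ℝ) (n : ℤ) (f : C(UnitAddCircle, ℂ)) (j : ℕ) :
    derivSup j (rot θ n f) = derivSup j f := by
  simp only [derivSup, lift_rot, iteratedDeriv_comp_sub_const]
  exact (Equiv.subRight ((n : ℝ) * θ)).surjective.iSup_comp
    (g := fun x => ‖iteratedDeriv j (lift f) x‖)

theorem derivSup_star (f : C(UnitAddCircle, ℂ)) (j : ℕ) :
    derivSup j (star f) = derivSup j f := by
  simp only [derivSup, ← norm_iter]
  congr 1; ext x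
  exact Complex.conjLIE.norm_iteratedFDeriv_comp_left (lift f) x j

theorem derivSup_mul (hf : IsSmooth f) (hg : IsSmooth g) (j : ℕ) :
    derivSup j (f * g) ≤
      ∑ i ∈ Finset.range (j + 1), (j.choose i : ℝ) * derivSup i f * derivSup (j - i) g := by
  refine derivSup_le fun x => ?_
  rw [lift_mul, ← norm_iter]
  refine (norm_iteratedFDeriv_mul_le (N := ∞) hf hg x (by exact_mod_cast le_top)).trans ?_
  refine Finset.sum_le_sum fun i _ => ?_
  rw [norm_iter, norm_iter]
  gcongr
  · exact mul_nonneg (Nat.cast_nonneg _) (derivSup_nonneg _ _)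
  · exact le_derivSup hf _ _
  · exact le_derivSup hg _ _

end

/-- A series of smooth functions that converges together with all derivatives. -/
theorem smooth_tsum {f : ℤ → C(UnitAddCircle, ℂ)} (hf : ∀ m, IsSmooth (f m))
    (hs : ∀ j, Summable fun m => derivSup j (f m)) :
    IsSmooth (∑' m, f m) ∧ ∀ j, derivSup j (∑' m, f m) ≤ ∑' m, derivSup j (f m) := by
  have h0 : Summable f := Summable.of_norm_bounded (hs 0) fun m => norm_le_derivSup (hf m)
  have hl : lift (∑' m, f m) = fun x => ∑' m, lift (f m) x := by
    ext x
    exact ((ContinuousMap.evalCLM ℂ (x : UnitAddCircle)).map_tsum h0 :)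
  have hb : ∀ (k : ℕ) (i : ℤ) (x : ℝ), (k : ℕ∞) ≤ ⊤ →
      ‖iteratedFDeriv ℝ k (lift (f i)) x‖ ≤ derivSup k (f i) := fun k i x _ => by
    rw [norm_iter]; exact le_derivSup (hf i) k x
  refine ⟨?_, fun j => derivSup_le fun x => ?_⟩
  · rw [IsSmooth, hl]
    exact contDiff_tsum (N := ⊤) hf (fun k _ => hs k) hb
  · rw [hl, ← norm_iter, iteratedFDeriv_tsum_apply (N := ⊤) hf (fun k _ => hs k) hb le_top]
    exact tsum_of_norm_bounded (hs j).hasSum fun i => hb j i x le_top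

/-- The weight `(1 + |n|)^k`. -/
def wt (k : ℕ) (n : ℤ) : ℝ := (1 + |(n : ℝ)|) ^ k

theorem wt_pos (k : ℕ) (n : ℤ) : 0 < wt k n := by unfold wt; positivity

theorem one_le_wt (k : ℕ) (n : ℤ) : 1 ≤ wt k n :=
  one_le_pow₀ (by linarith [abs_nonneg (n : ℝ)])

theorem wt_neg (k : ℕ) (n : ℤ) : wt k (-n) = wt k n := by simp [wt]

theorem wt_le (k : ℕ) (n m : ℤ) : wt k n ≤ wt k m * wt k (n - m) := by
  unfold wt
  rw [← mul_pow]
  gcongr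
  have h : |(n : ℝ)| ≤ |(m : ℝ)| + |((n - m : ℤ) : ℝ)| := by
    have := abs_add_le (m : ℝ) ((n - m : ℤ) : ℝ)
    simpa using this
  nlinarith [abs_nonneg (m : ℝ), abs_nonneg ((n - m : ℤ) : ℝ)]

/-- Membership in `S(ℤ, C^∞(𝕋))`: all `F(n, ·)` are smooth, and every derivative in the circle
variable decays faster than any power of `n`. -/
structure IsSchwartz (F : ℤ → C(UnitAddCircle, ℂ)) : Prop where
  smooth : ∀ n, IsSmooth (F n)
  decay : ∀ j k, Summable fun n => wt k n * derivSup j (F n)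

section
variable {F G H : ℤ → C(UnitAddCircle, ℂ)}

theorem IsSchwartz.summable_derivSup (hF : IsSchwartz F) (j : ℕ) :
    Summable fun n => derivSup j (F n) := by
  simpa [wt] using hF.decay j 0

theorem IsSchwartz.summable_norm (hF : IsSchwartz F) : Summable fun n => ‖F n‖ :=
  Summable.of_nonneg_of_le (fun _ => norm_nonneg _) (fun n => norm_le_derivSup (hF.smooth n))
    (hF.summable_derivSup 0)

theorem IsSchwartz.zero : IsSchwartz 0 :=
  ⟨fun _ => IsSmooth.zero, fun j k => by simp [derivSup_zero]⟩

theorem IsSchwartz.add (hF : IsSchwartz F) (hG : IsSchwartz G) : IsSchwartz (F + G) := by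
  refine ⟨fun n => (hF.smooth n).add (hG.smooth n), fun j k => ?_⟩
  refine Summable.of_nonneg_of_le (fun n => mul_nonneg (wt_pos k n).le (derivSup_nonneg _ _))
    (fun n => ?_) ((hF.decay j k).add (hG.decay j k))
  rw [← mul_add]
  exact mul_le_mul_of_nonneg_left (derivSup_add (hF.smooth n) (hG.smooth n) j) (wt_pos k n).le

theorem IsSchwartz.smul (c : ℂ) (hF : IsSchwartz F) : IsSchwartz (c • F) := by
  refine ⟨fun n => (hF.smooth n).smul c, fun j k => ?_⟩
  refine ((hF.decay j k).mul_left ‖c‖).congr fun n => ?_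
  rw [Pi.smul_apply, derivSup_smul]; ring

theorem IsSchwartz.single : IsSchwartz (Pi.single 0 1) := by
  refine ⟨fun n => ?_, fun j k => ?_⟩
  · by_cases h : n = 0
    · subst h; simpa using IsSmooth.one
    · simpa [h] using IsSmooth.zero
  · refine summable_of_ne_finset_zero (s := {0}) fun n hn => ?_
    have : n ≠ 0 := by simpa using hn
    simp [this, derivSup_zero]

/-- The involution `F^*(n, z) = conj (F(-n, z - nθ))`. -/
def adj (θ : ℝ) (F : ℤ → C(UnitAddCircle, ℂ)) : ℤ → C(UnitAddCircle, ℂ) :=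
  fun n => rot θ n (star (F (-n)))

theorem IsSchwartz.adj (θ : ℝ) (hF : IsSchwartz F) : IsSchwartz (adj θ F) := by
  refine ⟨fun n => (hF.smooth (-n)).star.rot θ n, fun j k => ?_⟩
  refine ((Equiv.neg ℤ).summable_iff.2 (hF.decay j k)).congr fun n => ?_
  simp [RotationAlgebra.adj, derivSup_rot, derivSup_star, wt_neg]

/-- The twisted convolution `(F * G)(n, z) = ∑ₘ F(m, z) G(n - m, z - mθ)`. -/
def conv (θ : ℝ) (F G : ℤ → C(UnitAddCircle, ℂ)) : ℤ → C(UnitAddCircle, ℂ) :=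
  fun n => ∑' m, F m * rot θ m (G (n - m))

theorem summable_conv {a b : ℤ → ℝ} (ha : Summable a) (hb : Summable b)
    (ha0 : ∀ n, 0 ≤ a n) (hb0 : ∀ n, 0 ≤ b n) :
    Summable fun p : ℤ × ℤ => a p.2 * b (p.1 - p.2) := by
  let e : ℤ × ℤ ≃ ℤ × ℤ :=
    ⟨fun p => (p.2, p.1 - p.2), fun p => (p.1 + p.2, p.1), fun p => by simp, fun p => by simp⟩
  exact e.summable_iff.2 (ha.mul_of_nonneg hb ha0 hb0)

theorem IsSchwartz.summable_conv_norm (hF : IsSchwartz F) (hG : IsSchwartz G) :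
    Summable fun p : ℤ × ℤ => ‖F p.2‖ * ‖G (p.1 - p.2)‖ :=
  summable_conv (a := fun n => ‖F n‖) (b := fun n => ‖G n‖) hF.summable_norm hG.summable_norm
    (fun _ => norm_nonneg _) fun _ => norm_nonneg _

theorem norm_conv_term_le (θ : ℝ) (F G : ℤ → C(UnitAddCircle, ℂ)) (n m : ℤ) :
    ‖F m * rot θ m (G (n - m))‖ ≤ ‖F m‖ * ‖G (n - m)‖ :=
  (norm_mul_le _ _).trans (mul_le_mul_of_nonneg_left (norm_rot_le _ _ _) (norm_nonneg _))

theorem IsSchwartz.summable_conv_term (θ : ℝ) (hF : IsSchwartz F) (hG : IsSchwartz G) (n : ℤ) :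
    Summable fun m => F m * rot θ m (G (n - m)) :=
  Summable.of_norm_bounded ((hF.summable_conv_norm hG).prod_factor n)
    fun m => norm_conv_term_le θ F G n m

theorem IsSchwartz.conv (θ : ℝ) (hF : IsSchwartz F) (hG : IsSchwartz G) :
    IsSchwartz (conv θ F G) := by
  let W : ℕ → ℕ → ℤ × ℤ → ℝ := fun j k p => ∑ i ∈ Finset.range (j + 1), (j.choose i : ℝ) *
    ((wt k p.2 * derivSup i (F p.2)) * (wt k (p.1 - p.2) * derivSup (j - i) (G (p.1 - p.2))))
  have hW : ∀ j k, Summable (W j k) := fun j k => summable_sum fun i _ =>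
    (summable_conv (hF.decay i k) (hG.decay (j - i) k)
      (fun n => mul_nonneg (wt_pos k n).le (derivSup_nonneg _ _))
      (fun n => mul_nonneg (wt_pos k n).le (derivSup_nonneg _ _))).mul_left _
  have hle : ∀ j k n m, wt k n * derivSup j (F m * rot θ m (G (n - m))) ≤ W j k (n, m) := by
    intro j k n m
    have h1 := derivSup_mul (hF.smooth m) ((hG.smooth (n - m)).rot θ m) j
    have h2 := mul_le_mul_of_nonneg_left h1 (wt_pos k n).le
    refine h2.trans ?_
    rw [Finset.mul_sum]
    refine Finset.sum_le_sum fun i _ => ?_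
    rw [derivSup_rot]
    have h3 := mul_le_mul_of_nonneg_right (wt_le k n m)
      (mul_nonneg (mul_nonneg (Nat.cast_nonneg (j.choose i)) (derivSup_nonneg i (F m)))
        (derivSup_nonneg (j - i) (G (n - m))))
    refine h3.trans (le_of_eq ?_)
    ring
  have hs : ∀ n j, Summable fun m => derivSup j (F m * rot θ m (G (n - m))) := fun n j =>
    Summable.of_nonneg_of_le (fun m => derivSup_nonneg _ _)
      (fun m => by simpa [wt] using hle j 0 n m) ((hW j 0).prod_factor n)
  have ht := fun n => smooth_tsum (fun m => (hF.smooth m).mul ((hG.smooth (n - m)).rot θ m)) (hs n)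
  refine ⟨fun n => (ht n).1, fun j k => ?_⟩
  refine Summable.of_nonneg_of_le (fun n => mul_nonneg (wt_pos k n).le (derivSup_nonneg _ _))
    (fun n => ?_) (hW j k).prod
  refine (mul_le_mul_of_nonneg_left ((ht n).2 j) (wt_pos k n).le).trans ?_
  rw [← tsum_mul_left]
  exact ((hs n j).mul_left _).tsum_le_tsum (hle j k n) ((hW j k).prod_factor n)

theorem conv_one (θ : ℝ) (F : ℤ → C(UnitAddCircle, ℂ)) : conv θ F (Pi.single 0 1) = F := by
  funext n
  rw [conv, tsum_eq_single n]
  · simp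
  · intro m hm
    have : n - m ≠ 0 := sub_ne_zero.2 hm.symm
    simp [this]

theorem one_conv (θ : ℝ) (F : ℤ → C(UnitAddCircle, ℂ)) : conv θ (Pi.single 0 1) F = F := by
  funext n
  rw [conv, tsum_eq_single 0]
  · simp [rot_zero]
  · intro m hm
    simp [hm]

theorem conv_add (θ : ℝ) (hF : IsSchwartz F) (hG : IsSchwartz G) (hH : IsSchwartz H) :
    conv θ F (G + H) = conv θ F G + conv θ F H := by
  funext n
  simp only [conv, Pi.add_apply, map_add, mul_add]
  exact (hF.summable_conv_term θ hG n).tsum_add (hF.summable_conv_term θ hH n)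

theorem add_conv (θ : ℝ) (hF : IsSchwartz F) (hG : IsSchwartz G) (hH : IsSchwartz H) :
    conv θ (F + G) H = conv θ F H + conv θ G H := by
  funext n
  simp only [conv, Pi.add_apply, add_mul]
  exact (hF.summable_conv_term θ hH n).tsum_add (hG.summable_conv_term θ hH n)

theorem smul_conv (θ : ℝ) (c : ℂ) (hF : IsSchwartz F) (hG : IsSchwartz G) :
    conv θ (c • F) G = c • conv θ F G := by
  funext n
  simp only [conv, Pi.smul_apply, smul_mul_assoc]
  exact (hF.summable_conv_term θ hG n).tsum_const_smul c

theorem conv_smul (θ : ℝ) (c : ℂ) (hF : IsSchwartz F) (hG : IsSchwartz G) :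
    conv θ F (c • G) = c • conv θ F G := by
  funext n
  simp only [conv, Pi.smul_apply, map_smul, mul_smul_comm]
  exact (hF.summable_conv_term θ hG n).tsum_const_smul c

theorem conv_assoc (θ : ℝ) (hF : IsSchwartz F) (hG : IsSchwartz G) (hH : IsSchwartz H) :
    conv θ (conv θ F G) H = conv θ F (conv θ G H) := by
  funext n
  have hL : conv θ (conv θ F G) H n =
      ∑' m, ∑' k, F k * rot θ k (G (m - k)) * rot θ m (H (n - m)) := by
    rw [conv]
    congr 1; ext1 m
    exact ((hF.summable_conv_term θ hG m).tsum_mul_right _).symm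
  have hR : conv θ F (conv θ G H) n =
      ∑' k, ∑' m, F k * rot θ k (G (m - k)) * rot θ m (H (n - m)) := by
    rw [conv]
    congr 1; ext1 k
    have h1 : rot θ k (conv θ G H (n - k)) =
        ∑' l, rot θ k (G l * rot θ l (H (n - k - l))) :=
      (hG.summable_conv_term θ hH (n - k)).map_tsum (rot θ k) (continuous_rot θ k)
    have h2 : Summable fun l => rot θ k (G l * rot θ l (H (n - k - l))) :=
      (hG.summable_conv_term θ hH (n - k)).map (rot θ k) (continuous_rot θ k)
    rw [h1, ← h2.tsum_mul_left, ← (Equiv.subRight k).tsum_eq]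
    congr 1; ext1 m
    simp only [Equiv.subRight_apply, map_mul, rot_rot, mul_assoc]
    congr 4 <;> abel_nf
  rw [hL, hR]
  obtain ⟨C, hC⟩ : ∃ C, ∀ l, ‖H l‖ ≤ C := by
    obtain ⟨C, hC⟩ := hH.summable_norm.tendsto_cofinite_zero.bddAbove_range_of_cofinite
    exact ⟨C, fun l => hC ⟨l, rfl⟩⟩
  refine (Summable.tsum_comm
    (f := fun m k => F k * rot θ k (G (m - k)) * rot θ m (H (n - m))) ?_).symm
  refine Summable.of_norm_bounded ((hF.summable_conv_norm hG).mul_right C) fun p => ?_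
  refine (norm_mul_le _ _).trans ?_
  exact mul_le_mul (norm_conv_term_le θ F G p.1 p.2) ((norm_rot_le _ _ _).trans (hC _))
    (norm_nonneg _) (mul_nonneg (norm_nonneg _) (norm_nonneg _))

theorem adj_adj (θ : ℝ) (F : ℤ → C(UnitAddCircle, ℂ)) : adj θ (adj θ F) = F := by
  funext n
  simp [adj, ← map_star, rot_rot, rot_zero]

theorem adj_conv (θ : ℝ) (hF : IsSchwartz F) (hG : IsSchwartz G) :
    adj θ (conv θ F G) = conv θ (adj θ G) (adj θ F) := by
  funext n
  have hs := hF.summable_conv_term θ hG (-n)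
  have h1 : adj θ (conv θ F G) n = ∑' m, rot θ n (star (F m * rot θ m (G (-n - m)))) := by
    rw [adj, conv, tsum_star]
    exact hs.star.map_tsum (rot θ n) (continuous_rot θ n)
  rw [h1, conv]
  conv_rhs => rw [← (Equiv.addLeft n).tsum_eq]
  congr 1; ext1 m
  have e1 : -(n - (n + m)) = m := by ring
  have e2 : -(n + m) = -n - m := by ring
  have e3 : n + m + (n - (n + m)) = n := by ring
  simp only [Equiv.coe_addLeft, adj, star_mul, ← map_star, map_mul, rot_rot, e1, e2, e3]

end
/-- `S(ℤ, C^∞(𝕋))` as a vector space of functions `ℤ → C(𝕋)`. -/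
def schwartz : Submodule ℂ (ℤ → C(UnitAddCircle, ℂ)) where
  carrier := {F | IsSchwartz F}
  add_mem' := IsSchwartz.add
  zero_mem' := IsSchwartz.zero
  smul_mem' c _ h := h.smul c

/-- The smooth rotation algebra `A_θ^∞ = S(ℤ, C^∞(𝕋))`, with twisted convolution. -/
def SmoothAlgebra (_θ : ℝ) : Type := schwartz

namespace SmoothAlgebra

variable {θ : ℝ}

/-- The function `F(n, ·)` on the circle. -/
def coeff (F : SmoothAlgebra θ) : ℤ → C(UnitAddCircle, ℂ) := F.1

theorem isSchwartz (F : SmoothAlgebra θ) : IsSchwartz F.coeff := F.2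

/-- An element of `A_θ^∞` from its coefficients. -/
def mk (F : ℤ → C(UnitAddCircle, ℂ)) (hF : IsSchwartz F) : SmoothAlgebra θ := ⟨F, hF⟩

theorem coeff_injective : Function.Injective (coeff : SmoothAlgebra θ → _) :=
  Subtype.val_injective

instance : AddCommGroup (SmoothAlgebra θ) := inferInstanceAs (AddCommGroup schwartz)
instance : Module ℂ (SmoothAlgebra θ) := inferInstanceAs (Module ℂ schwartz)
instance : One (SmoothAlgebra θ) := ⟨mk _ IsSchwartz.single⟩
instance : Mul (SmoothAlgebra θ) := ⟨fun F G => mk _ (F.isSchwartz.conv θ G.isSchwartz)⟩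
instance : Star (SmoothAlgebra θ) := ⟨fun F => mk _ (F.isSchwartz.adj θ)⟩

theorem coeff_zero : (0 : SmoothAlgebra θ).coeff = 0 := rfl
theorem coeff_add (F G : SmoothAlgebra θ) : (F + G).coeff = F.coeff + G.coeff := rfl
theorem coeff_smul (c : ℂ) (F : SmoothAlgebra θ) : (c • F).coeff = c • F.coeff := rfl
theorem coeff_one : (1 : SmoothAlgebra θ).coeff = Pi.single 0 1 := rfl
theorem coeff_mul (F G : SmoothAlgebra θ) : (F * G).coeff = conv θ F.coeff G.coeff := rfl
theorem coeff_star (F : SmoothAlgebra θ) : (star F).coeff = adj θ F.coeff := rfl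

instance : Ring (SmoothAlgebra θ) where
  __ := (inferInstance : AddCommGroup (SmoothAlgebra θ))
  left_distrib F G H :=
    coeff_injective (conv_add θ F.isSchwartz G.isSchwartz H.isSchwartz)
  right_distrib F G H :=
    coeff_injective (add_conv θ F.isSchwartz G.isSchwartz H.isSchwartz)
  zero_mul F := coeff_injective <| by
    funext n; simp [coeff_mul, coeff_zero, conv]
  mul_zero F := coeff_injective <| by
    funext n; simp [coeff_mul, coeff_zero, conv]
  mul_assoc F G H := coeff_injective (conv_assoc θ F.isSchwartz G.isSchwartz H.isSchwartz)
  one_mul F := coeff_injective (one_conv θ F.coeff)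
  mul_one F := coeff_injective (conv_one θ F.coeff)

instance : Algebra ℂ (SmoothAlgebra θ) := Algebra.ofModule
  (fun c F G => coeff_injective (smul_conv θ c F.isSchwartz G.isSchwartz))
  (fun c F G => coeff_injective (conv_smul θ c F.isSchwartz G.isSchwartz))

instance : StarRing (SmoothAlgebra θ) where
  star_involutive F := coeff_injective (adj_adj θ F.coeff)
  star_mul F G := coeff_injective (adj_conv θ F.isSchwartz G.isSchwartz)
  star_add F G := coeff_injective <| by
    funext n; simp [coeff_star, coeff_add, adj]

instance : StarModule ℂ (SmoothAlgebra θ) where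
  star_smul c F := coeff_injective <| by
    funext n; simp only [coeff_star, coeff_smul, adj, Pi.smul_apply, star_smul, map_smul]

/-- The defining seminorms `‖F‖_{j,k} = ∑ₙ (1 + |n|)^k ‖∂_z^j F(n, ·)‖_∞` of `A_θ^∞`. -/
def seminormFamily (θ : ℝ) : SeminormFamily ℂ (SmoothAlgebra θ) (ℕ × ℕ) := fun jk =>
  Seminorm.of (fun F => ∑' n, wt jk.2 n * derivSup jk.1 (F.coeff n))
    (fun F G => by
      rw [← (F.isSchwartz.decay _ _).tsum_add (G.isSchwartz.decay _ _)]
      refine Summable.tsum_le_tsum (fun n => ?_) ((F + G).isSchwartz.decay _ _)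
        ((F.isSchwartz.decay _ _).add (G.isSchwartz.decay _ _))
      rw [← mul_add]
      exact mul_le_mul_of_nonneg_left
        (derivSup_add (F.isSchwartz.smooth n) (G.isSchwartz.smooth n) _) (wt_pos _ n).le)
    (fun c F => by
      rw [← tsum_mul_left]
      congr 1; ext1 n
      rw [coeff_smul, Pi.smul_apply, derivSup_smul]; ring)

instance : TopologicalSpace (SmoothAlgebra θ) := (seminormFamily θ).moduleFilterBasis.topology

theorem withSeminorms : WithSeminorms (seminormFamily θ) := ⟨rfl⟩

end SmoothAlgebra

/-- A bounded covariant pair in a Banach algebra `D`: a contractive homomorphism of `C(𝕋)`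
and a group of contractions indexed by `ℤ` that implements the rotation. -/
structure CovariantPair (θ : ℝ) (D : Type*) [NormedRing D] [NormedAlgebra ℂ D] where
  π : C(UnitAddCircle, ℂ) →ₐ[ℂ] D
  U : ℤ → D
  norm_π_le : ∀ f, ‖π f‖ ≤ ‖f‖
  norm_U_le : ∀ n, ‖U n‖ ≤ 1
  U_zero : U 0 = 1
  U_add : ∀ m n, U (m + n) = U m * U n
  cov : ∀ n f, U n * π f = π (rot θ n f) * U n

namespace CovariantPair

variable {θ : ℝ} {D : Type*} [NormedRing D] [NormedAlgebra ℂ D]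
  (p : CovariantPair θ D)

theorem norm_term_le (f : C(UnitAddCircle, ℂ)) (n : ℤ) : ‖p.π f * p.U n‖ ≤ ‖f‖ :=
  (norm_mul_le _ _).trans <| (mul_le_mul (p.norm_π_le f) (p.norm_U_le n) (norm_nonneg _)
    (norm_nonneg _)).trans_eq (mul_one _)

theorem continuous_π : Continuous p.π :=
  AddMonoidHomClass.continuous_of_bound p.π 1 fun f => by simpa using p.norm_π_le f

theorem summable_norm (F : SmoothAlgebra θ) : Summable fun n => ‖p.π (F.coeff n) * p.U n‖ :=
  Summable.of_nonneg_of_le (fun _ => norm_nonneg _) (fun n => p.norm_term_le _ n)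
    F.isSchwartz.summable_norm

variable [CompleteSpace D]

theorem summable (F : SmoothAlgebra θ) : Summable fun n => p.π (F.coeff n) * p.U n :=
  (p.summable_norm F).of_norm

theorem mul_aux (F G : SmoothAlgebra θ) :
    ∑' n, p.π ((F * G).coeff n) * p.U n =
      (∑' n, p.π (F.coeff n) * p.U n) * ∑' n, p.π (G.coeff n) * p.U n := by
  have key : ∀ m k : ℤ, p.π (F.coeff m * rot θ m (G.coeff k)) * p.U (m + k) =
      (p.π (F.coeff m) * p.U m) * (p.π (G.coeff k) * p.U k) := fun m k => by
    rw [p.U_add, map_mul]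
    calc _ = p.π (F.coeff m) * (p.π (rot θ m (G.coeff k)) * p.U m) * p.U k := by
          simp only [mul_assoc]
      _ = _ := by rw [← p.cov]; simp only [mul_assoc]
  let e : ℤ × ℤ ≃ ℤ × ℤ :=
    ⟨fun q => (q.2, q.1 - q.2), fun q => (q.1 + q.2, q.1), fun q => by simp, fun q => by simp⟩
  have hs : Summable fun q : ℤ × ℤ =>
      (p.π (F.coeff q.1) * p.U q.1) * (p.π (G.coeff q.2) * p.U q.2) :=
    summable_mul_of_summable_norm (f := fun n => p.π (F.coeff n) * p.U n)
      (g := fun n => p.π (G.coeff n) * p.U n) (p.summable_norm F) (p.summable_norm G)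
  rw [tsum_mul_tsum_of_summable_norm (p.summable_norm F) (p.summable_norm G), ← e.tsum_eq]
  have hs' := (e.summable_iff (f := fun q : ℤ × ℤ =>
      (p.π (F.coeff q.1) * p.U q.1) * (p.π (G.coeff q.2) * p.U q.2))).2 hs
  refine Eq.trans ?_ (hs'.tsum_prod (f := _)).symm
  congr 1; ext1 n
  have hc := F.isSchwartz.summable_conv_term θ G.isSchwartz n
  have h1 : p.π ((F * G).coeff n) = ∑' m, p.π (F.coeff m * rot θ m (G.coeff (n - m))) := by
    have h0 := hc.hasSum.map p.π p.continuous_π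
    exact h0.tsum_eq.symm
  have h2 : Summable fun m => p.π (F.coeff m * rot θ m (G.coeff (n - m))) :=
    hc.map p.π p.continuous_π
  rw [h1, ← h2.tsum_mul_right]
  congr 1; ext1 m
  have h3 := key m (n - m)
  rw [show m + (n - m) = n by ring] at h3
  exact h3

/-- The integrated form `F ↦ ∑ₙ π(F(n, ·)) Uⁿ` of a covariant pair. -/
def integrated : SmoothAlgebra θ →ₐ[ℂ] D := AlgHom.ofLinearMap
  { toFun := fun F => ∑' n, p.π (F.coeff n) * p.U n
    map_add' := fun F G => by
      rw [← (p.summable F).tsum_add (p.summable G)]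
      simp only [SmoothAlgebra.coeff_add, Pi.add_apply, map_add, add_mul]
    map_smul' := fun c F => by
      rw [RingHom.id_apply, ← (p.summable F).tsum_const_smul c]
      simp only [SmoothAlgebra.coeff_smul, Pi.smul_apply, map_smul, smul_mul_assoc] }
  (by
    change ∑' n, p.π ((1 : SmoothAlgebra θ).coeff n) * p.U n = 1
    rw [tsum_eq_single 0]
    · simp [SmoothAlgebra.coeff_one, p.U_zero]
    · intro n hn; simp [SmoothAlgebra.coeff_one, hn])
  p.mul_aux

theorem integrated_apply (F : SmoothAlgebra θ) :
    p.integrated F = ∑' n, p.π (F.coeff n) * p.U n := rfl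

theorem integrated_star [StarRing D] [ContinuousStar D]
    (hπ : ∀ f, star (p.π f) = p.π (star f)) (hU : ∀ n, star (p.U n) = p.U (-n))
    (F : SmoothAlgebra θ) : p.integrated (star F) = star (p.integrated F) := by
  rw [integrated_apply, integrated_apply, tsum_star, ← (Equiv.neg ℤ).tsum_eq]
  congr 1; ext1 n
  rw [Equiv.neg_apply, star_mul, hπ, hU, p.cov]
  simp only [SmoothAlgebra.coeff_star, adj, neg_neg]

end CovariantPair
/-- A (nondegenerate) covariant representation of the rotation action of `ℤ` on `𝕋` on a nonzero
Hilbert space. -/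
structure CovariantRep (θ : ℝ) where
  H : Type
  [normedAddCommGroup : NormedAddCommGroup H]
  [innerProductSpace : InnerProductSpace ℂ H]
  [completeSpace : CompleteSpace H]
  [nontrivial : Nontrivial H]
  π : C(UnitAddCircle, ℂ) →⋆ₐ[ℂ] (H →L[ℂ] H)
  U : Multiplicative ℤ →* unitary (H →L[ℂ] H)
  cov : ∀ (n : ℤ) (f : C(UnitAddCircle, ℂ)),
    (U (.ofAdd n) : H →L[ℂ] H) * π f * star (U (.ofAdd n) : H →L[ℂ] H) = π (rot θ n f)

attribute [instance] CovariantRep.normedAddCommGroup CovariantRep.innerProductSpace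
  CovariantRep.completeSpace CovariantRep.nontrivial

/-- The `C^*`-algebra of bounded families of operators, indexed by all covariant
representations. -/
abbrev UniversalTarget (θ : ℝ) : Type 1 := lp (fun r : CovariantRep θ => r.H →L[ℂ] r.H) ∞

instance (θ : ℝ) : CStarAlgebra (UniversalTarget θ) where

theorem memℓp_of_le {θ : ℝ} (g : ∀ r : CovariantRep θ, r.H →L[ℂ] r.H) (C : ℝ)
    (h : ∀ r, ‖g r‖ ≤ C) : Memℓp g ∞ :=
  memℓp_infty ⟨C, by rintro _ ⟨r, rfl⟩; exact h r⟩

theorem CovariantRep.norm_π_le {θ : ℝ} (r : CovariantRep θ) (f : C(UnitAddCircle, ℂ)) :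
    ‖r.π f‖ ≤ ‖f‖ := NonUnitalStarAlgHom.norm_apply_le r.π f

theorem CovariantRep.norm_U_le {θ : ℝ} (r : CovariantRep θ) (n : ℤ) :
    ‖(r.U (.ofAdd n) : r.H →L[ℂ] r.H)‖ ≤ 1 := (CStarRing.norm_coe_unitary _).le

theorem CovariantRep.cov' {θ : ℝ} (r : CovariantRep θ) (n : ℤ) (f : C(UnitAddCircle, ℂ)) :
    (r.U (.ofAdd n) : r.H →L[ℂ] r.H) * r.π f = r.π (rot θ n f) * r.U (.ofAdd n) := by
  rw [← r.cov, mul_assoc, mul_assoc, Unitary.coe_star_mul_self, mul_one]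

/-- The direct sum of all covariant representations. -/
def universalPair (θ : ℝ) : CovariantPair θ (UniversalTarget θ) where
  π :=
    { toFun := fun f => ⟨fun r => r.π f, memℓp_of_le _ ‖f‖ fun r => r.norm_π_le f⟩
      map_one' := by ext1; funext r; exact map_one r.π
      map_mul' := fun f g => by ext1; funext r; exact map_mul r.π f g
      map_zero' := by ext1; funext r; exact map_zero r.π
      map_add' := fun f g => by ext1; funext r; exact map_add r.π f g
      commutes' := fun c => by ext1; funext r; exact AlgHomClass.commutes r.π c }
  U := fun n => ⟨fun r => r.U (.ofAdd n), memℓp_of_le _ 1 fun r => r.norm_U_le n⟩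
  norm_π_le f := lp.norm_le_of_forall_le (norm_nonneg _) fun r => r.norm_π_le f
  norm_U_le n := lp.norm_le_of_forall_le zero_le_one fun r => r.norm_U_le n
  U_zero := by ext1; funext r; simp
  U_add m n := by ext1; funext r; simp
  cov n f := by ext1; funext r; exact r.cov' n f

/-- The full crossed product `C^*`-algebra `A_θ = C^*(ℤ, 𝕋)`: the `C^*`-algebra generated by
`C(𝕋)` and `ℤ` in the direct sum of all covariant representations. So the norm of `∑ₙ fₙ Uⁿ` is the
supremum of `‖∑ₙ π(fₙ) Uⁿ‖` over all covariant representations. (Separable Hilbert spaces already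
give this supremum, so nothing depends on the universe of the Hilbert spaces.) -/
def crossedProduct (θ : ℝ) : StarSubalgebra ℂ (UniversalTarget θ) :=
  (StarAlgebra.adjoin ℂ
    (Set.range (universalPair θ).π ∪ Set.range (universalPair θ).U)).topologicalClosure

/-- The rotation `C^*`-algebra `A_θ`. -/
def FullAlgebra (θ : ℝ) : Type 1 := crossedProduct θ

instance (θ : ℝ) : IsClosed (crossedProduct θ : Set (UniversalTarget θ)) :=
  StarSubalgebra.isClosed_topologicalClosure _

instance (θ : ℝ) : CStarAlgebra (FullAlgebra θ) := inferInstanceAs (CStarAlgebra (crossedProduct θ))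

theorem integrated_mem (θ : ℝ) (F : SmoothAlgebra θ) :
    (universalPair θ).integrated F ∈ crossedProduct θ := by
  have hs := ((universalPair θ).summable F).hasSum
  refine (StarSubalgebra.isClosed_topologicalClosure _).mem_of_tendsto hs
    (Filter.Eventually.of_forall fun s => ?_)
  refine sum_mem fun n _ => mul_mem ?_ ?_
  · exact StarSubalgebra.le_topologicalClosure _ (StarAlgebra.subset_adjoin ℂ _ (.inl ⟨_, rfl⟩))
  · exact StarSubalgebra.le_topologicalClosure _ (StarAlgebra.subset_adjoin ℂ _ (.inr ⟨_, rfl⟩))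

/-- The inclusion `A_θ^∞ → A_θ`, `F ↦ ∑ₙ π(F(n, ·)) Uⁿ`. -/
def inclusion (θ : ℝ) : SmoothAlgebra θ →⋆ₐ[ℂ] FullAlgebra θ :=
  StarAlgHom.codRestrict
    { (universalPair θ).integrated with
      map_star' := (universalPair θ).integrated_star
        (fun f => by ext1; funext r; exact (map_star r.π f).symm)
        (fun n => by
          ext1; funext r
          change star (r.U (.ofAdd n) : r.H →L[ℂ] r.H) = r.U (.ofAdd (-n))
          rw [ofAdd_neg, map_inv]; rfl) }
    (crossedProduct θ) (integrated_mem θ)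

/-- The Banach space `L¹(𝕋)`. -/
abbrev L1 : Type := Lp ℂ 1 (volume : Measure UnitAddCircle)

/-- Multiplication by a continuous function on `L¹(𝕋)`. -/
def mulL1 (f : C(UnitAddCircle, ℂ)) : L1 →L[ℂ] L1 :=
  LinearMap.mkContinuous
    { toFun := fun ψ => f.toLp ∞ volume ℂ • ψ
      map_add' := fun ψ φ => Lp.add_smul _ ψ φ
      map_smul' := fun c ψ => (Lp.smul_comm c (f.toLp ∞ volume ℂ) ψ).symm } ‖f‖ (fun ψ => by
    refine (Lp.norm_smul_le (f.toLp ∞ volume ℂ) ψ).trans ?_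
    refine mul_le_mul_of_nonneg_right ?_ (norm_nonneg ψ)
    refine ((ContinuousMap.toLp ∞ volume ℂ).le_opNorm f).trans ?_
    have h := ContinuousMap.toLp_norm_le (p := ∞) (μ := (volume : Measure UnitAddCircle))
      (E := ℂ) (𝕜 := ℂ)
    simp only [ENNReal.toReal_top, inv_zero, Real.rpow_zero] at h
    exact mul_le_of_le_one_left (norm_nonneg f) h)

theorem mulL1_coe (f : C(UnitAddCircle, ℂ)) (ψ : L1) :
    mulL1 f ψ =ᵐ[volume] fun z => f z * ψ z := by
  refine (Lp.coeFn_lpSMul (r := 1) (f.toLp ∞ volume ℂ) ψ).trans ?_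
  filter_upwards [ContinuousMap.coeFn_toLp (p := ∞) (𝕜 := ℂ) volume f] with z hz
  rw [Pi.smul_apply', hz, smul_eq_mul]

theorem norm_mulL1_le (f : C(UnitAddCircle, ℂ)) : ‖mulL1 f‖ ≤ ‖f‖ :=
  LinearMap.mkContinuous_norm_le _ (norm_nonneg f) _

theorem measurePreserving_rot (θ : ℝ) (n : ℤ) :
    MeasurePreserving (fun z : UnitAddCircle => z - n • (θ : UnitAddCircle)) volume volume :=
  measurePreserving_sub_right volume _

/-- Translation by `nθ` on `L¹(𝕋)`: `ψ ↦ ψ(· - nθ)`. -/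
def rotL1 (θ : ℝ) (n : ℤ) : L1 →L[ℂ] L1 :=
  (Lp.compMeasurePreservingₗᵢ ℂ _ (measurePreserving_rot θ n)).toContinuousLinearMap

theorem rotL1_coe (θ : ℝ) (n : ℤ) (ψ : L1) :
    rotL1 θ n ψ =ᵐ[volume] fun z => ψ (z - n • (θ : UnitAddCircle)) :=
  Lp.coeFn_compMeasurePreserving ψ (measurePreserving_rot θ n)

/-- The covariant pair on `L¹(𝕋)`: pointwise multiplication and translation. -/
def pairL1 (θ : ℝ) : CovariantPair θ (L1 →L[ℂ] L1) where
  π := AlgHom.ofLinearMap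
    { toFun := mulL1
      map_add' := fun f g => by
        ext1 ψ; apply Lp.ext
        refine (mulL1_coe _ ψ).trans ?_
        rw [add_apply]
        filter_upwards [mulL1_coe f ψ, mulL1_coe g ψ, Lp.coeFn_add (mulL1 f ψ) (mulL1 g ψ)]
          with z h1 h2 h3
        rw [h3, Pi.add_apply, h1, h2, ContinuousMap.add_apply, add_mul]
      map_smul' := fun c f => by
        ext1 ψ; apply Lp.ext
        refine (mulL1_coe _ ψ).trans ?_
        rw [RingHom.id_apply, smul_apply]
        filter_upwards [mulL1_coe f ψ, Lp.coeFn_smul c (mulL1 f ψ)] with z h1 h2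
        rw [h2, Pi.smul_apply, h1, ContinuousMap.smul_apply, smul_mul_assoc] }
    (by
      ext1 ψ; apply Lp.ext
      refine (mulL1_coe _ ψ).trans ?_
      simp)
    (fun f g => by
      ext1 ψ; apply Lp.ext
      refine (mulL1_coe _ ψ).trans ?_
      change _ =ᵐ[volume] mulL1 f (mulL1 g ψ)
      filter_upwards [mulL1_coe f (mulL1 g ψ), mulL1_coe g ψ] with z h1 h2
      rw [h1, h2, ContinuousMap.mul_apply, mul_assoc])
  U := rotL1 θ
  norm_π_le := norm_mulL1_le
  norm_U_le n := LinearIsometry.norm_toContinuousLinearMap_le _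
  U_zero := by
    ext1 ψ; apply Lp.ext
    refine (rotL1_coe θ 0 ψ).trans ?_
    simp
  U_add m n := by
    ext1 ψ; apply Lp.ext
    refine (rotL1_coe θ (m + n) ψ).trans ?_
    change _ =ᵐ[volume] rotL1 θ m (rotL1 θ n ψ)
    filter_upwards [rotL1_coe θ m (rotL1 θ n ψ),
      (measurePreserving_rot θ m).quasiMeasurePreserving.ae (rotL1_coe θ n ψ)] with z h1 h2
    rw [h1, h2]
    congr 1; rw [add_smul]; abel
  cov n f := by
    ext1 ψ; apply Lp.ext
    change rotL1 θ n (mulL1 f ψ) =ᵐ[volume] mulL1 (rot θ n f) (rotL1 θ n ψ)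
    filter_upwards [rotL1_coe θ n (mulL1 f ψ), mulL1_coe (rot θ n f) (rotL1 θ n ψ),
      rotL1_coe θ n ψ, (measurePreserving_rot θ n).quasiMeasurePreserving.ae (mulL1_coe f ψ)]
      with z h1 h2 h3 h4
    rw [h1, h2, h3, h4, rot_apply]

/-- The action of `A_θ^∞` on `L¹(𝕋)`, `F ψ = ∑ₙ F(n, ·) ψ(· - nθ)` (a series that converges
in `L¹(𝕋)`). -/
instance (θ : ℝ) : Module (SmoothAlgebra θ) L1 :=
  Module.compHom L1 ((pairL1 θ).integrated : SmoothAlgebra θ →+* (L1 →L[ℂ] L1))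

theorem smul_L1_def {θ : ℝ} (F : SmoothAlgebra θ) (ψ : L1) :
    F • ψ = (pairL1 θ).integrated F ψ := rfl

instance (θ : ℝ) : IsScalarTower ℂ (SmoothAlgebra θ) L1 :=
  ⟨fun c F ψ => by rw [smul_L1_def, smul_L1_def, map_smul]; rfl⟩

/-- `ξ` is nonnegative, smooth away from `p`, and grows like `|z - p|^{-1/2}` at `p`. -/
structure HasInvSqrtSingularity (p : UnitAddCircle) (ξ : UnitAddCircle → ℝ) : Prop where
  nonneg : ∀ z, 0 ≤ ξ z
  smooth : ContDiffOn ℝ ∞ (fun x : ℝ => ξ (x : UnitAddCircle)) {x : ℝ | (x : UnitAddCircle) ≠ p}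
  growth : ξ =Θ[𝓝[≠] p] fun z => ‖z - p‖ ^ (-(1 / 2) : ℝ)

end RotationAlgebra

/-- A Fréchet space: a complete Hausdorff space whose topology is given by a sequence of
seminorms. -/
structure IsFrechetSpace (V : Type*) [AddCommGroup V] [Module ℂ V] [TopologicalSpace V] :
    Prop where
  exists_seminorms : ∃ p : SeminormFamily ℂ V ℕ, WithSeminorms p
  t2 : T2Space V
  complete : ∀ u : ℕ → V, (∀ W ∈ 𝓝 (0 : V), ∃ N, ∀ m ≥ N, ∀ n ≥ N, u m - u n ∈ W) →
    ∃ v, Tendsto u atTop (𝓝 v)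

/-- An `m`-convex Fréchet algebra. -/
structure IsMConvexFrechetAlgebra (A : Type*) [Ring A] [Algebra ℂ A] [TopologicalSpace A] :
    Prop where
  frechet : IsFrechetSpace A
  mconvex : ∃ p : SeminormFamily ℂ A ℕ, WithSeminorms p ∧
    ∃ C : ℕ → ℝ, ∀ n a b, p n (a * b) ≤ C n * p n a * p n b

/-- Spectral invariance of a unital subalgebra, given by its inclusion `ι : A → B`. -/
def IsSpectralInvariant {A B : Type*} [Ring A] [Algebra ℂ A] [Ring B] [Algebra ℂ B]
    (ι : A →ₐ[ℂ] B) : Prop := ∀ a, IsUnit a ↔ IsUnit (ι a)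

/-- `E` is nonzero and has no closed `A`-invariant subspaces besides `{0}` and `E`. -/
def IsTopologicallyIrreducible (A E : Type*) [Ring A] [AddCommGroup E] [TopologicalSpace E]
    [Module A E] : Prop :=
  Nontrivial E ∧ ∀ N : Submodule A E, IsClosed (N : Set E) → N = ⊥ ∨ N = ⊤

section Cyclic

variable {A E : Type*} [Ring A] [AddCommGroup E] [Module A E]

variable (A) in
/-- The algebraically cyclic submodule `A e`. -/
def cyclicSubmodule (e : E) : Submodule A E := (LinearMap.toSpanSingleton A E e).range

variable (A) in
/-- The quotient topology on `A e`, from the surjection `A → A e`, `a ↦ a e`. -/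
abbrev cyclicTopology [TopologicalSpace A] (e : E) : TopologicalSpace (cyclicSubmodule A e) :=
  TopologicalSpace.coinduced (LinearMap.toSpanSingleton A E e).rangeRestrict inferInstance

variable [Algebra ℂ A] [TopologicalSpace A] [Module ℂ E] [IsScalarTower ℂ A E]
  {B : Type*} [Ring B] [Algebra ℂ B]

/-- The algebraically cyclic `A`-module `A e` (with its quotient topology) is continuously
contained in the `B`-module `X`, where `A` is a subalgebra of `B` via `ι`. -/
def CyclicContainedInModule (ι : A →ₐ[ℂ] B) (e : E) (X : Type*) [AddCommGroup X] [Module ℂ X]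
    [TopologicalSpace X] [Module B X] : Prop :=
  ∃ J : cyclicSubmodule A e →ₗ[ℂ] X, Function.Injective J ∧
    Continuous[cyclicTopology A e, inferInstance] J ∧ ∀ (a : A) (x), J (a • x) = ι a • J x

/-- The algebraically cyclic `A`-module `A e` (with its quotient topology) is continuously
contained in the `⋆`-representation `π` of `B` on the Hilbert space `H`. -/
def CyclicContainedInStarRep [StarRing B] (ι : A →ₐ[ℂ] B) (e : E) {H : Type*}
    [NormedAddCommGroup H] [InnerProductSpace ℂ H] [CompleteSpace H]
    (π : B →⋆ₙₐ[ℂ] (H →L[ℂ] H)) : Prop :=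
  ∃ J : cyclicSubmodule A e →ₗ[ℂ] H, Function.Injective J ∧
    Continuous[cyclicTopology A e, inferInstance] J ∧ ∀ (a : A) (x), J (a • x) = π (ι a) (J x)

end Cyclic

/-- Every algebraically cyclic submodule of every topologically irreducible Banach `A`-module is
contained in a (continuous Fréchet) `B`-module. -/
def CyclicSubmodulesExtend.{e, x, a, b} {A : Type a} {B : Type b} [Ring A] [Algebra ℂ A]
    [TopologicalSpace A] [Ring B] [Algebra ℂ B] [TopologicalSpace B] (ι : A →ₐ[ℂ] B) : Prop :=
  ∀ (E : Type e) [NormedAddCommGroup E] [NormedSpace ℂ E] [CompleteSpace E] [Module A E]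
    [IsScalarTower ℂ A E] [ContinuousSMul A E], IsTopologicallyIrreducible A E → ∀ v : E,
    ∃ (X : Type x) (_ : AddCommGroup X) (_ : Module ℂ X) (_ : TopologicalSpace X)
      (_ : Module B X) (_ : IsScalarTower ℂ B X),
      IsFrechetSpace X ∧ ContinuousSMul B X ∧ CyclicContainedInModule ι v X

end

open RotationAlgebra

universe u v

/-! Spectral invariance. For `u, z` in `𝕋` let `ℤ` and `C(𝕋)` act on `ℓ²(ℤ)` by shifts twisted by
the character `u` and by multiplication with values along the orbit `z + mθ`. The matrix entries of
the resulting operator `orbitOp u z F` are the numbers `F(m - l, z + mθ)` up to a phase, so these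
operators determine `F`. Rapid decay in `n` and smoothness in `z` make the operator a smooth
function of `(u, z)` in norm (`contDiff_orbitOp`). If `F` is invertible in `A_θ`, all these
operators are invertible, and their inverses again depend smoothly on `(u, z)`. Changing `u`
conjugates by a diagonal unitary, so each `u`-derivative multiplies the `n`-th entry of the inverse
by `2πin`; bounded derivatives therefore mean rapidly decaying entries, and the entries form an
inverse of `F` in `A_θ^∞` (`isUnit_of_isUnit_orbitOp`).

Irreducibility of `L¹`. Averages of irrational rotations converge to the mean, uniformly on `C(𝕋)`
and hence in norm on `L¹(𝕋)`. A nonzero closed submodule contains a function of nonzero mean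
(otherwise all Fourier coefficients of all its elements vanish), so it contains the constant `1`,
then all trigonometric polynomials, and these are dense.

The singular vector. For a suitable smooth cutoff `f` that vanishes near `p`, the function `g = fξ`
is smooth and nonzero. A finite average of rotations of `|g|²` is close to the positive constant
`∫|g|²`, so it is nowhere zero and has a smooth inverse: already algebraically, `1 ∈ A ξ`
(`toL1_one_mem_cyclicSubmodule`). The submodule `A 1` consists of bounded functions, so it misses
`ξ`, and `A ξ` is not simple.

Suppose that `ξ` corresponds to a vector `x` of a Hilbert space representation, and let `1 = aξ`
correspond to `η = ax ≠ 0`. Then `η` is invariant under `U`, so unique ergodicity gives `‖gη‖² =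
‖η‖² ∫|g|²`. But `gη = fx` has norm at most `‖x‖` when `|f| ≤ 1`, while `∫|fξ|²` is unbounded over
such cutoffs because `ξ ∉ L²`. For general topological modules there is no norm on the vectors; the
same argument runs inside `A_θ`, with the closed left ideal that annihilates `x` in place of `x`
(`false_of_leftIdeal`). An approximate annihilator of finitely many elements of that ideal turns the
relations modulo the ideal into norm estimates. -/

noncomputable section

/-! ### The Fréchet algebra structure of `A_θ^∞`. -/

namespace RotationAlgebra

theorem wt_mono {k l : ℕ} (h : k ≤ l) (n : ℤ) : wt k n ≤ wt l n :=
  pow_le_pow_right₀ (by linarith [abs_nonneg (n : ℝ)]) h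

theorem tsum_conv {a b : ℤ → ℝ} (ha : Summable a) (hb : Summable b)
    (ha0 : ∀ n, 0 ≤ a n) (hb0 : ∀ n, 0 ≤ b n) :
    ∑' n, ∑' m, a m * b (n - m) = (∑' n, a n) * ∑' n, b n := by
  let e : ℤ × ℤ ≃ ℤ × ℤ :=
    ⟨fun p => (p.2, p.1 - p.2), fun p => (p.1 + p.2, p.1), fun p => by simp, fun p => by simp⟩
  rw [ha.tsum_mul_tsum hb (ha.mul_of_nonneg hb ha0 hb0), ← e.tsum_eq]
  exact ((summable_conv ha hb ha0 hb0).tsum_prod (f := fun p : ℤ × ℤ => a p.2 * b (p.1 - p.2))).symm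

namespace SmoothAlgebra

variable {θ : ℝ}

theorem coeff_sub (F G : SmoothAlgebra θ) : (F - G).coeff = F.coeff - G.coeff := rfl

theorem coeff_sum {ι : Type*} (s : Finset ι) (F : ι → SmoothAlgebra θ) (n : ℤ) :
    (∑ i ∈ s, F i).coeff n = ∑ i ∈ s, (F i).coeff n := by
  classical
  induction s using Finset.induction_on with
  | empty => simp [coeff_zero]
  | insert a s ha ih => rw [Finset.sum_insert ha, Finset.sum_insert ha, coeff_add, Pi.add_apply, ih]

theorem wt_mul_derivSup_le (F : SmoothAlgebra θ) (j k : ℕ) (n : ℤ) :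
    wt k n * derivSup j (F.coeff n) ≤ seminormFamily θ (j, k) F :=
  (F.isSchwartz.decay j k).le_tsum n fun m _ => mul_nonneg (wt_pos k m).le (derivSup_nonneg _ _)

theorem seminormFamily_mono (j : ℕ) {k l : ℕ} (h : k ≤ l) :
    seminormFamily θ (j, k) ≤ seminormFamily θ (j, l) := fun F =>
  (F.isSchwartz.decay j k).tsum_le_tsum
    (fun n => mul_le_mul_of_nonneg_right (wt_mono h n) (derivSup_nonneg _ _))
    (F.isSchwartz.decay j l)

theorem tsum_norm_coeff_le (F : SmoothAlgebra θ) :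
    ∑' n, ‖F.coeff n‖ ≤ seminormFamily θ (0, 0) F := by
  refine F.isSchwartz.summable_norm.tsum_le_tsum (fun n => ?_) (F.isSchwartz.decay 0 0)
  simpa [wt] using norm_le_derivSup (F.isSchwartz.smooth n)

-- The Leibniz rule in `z` combines with the submultiplicative weight `wt_le` in `n`; for each `i`
-- the twisted convolution is then dominated by an ordinary convolution on `ℤ`, whose `ℓ¹` norm
-- factors.
set_option maxHeartbeats 1000000 in
theorem seminormFamily_mul_le (j k : ℕ) (F G : SmoothAlgebra θ) :
    seminormFamily θ (j, k) (F * G) ≤ ∑ i ∈ Finset.range (j + 1), (j.choose i : ℝ) *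
      (seminormFamily θ (i, k) F * seminormFamily θ (j - i, k) G) := by
  have h0 : ∀ (H : SmoothAlgebra θ) i n, 0 ≤ wt k n * derivSup i (H.coeff n) := fun H i n =>
    mul_nonneg (wt_pos k n).le (derivSup_nonneg _ _)
  let w : ℕ → ℤ → ℤ → ℝ := fun i n m => (wt k m * derivSup i (F.coeff m)) *
    (wt k (n - m) * derivSup (j - i) (G.coeff (n - m)))
  have hw : ∀ i, Summable fun p : ℤ × ℤ => w i p.1 p.2 := fun i =>
    summable_conv (F.isSchwartz.decay i k) (G.isSchwartz.decay (j - i) k) (h0 F i) (h0 G (j - i))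
  have hW : ∀ n, Summable fun m => ∑ i ∈ Finset.range (j + 1), (j.choose i : ℝ) * w i n m :=
    fun n => summable_sum fun i _ => ((hw i).prod_factor n).mul_left _
  -- The weight stands on the right, so that `smooth_tsum` can be applied to the unweighted series
  -- before multiplying back.
  have hle : ∀ n m, derivSup j (F.coeff m * rot θ m (G.coeff (n - m))) ≤
      (wt k n)⁻¹ * ∑ i ∈ Finset.range (j + 1), (j.choose i : ℝ) * w i n m := by
    intro n m
    rw [← div_eq_inv_mul, le_div_iff₀' (wt_pos k n)]
    refine (mul_le_mul_of_nonneg_left (derivSup_mul (F.isSchwartz.smooth m)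
      ((G.isSchwartz.smooth (n - m)).rot θ m) j) (wt_pos k n).le).trans ?_
    rw [Finset.mul_sum]
    refine Finset.sum_le_sum fun i _ => ?_
    rw [derivSup_rot]
    refine (mul_le_mul_of_nonneg_right (wt_le k n m)
      (mul_nonneg (mul_nonneg (Nat.cast_nonneg (j.choose i)) (derivSup_nonneg i (F.coeff m)))
        (derivSup_nonneg (j - i) (G.coeff (n - m))))).trans (le_of_eq ?_)
    simp only [w]; ring
  have hterm : ∀ n, wt k n * derivSup j ((F * G).coeff n) ≤
      ∑' m, ∑ i ∈ Finset.range (j + 1), (j.choose i : ℝ) * w i n m := by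
    intro n
    have hs : ∀ l, Summable fun m => derivSup l (F.coeff m * rot θ m (G.coeff (n - m))) := by
      intro l
      refine Summable.of_nonneg_of_le (fun m => derivSup_nonneg _ _) (fun m => (derivSup_mul
        (F.isSchwartz.smooth m) ((G.isSchwartz.smooth (n - m)).rot θ m) l)) ?_
      refine summable_sum fun i _ => ?_
      simp only [derivSup_rot, mul_assoc]
      exact ((summable_conv (F.isSchwartz.summable_derivSup i)
        (G.isSchwartz.summable_derivSup (l - i)) (fun _ => derivSup_nonneg _ _)
        (fun _ => derivSup_nonneg _ _)).prod_factor n).mul_left _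
    have h1 := (smooth_tsum (fun m => (F.isSchwartz.smooth m).mul
      ((G.isSchwartz.smooth (n - m)).rot θ m)) hs).2 j
    have h2 := h1.trans ((hs j).tsum_le_tsum (hle n) ((hW n).mul_left _))
    rw [tsum_mul_left, ← div_eq_inv_mul, le_div_iff₀' (wt_pos k n)] at h2
    exact h2
  have hsum : ∀ n, ∑' m, ∑ i ∈ Finset.range (j + 1), (j.choose i : ℝ) * w i n m =
      ∑ i ∈ Finset.range (j + 1), (j.choose i : ℝ) * ∑' m, w i n m := by
    intro n
    rw [Summable.tsum_finsetSum fun i _ => ((hw i).prod_factor n).mul_left _]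
    simp only [tsum_mul_left]
  have hS : Summable fun n => ∑ i ∈ Finset.range (j + 1), (j.choose i : ℝ) * ∑' m, w i n m :=
    summable_sum fun i _ => ((hw i).prod.mul_left _)
  refine (((F * G).isSchwartz.decay j k).tsum_le_tsum
    (fun n => (hterm n).trans_eq (hsum n)) hS).trans_eq ?_
  rw [Summable.tsum_finsetSum fun i _ => ((hw i).prod.mul_left _)]
  refine Finset.sum_congr rfl fun i _ => ?_
  rw [tsum_mul_left, tsum_conv (F.isSchwartz.decay i k) (G.isSchwartz.decay (j - i) k)
    (h0 F i) (h0 G (j - i))]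
  rfl

/-- An increasing sequence of seminorms that defines the topology of `A_θ^∞`. -/
def supSeminorm (θ : ℝ) : SeminormFamily ℂ (SmoothAlgebra θ) ℕ := fun n =>
  (Finset.range (n + 1)).sup fun j => seminormFamily θ (j, n)

theorem seminormFamily_le_supSeminorm {j k n : ℕ} (hj : j ≤ n) (hk : k ≤ n) :
    seminormFamily θ (j, k) ≤ supSeminorm θ n :=
  (seminormFamily_mono j hk).trans
    (Finset.le_sup (f := fun j => seminormFamily θ (j, n)) (Finset.mem_range_succ_iff.2 hj))

theorem withSeminorms_supSeminorm : WithSeminorms (supSeminorm θ) := by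
  refine withSeminorms.congr (fun n => ?_) fun jk => ?_
  · refine ⟨(Finset.range (n + 1)).image fun j => (j, n), 1, ?_⟩
    rw [one_smul, Finset.sup_image]
    exact le_rfl
  · refine ⟨{max jk.1 jk.2}, 1, ?_⟩
    rw [one_smul, Finset.sup_singleton]
    exact seminormFamily_le_supSeminorm (le_max_left _ _) (le_max_right _ _)

/-- The supremum over `j ≤ n` dominates every factor of the Leibniz sum, so only the sum `2 ^ j` of
the binomial coefficients remains. -/
theorem supSeminorm_mul_le (n : ℕ) (F G : SmoothAlgebra θ) :
    supSeminorm θ n (F * G) ≤ 2 ^ n * supSeminorm θ n F * supSeminorm θ n G := by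
  refine Seminorm.finset_sup_apply_le (by positivity) fun j hj => ?_
  have hj' : j ≤ n := Finset.mem_range_succ_iff.1 hj
  refine (seminormFamily_mul_le j n F G).trans ?_
  have h1 : ∀ i ∈ Finset.range (j + 1), (j.choose i : ℝ) *
      (seminormFamily θ (i, n) F * seminormFamily θ (j - i, n) G) ≤
      (j.choose i : ℝ) * (supSeminorm θ n F * supSeminorm θ n G) := fun i hi => by
    have hi' : i ≤ j := Finset.mem_range_succ_iff.1 hi
    gcongr
    · exact seminormFamily_le_supSeminorm (hi'.trans hj') le_rfl F
    · exact seminormFamily_le_supSeminorm ((Nat.sub_le _ _).trans hj') le_rfl G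
  refine (Finset.sum_le_sum h1).trans ?_
  rw [← Finset.sum_mul, mul_assoc]
  have h2 : ∑ i ∈ Finset.range (j + 1), (j.choose i : ℝ) = 2 ^ j := by
    exact_mod_cast Nat.sum_range_choose j
  rw [h2]
  gcongr
  norm_num

/-- Completeness in terms of absolutely convergent series: the sum is formed coefficientwise in
`C(𝕋)`, and exchanging the sums over `m` and `n` bounds its seminorms. -/
theorem hasSum_of_summable_seminorm {v : ℤ → SmoothAlgebra θ}
    (hv : ∀ jk, Summable fun m => seminormFamily θ jk (v m)) : ∃ S, HasSum v S := by
  have hp : ∀ (w : ℤ → SmoothAlgebra θ) jk, (Summable fun m => seminormFamily θ jk (w m)) →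
      Summable fun p : ℤ × ℤ => wt jk.2 p.2 * derivSup jk.1 ((w p.1).coeff p.2) := by
    intro w jk hw
    refine (summable_prod_of_nonneg fun p => ?_).2 ⟨fun m => (w m).isSchwartz.decay _ _, hw⟩
    exact mul_nonneg (wt_pos _ _).le (derivSup_nonneg _ _)
  have hd : ∀ (w : ℤ → SmoothAlgebra θ), (∀ jk, Summable fun m => seminormFamily θ jk (w m)) →
      ∀ n j, Summable fun m => derivSup j ((w m).coeff n) := by
    intro w hw n j
    refine Summable.of_nonneg_of_le (fun m => derivSup_nonneg _ _) (fun m => ?_) (hw (j, 0))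
    simpa [wt] using wt_mul_derivSup_le (w m) j 0 n
  -- Stated for arbitrary `w` because it serves twice: for `v`, to construct the sum, and for the
  -- tails of `v`, to prove convergence.
  have key : ∀ (w : ℤ → SmoothAlgebra θ), (∀ jk, Summable fun m => seminormFamily θ jk (w m)) →
      ∃ h : IsSchwartz fun n => ∑' m, (w m).coeff n, ∀ jk,
        seminormFamily θ jk (mk _ h) ≤ ∑' m, seminormFamily θ jk (w m) := by
    intro w hw
    have hs := fun n => smooth_tsum (fun m => (w m).isSchwartz.smooth n) (hd w hw n)
    have hle : ∀ j k n, wt k n * derivSup j (∑' m, (w m).coeff n) ≤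
        ∑' m, wt k n * derivSup j ((w m).coeff n) := fun j k n => by
      rw [tsum_mul_left]
      exact mul_le_mul_of_nonneg_left ((hs n).2 j) (wt_pos _ _).le
    have hS : ∀ j k, Summable fun n => ∑' m, wt k n * derivSup j ((w m).coeff n) := fun j k =>
      (hp w (j, k) (hw (j, k))).prod_symm.prod
    have hI : IsSchwartz fun n => ∑' m, (w m).coeff n := ⟨fun n => (hs n).1, fun j k =>
      Summable.of_nonneg_of_le (fun n => mul_nonneg (wt_pos k n).le (derivSup_nonneg _ _))
        (hle j k) (hS j k)⟩
    refine ⟨hI, fun jk => ?_⟩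
    refine ((hI.decay jk.1 jk.2).tsum_le_tsum (hle jk.1 jk.2) (hS jk.1 jk.2)).trans_eq ?_
    exact (hp w jk (hw jk)).tsum_comm
  obtain ⟨hS, -⟩ := key v hv
  refine ⟨mk _ hS, (withSeminorms.tendsto_nhds _ _).2 fun jk ε hε => ?_⟩
  have ht := tendsto_tsum_compl_atTop_zero fun m => seminormFamily θ jk (v m)
  filter_upwards [ht.eventually (gt_mem_nhds hε)] with s hs
  refine lt_of_le_of_lt ?_ hs
  classical
  let w : ℤ → SmoothAlgebra θ := fun m => if m ∈ s then 0 else v m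
  have hwle : ∀ jk, (fun m => seminormFamily θ jk (w m)) =
      (↑s : Set ℤ)ᶜ.indicator fun m => seminormFamily θ jk (v m) := by
    intro jk; ext1 m
    by_cases hm : m ∈ s <;> simp [w, hm]
  obtain ⟨hw, hb⟩ := key w fun jk => by rw [hwle]; exact (hv jk).indicator _
  have hb' := hb jk
  rw [hwle, ← tsum_subtype] at hb'
  refine le_trans (le_of_eq ?_) hb'
  rw [← map_neg_eq_map, neg_sub]
  congr 1
  refine coeff_injective (funext fun n => ?_)
  rw [coeff_sub, Pi.sub_apply, coeff_sum]
  change ∑' m, (v m).coeff n - _ = ∑' m, (w m).coeff n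
  have hvs : Summable fun m => (v m).coeff n := Summable.of_norm_bounded (hd v hv n 0)
    fun m => norm_le_derivSup ((v m).isSchwartz.smooth n)
  rw [sub_eq_iff_eq_add', ← hvs.sum_add_tsum_compl (s := s),
    tsum_subtype ((↑s : Set ℤ)ᶜ) fun m => (v m).coeff n]
  congr 2
  ext1 m
  by_cases hm : m ∈ s <;> simp [w, hm, coeff_zero]

instance : IsTopologicalAddGroup (SmoothAlgebra θ) := withSeminorms.topologicalAddGroup

theorem eq_zero_of_seminorm (F : SmoothAlgebra θ) (h : seminormFamily θ (0, 0) F = 0) : F = 0 := by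
  refine coeff_injective (funext fun n => ?_)
  have h1 := wt_mul_derivSup_le F 0 0 n
  rw [h] at h1
  have h2 := norm_le_derivSup (F.isSchwartz.smooth n)
  have h3 : ‖F.coeff n‖ ≤ 0 := h2.trans (by simpa [wt] using h1)
  simpa [coeff_zero] using h3

instance : T2Space (SmoothAlgebra θ) := by
  have := withSeminorms.T1_of_separating (p := seminormFamily θ) fun F hF => by
    by_contra! h
    exact hF (eq_zero_of_seminorm F (h (0, 0)))
  infer_instance

-- A subsequence whose increments are below `2⁻ᵏ` in the `k`-th seminorm telescopes to an absolutely
-- convergent series; the Cauchy condition carries its limit over to the whole sequence.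
set_option maxHeartbeats 1000000 in
theorem exists_tendsto_of_cauchy (u : ℕ → SmoothAlgebra θ)
    (hu : ∀ W ∈ 𝓝 (0 : SmoothAlgebra θ), ∃ N, ∀ m ≥ N, ∀ n ≥ N, u m - u n ∈ W) :
    ∃ v, Tendsto u atTop (𝓝 v) := by
  have h1 : ∀ k, ∃ N, ∀ m ≥ N, ∀ n ≥ N, supSeminorm θ k (u m - u n) < (1 / 2) ^ k := by
    intro k
    refine hu {x | supSeminorm θ k x < (1 / 2) ^ k} ?_
    refine (withSeminorms_supSeminorm.continuous_seminorm k).continuousAt.eventually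
      (gt_mem_nhds ?_)
    rw [map_zero]; positivity
  obtain ⟨φ, hφ, hφ'⟩ := extraction_forall_of_eventually
    (P := fun k N => ∀ m ≥ N, ∀ n ≥ N, supSeminorm θ k (u m - u n) < (1 / 2) ^ k) fun k => by
      obtain ⟨N, hN⟩ := h1 k
      exact eventually_atTop.2 ⟨N, fun M hM m hm n hn => hN m (hM.trans hm) n (hM.trans hn)⟩
  let w : ℕ → SmoothAlgebra θ := fun k => u (φ (k + 1)) - u (φ k)
  have hw : ∀ jk, Summable fun k => seminormFamily θ jk (w k) := by
    intro jk
    -- A fixed seminorm `(j, k)` is dominated by the `m`-th increasing seminorm only for `m ≥ max j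
    -- k`, hence an eventual bound.
    refine Summable.of_norm_bounded_eventually_nat summable_geometric_two
      (eventually_atTop.2 ⟨max jk.1 jk.2, fun k hk => ?_⟩)
    rw [Real.norm_of_nonneg (apply_nonneg _ _)]
    refine (seminormFamily_le_supSeminorm ((le_max_left _ _).trans hk)
      ((le_max_right _ _).trans hk) (w k)).trans ?_
    exact (hφ' k _ (hφ.monotone (Nat.le_succ k)) _ le_rfl).le
  obtain ⟨S, hS⟩ := hasSum_of_summable_seminorm (v := w ∘ Equiv.intEquivNat) fun jk =>
    Equiv.intEquivNat.summable_iff.2 (hw jk)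
  have hS' := (Equiv.intEquivNat.hasSum_iff.1 hS).tendsto_sum_nat
  simp only [w, Finset.sum_range_sub fun k => u (φ k)] at hS'
  have hlim : Tendsto (fun k => u (φ k)) atTop (𝓝 (S + u (φ 0))) := by
    simpa using hS'.add_const (u (φ 0))
  refine ⟨S + u (φ 0), ?_⟩
  have hd : Tendsto (fun n => u n - u (φ n)) atTop (𝓝 0) := fun W hW => by
    obtain ⟨N, hN⟩ := hu W hW
    exact mem_map.2 (mem_atTop_sets.2
      ⟨N, fun n hn => hN n hn _ (hn.trans (hφ.id_le n))⟩)
  simpa using hd.add hlim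

theorem isMConvexFrechetAlgebra : IsMConvexFrechetAlgebra (SmoothAlgebra θ) where
  frechet := ⟨⟨_, withSeminorms_supSeminorm⟩, inferInstance, exists_tendsto_of_cauchy⟩
  mconvex := ⟨_, withSeminorms_supSeminorm, fun n => 2 ^ n, supSeminorm_mul_le⟩

/-- The element `f Uⁿ` of `A_θ^∞`. -/
def single (θ : ℝ) (n : ℤ) (f : C(UnitAddCircle, ℂ)) (hf : IsSmooth f) : SmoothAlgebra θ :=
  mk (Pi.single n f) <| by
    refine ⟨fun m => ?_, fun j k => summable_of_ne_finset_zero (s := {n}) fun m hm => ?_⟩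
    · by_cases h : m = n
      · subst h; simpa using hf
      · simpa [h] using IsSmooth.zero
    · have : m ≠ n := by simpa using hm
      simp [this, derivSup_zero]

theorem coeff_single (n : ℤ) (f : C(UnitAddCircle, ℂ)) (hf : IsSmooth f) :
    (single θ n f hf).coeff = Pi.single n f := rfl

end SmoothAlgebra

namespace CovariantPair

variable {θ : ℝ} {D : Type*} [NormedRing D] [NormedAlgebra ℂ D] [CompleteSpace D]
  (p : CovariantPair θ D)

theorem integrated_single (n : ℤ) (f : C(UnitAddCircle, ℂ)) (hf : IsSmooth f) :
    p.integrated (SmoothAlgebra.single θ n f hf) = p.π f * p.U n := by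
  rw [integrated_apply, tsum_eq_single n]
  · simp [SmoothAlgebra.coeff_single]
  · intro m hm; simp [SmoothAlgebra.coeff_single, hm]

theorem norm_integrated_le (F : SmoothAlgebra θ) :
    ‖p.integrated F‖ ≤ SmoothAlgebra.seminormFamily θ (0, 0) F :=
  (tsum_of_norm_bounded F.isSchwartz.summable_norm.hasSum
    fun n => p.norm_term_le _ n).trans F.tsum_norm_coeff_le

theorem continuous_integrated : Continuous (p.integrated : SmoothAlgebra θ → D) := by
  refine WithSeminorms.continuous_normedSpace_rng D (SmoothAlgebra.withSeminorms (θ := θ))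
    p.integrated.toLinearMap ⟨{(0, 0)}, 1, fun F => ?_⟩
  simpa using p.norm_integrated_le F

end CovariantPair

end RotationAlgebra

end

/-! ### Ergodic averages and irreducibility of `L¹(𝕋)`. -/

noncomputable section

namespace RotationAlgebra

/-- Averages of contractions converge everywhere if they converge on a set with dense span. -/
theorem tendsto_average_of_dense {E : Type*} [NormedAddCommGroup E] [NormedSpace ℂ E]
    {T : ℕ → E →L[ℂ] E} (hT : ∀ n, ‖T n‖ ≤ 1) (Q : E →L[ℂ] E) {s : Set E}
    (hs : Dense (Submodule.span ℂ s : Set E))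
    (h : ∀ x ∈ s, Tendsto (fun N : ℕ => (N : ℂ)⁻¹ • ∑ n ∈ Finset.range N, T n x) atTop (𝓝 (Q x)))
    (x : E) : Tendsto (fun N : ℕ => (N : ℂ)⁻¹ • ∑ n ∈ Finset.range N, T n x) atTop (𝓝 (Q x)) := by
  have hspan : ∀ y ∈ Submodule.span ℂ s,
      Tendsto (fun N : ℕ => (N : ℂ)⁻¹ • ∑ n ∈ Finset.range N, T n y) atTop (𝓝 (Q y)) := by
    intro y hy
    induction hy using Submodule.span_induction with
    | mem x hx => exact h x hx
    | zero => simp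
    | add x y _ _ hx hy => simpa [Finset.sum_add_distrib] using hx.add hy
    | smul c x _ hx => simpa [← Finset.smul_sum, smul_comm c] using hx.const_smul c
  have hM : ∀ (N : ℕ) (y : E), ‖(N : ℂ)⁻¹ • ∑ n ∈ Finset.range N, T n y‖ ≤ ‖y‖ := by
    intro N y
    rcases Nat.eq_zero_or_pos N with rfl | hN
    · simp
    have h1 : ‖∑ n ∈ Finset.range N, T n y‖ ≤ N * ‖y‖ := by
      refine (norm_sum_le_of_le _ fun n _ => (T n).le_of_opNorm_le (hT n) y).trans_eq ?_
      simp
    rw [norm_smul, norm_inv, Complex.norm_natCast, inv_mul_le_iff₀ (by positivity)]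
    exact h1
  rw [Metric.tendsto_atTop]
  intro ε hε
  -- Replacing `x` by `y` costs `‖x - y‖` in the average and `‖Q‖ ‖x - y‖` in the limit, together
  -- less than `ε / 2`.
  obtain ⟨y, hy, hxy⟩ := Metric.dense_iff.1 hs x (ε / (2 * (1 + ‖Q‖))) (by positivity)
  rw [Metric.mem_ball, dist_comm, dist_eq_norm] at hy
  obtain ⟨N₀, hN₀⟩ := Metric.tendsto_atTop.1 (hspan y hxy) (ε / 2) (by positivity)
  refine ⟨N₀, fun N hN => ?_⟩
  have h1 := hN₀ N hN
  rw [dist_eq_norm] at h1 ⊢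
  have h2 := hM N (x - y)
  have h3 := Q.le_opNorm (x - y)
  have h4 : (N : ℂ)⁻¹ • ∑ n ∈ Finset.range N, T n x - Q x =
      (N : ℂ)⁻¹ • ∑ n ∈ Finset.range N, T n (x - y) +
      ((N : ℂ)⁻¹ • ∑ n ∈ Finset.range N, T n y - Q y) - Q (x - y) := by
    simp only [map_sub, Finset.sum_sub_distrib, smul_sub]; abel
  have h5 : (1 + ‖Q‖) * ‖x - y‖ < ε / 2 := by
    rw [lt_div_iff₀ (by positivity)] at hy
    nlinarith
  rw [h4]
  refine (norm_sub_le _ _).trans_lt ?_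
  linarith [norm_add_le ((N : ℂ)⁻¹ • ∑ n ∈ Finset.range N, T n (x - y))
    ((N : ℂ)⁻¹ • ∑ n ∈ Finset.range N, T n y - Q y)]

/-- The geometric sums stay bounded by `2 / ‖c - 1‖`. -/
theorem tendsto_average_pow {c : ℂ} (hc : ‖c‖ = 1) (hc1 : c ≠ 1) :
    Tendsto (fun N : ℕ => (N : ℂ)⁻¹ * ∑ n ∈ Finset.range N, c ^ n) atTop (𝓝 0) := by
  have h1 : ∀ N : ℕ, ‖∑ n ∈ Finset.range N, c ^ n‖ ≤ 2 / ‖c - 1‖ := fun N => by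
    rw [geom_sum_eq hc1, norm_div]
    gcongr
    refine (norm_sub_le _ _).trans ?_
    rw [norm_pow, hc]; norm_num
  refine squeeze_zero_norm (a := fun N : ℕ => (N : ℝ)⁻¹ * (2 / ‖c - 1‖)) (fun N => ?_) ?_
  · rw [norm_mul, norm_inv, Complex.norm_natCast]
    gcongr
    exact h1 N
  · simpa using (tendsto_natCast_atTop_atTop (R := ℝ)).inv_tendsto_atTop.mul_const (2 / ‖c - 1‖)

/-- The character of `ℤ` by which rotations act on the `k`-th Fourier monomial. -/
def rotChar (θ : ℝ) (k : ℤ) : ℂ := fourier k (-(θ : UnitAddCircle))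

theorem norm_rotChar (θ : ℝ) (k : ℤ) : ‖rotChar θ k‖ = 1 := by
  rw [rotChar, fourier_apply]; exact Circle.norm_coe _

theorem rotChar_ne_one {θ : ℝ} (hθ : Irrational θ) {k : ℤ} (hk : k ≠ 0) : rotChar θ k ≠ 1 := by
  intro h
  rw [rotChar, fourier_apply, ← Circle.coe_one, Circle.coe_inj, ← AddCircle.toCircle_zero] at h
  have h1 := AddCircle.injective_toCircle one_ne_zero h
  rw [smul_neg, neg_eq_zero, ← AddCircle.coe_zsmul, AddCircle.coe_eq_zero_iff] at h1
  obtain ⟨n, hn⟩ := h1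
  simp only [zsmul_eq_mul, mul_one] at hn
  exact (hθ.intCast_mul hk).ne_int n hn.symm

theorem rot_fourier (θ : ℝ) (n : ℕ) (k : ℤ) :
    rot θ n (fourier k) = rotChar θ k ^ n • (fourier k : C(UnitAddCircle, ℂ)) := by
  ext z
  rw [rot_apply, ContinuousMap.smul_apply, rotChar, fourier_apply, fourier_apply, fourier_apply,
    smul_eq_mul, ← Circle.coe_pow, ← Circle.coe_mul, ← AddCircle.toCircle_nsmul,
    ← AddCircle.toCircle_add]
  congr 2
  rw [natCast_zsmul, smul_sub, smul_neg, smul_neg, smul_comm (n : ℕ) k]; abel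

theorem isSmooth_fourier (k : ℤ) : IsSmooth (fourier k) := by
  have h : lift (fourier k) = fun x : ℝ => Complex.exp (2 * Real.pi * Complex.I * k * x) := by
    ext x
    simp [lift]
  rw [IsSmooth, h]
  exact (contDiff_const.mul Complex.ofRealCLM.contDiff).cexp

instance : IsProbabilityMeasure (volume : Measure UnitAddCircle) :=
  ⟨UnitAddCircle.measure_univ⟩

/-- The normalized trace on `C(𝕋)`, as the multiple `(∫ f) 1` of the unit. -/
def meanC : C(UnitAddCircle, ℂ) →L[ℂ] C(UnitAddCircle, ℂ) :=
  LinearMap.mkContinuous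
    { toFun := fun f => (∫ z, f z) • (1 : C(UnitAddCircle, ℂ))
      map_add' := fun f g => by
        have h : ∫ z, (f + g) z = (∫ z, f z) + ∫ z, g z :=
          integral_add (f.continuous.integrable_of_hasCompactSupport
            (HasCompactSupport.of_compactSpace _)) (g.continuous.integrable_of_hasCompactSupport
            (HasCompactSupport.of_compactSpace _))
        rw [h]
        exact add_smul (∫ z, f z) (∫ z, g z) (1 : C(UnitAddCircle, ℂ))
      map_smul' := fun c f => by
        rw [RingHom.id_apply, smul_smul, ← smul_eq_mul c, ← integral_smul]
        rfl } 1 (fun f => by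
    change ‖(∫ z, f z) • (1 : C(UnitAddCircle, ℂ))‖ ≤ _
    rw [norm_smul, norm_one, mul_one, one_mul]
    refine (norm_integral_le_of_norm_le_const (C := ‖f‖) (ae_of_all _ f.norm_coe_le_norm)).trans ?_
    simp)

theorem meanC_apply (f : C(UnitAddCircle, ℂ)) :
    meanC f = (∫ z, f z) • (1 : C(UnitAddCircle, ℂ)) := rfl

theorem integral_fourier (k : ℤ) :
    ∫ z : UnitAddCircle, fourier k z = if k = 0 then (1 : ℂ) else 0 := by
  have h := congrFun (fourierCoeff_fourier (T := 1) k) 0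
  have h2 := AddCircle.integral_haarAddCircle (T := 1) (f := fun z => (fourier k z : ℂ))
  rw [inv_one, one_smul] at h2
  rw [← h2]
  simp only [fourierCoeff, neg_zero, fourier_zero, one_smul] at h
  rw [h, Pi.single_apply]
  simp [eq_comm]

theorem dense_span_fourier :
    Dense ((Submodule.span ℂ (Set.range fourier) : Submodule ℂ C(UnitAddCircle, ℂ)) :
      Set C(UnitAddCircle, ℂ)) :=
  Submodule.dense_iff_topologicalClosure_eq_top.2 span_fourier_closure_eq_top

/-- Translation by `nθ` as a continuous linear map on `C(𝕋)`. -/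
def rotCLM (θ : ℝ) (n : ℤ) : C(UnitAddCircle, ℂ) →L[ℂ] C(UnitAddCircle, ℂ) :=
  LinearMap.mkContinuous (rot θ n : C(UnitAddCircle, ℂ) →ₗ[ℂ] C(UnitAddCircle, ℂ)) 1
    fun f => by simpa using norm_rot_le θ n f

/-- Unique ergodicity of the irrational rotation. -/
theorem tendsto_average_rot {θ : ℝ} (hθ : Irrational θ) (f : C(UnitAddCircle, ℂ)) :
    Tendsto (fun N : ℕ => (N : ℂ)⁻¹ • ∑ n ∈ Finset.range N, rot θ n f) atTop
      (𝓝 ((∫ z, f z) • (1 : C(UnitAddCircle, ℂ)))) := by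
  refine tendsto_average_of_dense (T := fun n => rotCLM θ n)
    (fun n => LinearMap.mkContinuous_norm_le _ zero_le_one _) meanC dense_span_fourier ?_ f
  rintro _ ⟨k, rfl⟩
  have h1 : ∀ n : ℕ, rotCLM θ n (fourier k) = rotChar θ k ^ n • fourier k :=
    fun n => rot_fourier θ n k
  simp only [h1, ← Finset.sum_smul, smul_smul, meanC_apply, integral_fourier]
  by_cases hk : k = 0
  · subst hk
    have h2 : rotChar θ 0 = 1 := by simp [rotChar]
    have h3 : (fourier 0 : C(UnitAddCircle, ℂ)) = 1 := by ext z; simp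
    rw [h2, h3, if_pos rfl]
    refine tendsto_const_nhds.congr' ?_
    filter_upwards [eventually_ne_atTop 0] with N hN
    have : (N : ℂ) ≠ 0 := Nat.cast_ne_zero.2 hN
    simp [this]
  · rw [if_neg hk]
    have h2 := (tendsto_average_pow (norm_rotChar θ k) (rotChar_ne_one hθ hk)).smul_const
      (fourier k : C(UnitAddCircle, ℂ))
    rwa [zero_smul ℂ (fourier k : C(UnitAddCircle, ℂ)),
      ← zero_smul ℂ (1 : C(UnitAddCircle, ℂ))] at h2

/-- The map `C(𝕋) → L¹(𝕋)`. -/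
def toL1 : C(UnitAddCircle, ℂ) →L[ℂ] L1 := ContinuousMap.toLp 1 volume ℂ

theorem toL1_coe (f : C(UnitAddCircle, ℂ)) : toL1 f =ᵐ[volume] f :=
  ContinuousMap.coeFn_toLp volume f

theorem denseRange_toL1 : DenseRange toL1 :=
  ContinuousMap.toLp_denseRange ℂ volume ℂ ENNReal.one_ne_top

theorem mulL1_toL1 (f g : C(UnitAddCircle, ℂ)) : mulL1 f (toL1 g) = toL1 (f * g) := by
  apply Lp.ext
  filter_upwards [mulL1_coe f (toL1 g), toL1_coe g, toL1_coe (f * g)] with z h1 h2 h3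
  rw [h1, h2, h3, ContinuousMap.mul_apply]

theorem rotL1_toL1 (θ : ℝ) (n : ℤ) (g : C(UnitAddCircle, ℂ)) :
    rotL1 θ n (toL1 g) = toL1 (rot θ n g) := by
  apply Lp.ext
  filter_upwards [rotL1_coe θ n (toL1 g), toL1_coe (rot θ n g),
    (measurePreserving_rot θ n).quasiMeasurePreserving.ae (toL1_coe g)] with z h1 h2 h3
  rw [h1, h2, h3, rot_apply]

theorem toL1_injective : Function.Injective toL1 := by
  intro f g h
  have h1 : (f : UnitAddCircle → ℂ) =ᵐ[volume] g :=
    (toL1_coe f).symm.trans ((by rw [h] : toL1 f =ᵐ[volume] toL1 g).trans (toL1_coe g))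
  exact ContinuousMap.coe_injective ((f.continuous.ae_eq_iff_eq volume g.continuous).1 h1)

theorem single_smul_L1 {θ : ℝ} (n : ℤ) (f : C(UnitAddCircle, ℂ)) (hf : IsSmooth f) (ψ : L1) :
    SmoothAlgebra.single θ n f hf • ψ = mulL1 f (rotL1 θ n ψ) := by
  rw [smul_L1_def, CovariantPair.integrated_single]; rfl

instance (θ : ℝ) : ContinuousSMul (SmoothAlgebra θ) L1 :=
  ⟨((pairL1 θ).continuous_integrated.comp continuous_fst).clm_apply continuous_snd⟩

/-- An absolutely convergent series in `L¹` converges almost everywhere to its sum. -/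
theorem ae_hasSum_of_summable_norm {f : ℤ → L1} (hf : Summable fun n => ‖f n‖) :
    ∀ᵐ z, HasSum (fun n => f n z) ((∑' n, f n : L1) z) := by
  have h1 : ∀ᵐ z : UnitAddCircle, Summable fun n => ‖f n z‖ := by
    have h2 : ∫⁻ z, ∑' n, ‖f n z‖ₑ = ∑' n, ‖f n‖ₑ := by
      rw [lintegral_tsum fun n => (Lp.aestronglyMeasurable (f n)).enorm]
      congr 1; ext1 n
      rw [Lp.enorm_def, eLpNorm_one_eq_lintegral_enorm]
    have h3 : ∫⁻ z, ∑' n, ‖f n z‖ₑ ≠ ⊤ := by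
      rw [h2]
      have h4 : Summable fun n => ‖f n‖₊ := NNReal.summable_coe.1 hf
      exact ENNReal.tsum_coe_ne_top_iff_summable.2 h4
    filter_upwards [ae_lt_top' (AEMeasurable.tsum fun n =>
      (Lp.aestronglyMeasurable (f n)).enorm) h3] with z hz
    have h4 : Summable fun n => ‖f n z‖₊ := ENNReal.tsum_coe_ne_top_iff_summable.1 hz.ne
    exact NNReal.summable_coe.2 h4
  -- Tonelli has given pointwise absolute convergence; a sequence of partial sums that converges
  -- almost everywhere to the `L¹` sum identifies the pointwise limit.
  obtain ⟨s, hs, hs'⟩ := (tendstoInMeasure_of_tendsto_Lp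
    hf.of_norm.hasSum).exists_seq_tendsto_ae'
  have h5 : ∀ᵐ z : UnitAddCircle, ∀ i, (∑ n ∈ s i, f n : L1) z = ∑ n ∈ s i, f n z := by
    refine ae_all_iff.2 fun i => ?_
    filter_upwards [Lp.coeFn_finsetSum (s i) f] with z hz
    rw [hz, Finset.sum_apply]
  filter_upwards [h1, hs', h5] with z h1 h2 h5
  have h6 := h1.of_norm.hasSum
  have h7 := h6.comp hs
  simp only [h5] at h2
  rwa [tendsto_nhds_unique h2 h7]

theorem ae_hasSum_smul_L1 {θ : ℝ} (F : SmoothAlgebra θ) (ψ : L1) :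
    ∀ᵐ z : UnitAddCircle,
      HasSum (fun n : ℤ => F.coeff n z * ψ (z - n • (θ : UnitAddCircle))) ((F • ψ : L1) z) := by
  let f : ℤ → L1 := fun n => mulL1 (F.coeff n) (rotL1 θ n ψ)
  have h0 : F • ψ = ∑' n, f n :=
    (ContinuousLinearMap.apply ℂ L1 ψ).map_tsum ((pairL1 θ).summable F)
  have hf : Summable fun n => ‖f n‖ := by
    refine Summable.of_nonneg_of_le (fun _ => norm_nonneg _) (fun n => ?_)
      (F.isSchwartz.summable_norm.mul_right ‖ψ‖)
    exact ((pairL1 θ).π (F.coeff n) * (pairL1 θ).U n).le_of_opNorm_le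
      ((pairL1 θ).norm_term_le _ n) ψ
  have h1 : ∀ᵐ z : UnitAddCircle, ∀ n, f n z = F.coeff n z * ψ (z - n • (θ : UnitAddCircle)) := by
    refine ae_all_iff.2 fun n => ?_
    filter_upwards [mulL1_coe (F.coeff n) (rotL1 θ n ψ), rotL1_coe θ n ψ] with z h1 h2
    rw [h1, h2]
  filter_upwards [ae_hasSum_of_summable_norm hf, h1] with z hz h1
  rw [h0]
  simpa only [h1] using hz

theorem integrable_L1 (ψ : L1) : Integrable ψ := L1.integrable_coeFn ψ

/-- The mean `(∫ ψ) 1` on `L¹(𝕋)`. -/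
def meanL1 : L1 →L[ℂ] L1 :=
  LinearMap.mkContinuous
    { toFun := fun ψ => (∫ z, ψ z) • toL1 1
      map_add' := fun f g => by
        rw [← add_smul, ← integral_add (integrable_L1 f) (integrable_L1 g),
          integral_congr_ae (Lp.coeFn_add f g)]
        rfl
      map_smul' := fun c f => by
        rw [RingHom.id_apply, smul_smul, ← smul_eq_mul c, ← integral_smul,
          integral_congr_ae (Lp.coeFn_smul c f)]
        rfl } ‖toL1 1‖ (fun f => by
    change ‖(∫ z, f z) • toL1 1‖ ≤ _
    rw [norm_smul, mul_comm]
    gcongr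
    rw [L1.norm_eq_integral_norm]
    exact norm_integral_le_integral_norm _)

theorem meanL1_apply (ψ : L1) : meanL1 ψ = (∫ z, ψ z) • toL1 1 := rfl

theorem tendsto_average_rotL1 {θ : ℝ} (hθ : Irrational θ) (ψ : L1) :
    Tendsto (fun N : ℕ => (N : ℂ)⁻¹ • ∑ n ∈ Finset.range N, rotL1 θ n ψ) atTop
      (𝓝 ((∫ z, ψ z) • toL1 1)) := by
  refine tendsto_average_of_dense (T := fun n => rotL1 θ n) (s := Set.range toL1)
    (fun n => (pairL1 θ).norm_U_le n) meanL1
    (denseRange_toL1.mono Submodule.subset_span) ?_ ψ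
  rintro _ ⟨f, rfl⟩
  rw [meanL1_apply, integral_congr_ae (toL1_coe f), ← map_smul]
  refine ((toL1.continuous.tendsto _).comp (tendsto_average_rot hθ f)).congr fun N => ?_
  simp only [Function.comp_apply, map_smul, map_sum, rotL1_toL1]

theorem integral_mulL1 (f : C(UnitAddCircle, ℂ)) (ψ : L1) :
    ∫ z, mulL1 f ψ z = ∫ z, f z * ψ z := integral_congr_ae (mulL1_coe f ψ)

/-- Indicators of closed sets are bounded pointwise limits of continuous functions, and the
integrals over closed sets determine an integrable function. -/
theorem eq_zero_of_integral_mul_eq_zero {ψ : L1}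
    (h : ∀ f : C(UnitAddCircle, ℂ), ∫ z, f z * ψ z = 0) : ψ = 0 := by
  have h0 := integrable_L1 ψ
  refine (Lp.eq_zero_iff_ae_eq_zero).2 (ae_eq_zero_of_forall_setIntegral_isClosed_eq_zero h0 ?_)
  intro s hs
  let g : ℕ → C(UnitAddCircle, ℂ) := fun n => ⟨fun z => ((hs.apprSeq n z : ℝ) : ℂ), by fun_prop⟩
  have hlim : Tendsto (fun n => ∫ z, g n z * ψ z) atTop (𝓝 (∫ z, s.indicator ψ z)) := by
    refine tendsto_integral_of_dominated_convergence (fun z => ‖ψ z‖)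
      (fun n => (g n).continuous.aestronglyMeasurable.mul h0.1) h0.norm
      (fun n => ae_of_all _ fun z => ?_) (ae_of_all _ fun z => ?_)
    · rw [norm_mul]
      refine mul_le_of_le_one_left (norm_nonneg _) ?_
      simp only [g, ContinuousMap.coe_mk, Complex.norm_real, NNReal.norm_eq]
      exact_mod_cast HasOuterApproxClosed.apprSeq_apply_le_one hs n z
    · have h1 := tendsto_pi_nhds.1 (HasOuterApproxClosed.tendsto_apprSeq hs) z
      have h2 : Tendsto (fun n => g n z) atTop
          (𝓝 (((s.indicator (fun _ => (1 : NNReal)) z : NNReal) : ℝ) : ℂ)) :=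
        (Complex.continuous_ofReal.tendsto _).comp ((NNReal.continuous_coe.tendsto _).comp h1)
      have h3 := h2.mul_const (ψ z)
      convert h3 using 2
      by_cases hz : z ∈ s <;> simp [hz]
  rw [← integral_indicator hs.measurableSet]
  refine tendsto_nhds_unique hlim ?_
  simp only [h, tendsto_const_nhds]

/-- A single element of nonzero mean suffices, since its rotation averages converge to a nonzero
constant. If every mean vanished, multiplying `ψ ∈ N` by Fourier monomials would make all Fourier
coefficients of `ψ` vanish. -/
theorem toL1_one_mem {θ : ℝ} (hθ : Irrational θ) {N : Submodule (SmoothAlgebra θ) L1}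
    (hN : IsClosed (N : Set L1)) (h : N ≠ ⊥) : toL1 1 ∈ N := by
  obtain ⟨ψ, hψ, hψ0⟩ := N.ne_bot_iff.1 h
  by_contra h1
  have hrot : ∀ (n : ℤ), ∀ φ ∈ N, rotL1 θ n φ ∈ N := fun n φ hφ => by
    have h2 := N.smul_mem (SmoothAlgebra.single θ n 1 IsSmooth.one) hφ
    rwa [single_smul_L1, show mulL1 1 = 1 from map_one (pairL1 θ).π] at h2
  have hmean : ∀ φ ∈ N, ∫ z, φ z = 0 := fun φ hφ => by
    by_contra h2
    have h3 : (∫ z, φ z) • toL1 1 ∈ N := by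
      refine hN.mem_of_tendsto (tendsto_average_rotL1 hθ φ) (Eventually.of_forall fun M => ?_)
      exact N.smul_of_tower_mem _ (N.sum_mem fun n _ => hrot n φ hφ)
    have h4 := N.smul_of_tower_mem (∫ z, φ z)⁻¹ h3
    rw [smul_smul, inv_mul_cancel₀ h2, one_smul] at h4
    exact h1 h4
  refine hψ0 (eq_zero_of_integral_mul_eq_zero fun f => ?_)
  -- The functional `f ↦ ∫ fψ`, carried by the constant `1`. Multiplication does not involve the
  -- angle, so the linearity and continuity facts can be taken from `pairL1 0`.
  let Λ : C(UnitAddCircle, ℂ) →ₗ[ℂ] L1 :=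
    { toFun := fun f => meanL1 (mulL1 f ψ)
      map_add' := fun f g => by
        rw [show mulL1 (f + g) = mulL1 f + mulL1 g from map_add (pairL1 0).π f g]
        exact map_add meanL1 _ _
      map_smul' := fun c f => by
        rw [show mulL1 (c • f) = c • mulL1 f from map_smul (pairL1 0).π c f]
        exact map_smul meanL1 _ _ }
  have hΛ : Continuous Λ := meanL1.continuous.comp
    ((pairL1 0).continuous_π.clm_apply continuous_const)
  have hz : ∀ g ∈ Submodule.span ℂ (Set.range fourier), Λ g = 0 := fun g hg => by
    induction hg using Submodule.span_induction with
    | mem x hx =>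
      obtain ⟨k, rfl⟩ := hx
      have h2 := N.smul_mem (SmoothAlgebra.single θ 0 _ (isSmooth_fourier k)) hψ
      rw [single_smul_L1, show rotL1 θ 0 = 1 from (pairL1 θ).U_zero] at h2
      change meanL1 (mulL1 (fourier k) ψ) = 0
      rw [meanL1_apply]
      have h3 := hmean _ h2
      rw [one_apply_eq_self] at h3
      rw [h3, zero_smul]
    | zero => exact map_zero Λ
    | add x y _ _ hx hy => rw [map_add, hx, hy, add_zero]
    | smul c x _ hx => rw [map_smul, hx, smul_zero]
  have h5 : Λ f = 0 := by
    have := dense_span_fourier f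
    exact closure_minimal (t := {g | Λ g = 0}) hz (isClosed_eq hΛ continuous_const) this
  have h6 : (∫ z, mulL1 f ψ z) • toL1 1 = 0 := h5
  rw [smul_eq_zero, integral_mulL1] at h6
  refine h6.resolve_right fun h7 => ?_
  have := toL1_injective (h7.trans (map_zero toL1).symm)
  exact one_ne_zero this

/-- Once `1 ∈ N`, multiplication by monomials gives the trigonometric polynomials; these are
uniformly dense in `C(𝕋)`, which is dense in `L¹`. -/
theorem isTopologicallyIrreducible_L1 {θ : ℝ} (hθ : Irrational θ) :
    IsTopologicallyIrreducible (SmoothAlgebra θ) L1 := by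
  refine ⟨⟨toL1 1, 0, fun h => one_ne_zero (toL1_injective (h.trans (map_zero toL1).symm))⟩,
    fun N hN => or_iff_not_imp_left.2 fun h => ?_⟩
  have h1 := toL1_one_mem hθ hN h
  have h2 : ∀ f : C(UnitAddCircle, ℂ), toL1 f ∈ N := fun f => by
    have h3 : ∀ g ∈ Submodule.span ℂ (Set.range fourier), toL1 g ∈ N := fun g hg => by
      induction hg using Submodule.span_induction with
      | mem x hx =>
        obtain ⟨k, rfl⟩ := hx
        have h2 := N.smul_mem (SmoothAlgebra.single θ 0 _ (isSmooth_fourier k)) h1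
        rwa [single_smul_L1, rotL1_toL1, rot_zero, mulL1_toL1, mul_one] at h2
      | zero => rw [map_zero]; exact N.zero_mem
      | add x y _ _ hx hy => rw [map_add]; exact N.add_mem hx hy
      | smul c x _ hx => rw [map_smul]; exact N.smul_of_tower_mem c hx
    have := dense_span_fourier f
    exact closure_minimal (t := toL1 ⁻¹' N) h3 (hN.preimage toL1.continuous) this
  refine eq_top_iff.2 fun ψ _ => ?_
  have h4 : ψ ∈ closure (Set.range toL1) := denseRange_toL1 ψ
  exact closure_minimal (by rintro _ ⟨f, rfl⟩; exact h2 f) hN h4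

end RotationAlgebra

end

/-! ### Functions with an inverse square root singularity. -/

noncomputable section

namespace RotationAlgebra

theorem isOpenQuotientMap_coe : IsOpenQuotientMap (fun x : ℝ => (x : UnitAddCircle)) :=
  QuotientAddGroup.isOpenQuotientMap_mk

/-- A function on the circle whose pullback to `ℝ` is smooth is a smooth element of `C(𝕋)`. -/
theorem exists_isSmooth_of_contDiff {φ : UnitAddCircle → ℂ}
    (h : ContDiff ℝ ∞ fun x : ℝ => φ (x : UnitAddCircle)) :
    ∃ g : C(UnitAddCircle, ℂ), IsSmooth g ∧ ∀ z, g z = φ z :=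
  ⟨⟨φ, isOpenQuotientMap_coe.isQuotientMap.continuous_iff.2 h.continuous⟩, h, fun _ => rfl⟩

/-- The squared chordal distance on the circle. -/
def chordSq (p z : UnitAddCircle) : ℝ :=
  ‖(fourier 1 z : ℂ) - fourier 1 p‖ ^ 2

/-- For the representative `y ∈ [-1/2, 1/2]` of `z - p` the chord has length `2 |sin (πy)|`, and
Jordan's inequality gives `2|y| ≤ |sin (πy)| ≤ π|y|`. So the chord is a smooth substitute for the
distance, which is not smooth at the antipode of `p`. -/
theorem chordSq_bounds (p z : UnitAddCircle) :
    16 * ‖z - p‖ ^ 2 ≤ chordSq p z ∧ chordSq p z ≤ (2 * Real.pi) ^ 2 * ‖z - p‖ ^ 2 := by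
  have h0 : ‖(fourier 1 z : ℂ) - fourier 1 p‖ = ‖(fourier 1 (z - p) : ℂ) - 1‖ := by
    have h1 : (fourier 1 z : ℂ) = fourier 1 (z - p) * fourier 1 p := by
      rw [fourier_one, fourier_one, fourier_one, ← Circle.coe_mul, ← AddCircle.toCircle_add,
        sub_add_cancel]
    rw [h1, ← sub_one_mul, norm_mul, fourier_one (x := p), Circle.norm_coe, mul_one]
  rw [chordSq, h0]
  obtain ⟨x, hx⟩ := QuotientAddGroup.mk_surjective (z - p)
  set y := x - round x with hy
  have hyz : ((y : ℝ) : UnitAddCircle) = z - p := by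
    rw [← hx, hy, AddCircle.coe_sub]
    have : (((round x : ℤ) : ℝ) : UnitAddCircle) = 0 := by
      rw [AddCircle.coe_eq_zero_iff]; exact ⟨round x, by simp⟩
    rw [this, sub_zero]
  have hyn : ‖z - p‖ = |y| := by rw [← hx]; exact UnitAddCircle.norm_eq
  have hy2 : |y| ≤ 1 / 2 := abs_sub_round x
  have h2 : ‖(fourier 1 (z - p) : ℂ) - 1‖ = 2 * |Real.sin (Real.pi * y)| := by
    rw [← hyz, fourier_coe_apply]
    have h3 := Complex.norm_exp_I_mul_ofReal_sub_one (2 * Real.pi * y)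
    rw [show 2 * Real.pi * y / 2 = Real.pi * y by ring, norm_mul, Real.norm_eq_abs,
      Real.norm_eq_abs, abs_two] at h3
    rw [← h3]
    congr 3
    push_cast; ring
  have h4 : |Real.pi * y| = Real.pi * |y| := by rw [abs_mul, abs_of_pos Real.pi_pos]
  have h5 : 2 * |y| ≤ |Real.sin (Real.pi * y)| := by
    have h6 := Real.mul_abs_le_abs_sin (x := Real.pi * y)
      (by rw [h4]; nlinarith [Real.pi_pos])
    rw [h4] at h6
    refine le_trans (le_of_eq ?_) h6
    field_simp
  have h7 : |Real.sin (Real.pi * y)| ≤ Real.pi * |y| := h4 ▸ Real.abs_sin_le_abs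
  rw [h2, hyn, ← mul_pow, show (16 : ℝ) * |y| ^ 2 = (4 * |y|) ^ 2 by ring]
  constructor
  · refine pow_le_pow_left₀ (by positivity) ?_ 2; linarith
  · refine pow_le_pow_left₀ (by positivity) ?_ 2; linarith

theorem chordSq_pos {p z : UnitAddCircle} (h : z ≠ p) : 0 < chordSq p z := by
  have : 0 < ‖z - p‖ := norm_pos_iff.2 (sub_ne_zero.2 h)
  exact lt_of_lt_of_le (by positivity) (chordSq_bounds p z).1

theorem contDiff_chordSq (p : UnitAddCircle) :
    ContDiff ℝ ∞ fun x : ℝ => chordSq p (x : UnitAddCircle) :=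
  ((isSmooth_fourier 1).sub contDiff_const).norm_sq ℝ

/-- The exponent is `-1/4` because `chordSq` is comparable to the square of the distance. -/
theorem exists_hasInvSqrtSingularity (p : UnitAddCircle) : ∃ ξ, HasInvSqrtSingularity p ξ := by
  refine ⟨fun z => chordSq p z ^ (-(1 / 4) : ℝ), fun z => ?_, fun x hx => ?_, ?_, ?_⟩
  · exact Real.rpow_nonneg (sq_nonneg _) _
  · exact (((contDiff_chordSq p).contDiffAt).rpow_const_of_ne
      (chordSq_pos hx).ne').contDiffWithinAt
  · refine Asymptotics.IsBigO.of_bound ((16 : ℝ) ^ (-(1 / 4) : ℝ))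
      (eventually_mem_nhdsWithin.mono fun z hz => ?_)
    have h0 : 0 < ‖z - p‖ := norm_pos_iff.2 (sub_ne_zero.2 hz)
    rw [Real.norm_of_nonneg (Real.rpow_nonneg (chordSq_pos hz).le _),
      Real.norm_of_nonneg (by positivity)]
    refine (Real.rpow_le_rpow_of_nonpos (by positivity) (chordSq_bounds p z).1
      (by norm_num)).trans_eq ?_
    rw [Real.mul_rpow (by norm_num) (by positivity), ← Real.rpow_natCast ‖z - p‖ 2,
      ← Real.rpow_mul h0.le]
    norm_num
  · refine Asymptotics.IsBigO.of_bound (((2 * Real.pi) ^ 2) ^ (1 / 4 : ℝ))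
      (eventually_mem_nhdsWithin.mono fun z hz => ?_)
    have h0 : 0 < ‖z - p‖ := norm_pos_iff.2 (sub_ne_zero.2 hz)
    rw [Real.norm_of_nonneg (Real.rpow_nonneg (chordSq_pos hz).le _),
      Real.norm_of_nonneg (by positivity)]
    have h1 := Real.rpow_le_rpow_of_nonpos (chordSq_pos hz) (chordSq_bounds p z).2
      (show (-(1 / 4) : ℝ) ≤ 0 by norm_num)
    rw [Real.mul_rpow (by positivity) (by positivity), ← Real.rpow_natCast ‖z - p‖ 2,
      ← Real.rpow_mul h0.le, Real.rpow_neg (by positivity), inv_mul_le_iff₀ (by positivity)] at h1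
    rwa [show ((2 : ℕ) : ℝ) * -(1 / 4) = -(1 / 2) by norm_num] at h1

theorem norm_coe_sub {x y : ℝ} (h : |x - y| ≤ 1 / 2) :
    ‖(x : UnitAddCircle) - (y : UnitAddCircle)‖ = |x - y| := by
  rw [← AddCircle.coe_sub, AddCircle.norm_coe_eq_abs_iff 1 one_ne_zero]
  simpa using h

theorem intervalIntegrable_abs_rpow {r : ℝ} (hr : -1 < r) (c : ℝ) (hc : 0 ≤ c) :
    IntervalIntegrable (fun x : ℝ => |x| ^ r) volume (-c) c := by
  have h1 : IntervalIntegrable (fun x : ℝ => |x| ^ r) volume 0 c := by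
    refine (intervalIntegral.intervalIntegrable_rpow' hr).congr fun x hx => ?_
    rw [Set.uIoc_of_le hc] at hx
    simp only [abs_of_pos hx.1]
  refine IntervalIntegrable.trans (b := 0) ?_ h1
  rw [IntervalIntegrable.iff_comp_neg]
  simpa using h1.symm

/-- On the fundamental interval centred at a lift `y` of `p`, the distance to `p` is `|x - y|`. -/
theorem integrable_norm_sub_rpow {r : ℝ} (hr : -1 < r) (p : UnitAddCircle) :
    Integrable fun z : UnitAddCircle => ‖z - p‖ ^ r := by
  obtain ⟨y, rfl⟩ := QuotientAddGroup.mk_surjective p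
  have hm := UnitAddCircle.measurePreserving_mk (y - 1 / 2)
  have hmeas : Measurable fun z : UnitAddCircle => ‖z - (y : UnitAddCircle)‖ ^ r := by fun_prop
  refine (hm.integrable_comp hmeas.aestronglyMeasurable).1 ?_
  have h1 := (intervalIntegrable_abs_rpow hr (1 / 2) (by norm_num)).comp_sub_right y
  rw [intervalIntegrable_iff_integrableOn_Ioc_of_le (by linarith)] at h1
  rw [show y - 1 / 2 + 1 = 1 / 2 + y by ring, show y - 1 / 2 = -(1 / 2) + y by ring]
  refine h1.congr_fun (fun x hx => ?_) measurableSet_Ioc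
  have h2 : |x - y| ≤ 1 / 2 := abs_le.2 ⟨by linarith [hx.1], by linarith [hx.2]⟩
  simp only [Function.comp_apply]
  rw [← norm_coe_sub h2]

instance : NullSingletonClass (volume : Measure UnitAddCircle) where
  measure_singleton z := by
    obtain ⟨y, rfl⟩ := QuotientAddGroup.mk_surjective z
    rw [← (UnitAddCircle.measurePreserving_mk y).measure_preimage
      (measurableSet_singleton _).nullMeasurableSet]
    refine Set.Countable.measure_zero (Set.Countable.mono (s₂ := Set.range fun n : ℤ => y + n) ?_
      (Set.countable_range _)) _
    intro x hx
    have h1 : ((x - y : ℝ) : UnitAddCircle) = 0 := by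
      rw [AddCircle.coe_sub, sub_eq_zero]; exact hx
    obtain ⟨n, hn⟩ := (AddCircle.coe_eq_zero_iff 1).1 h1
    refine ⟨n, ?_⟩
    simp only [zsmul_eq_mul, mul_one] at hn
    simp [hn]

namespace HasInvSqrtSingularity

variable {p : UnitAddCircle} {ξ : UnitAddCircle → ℝ}

theorem contDiffAt (h : HasInvSqrtSingularity p ξ) {x : ℝ} (hx : (x : UnitAddCircle) ≠ p) :
    ContDiffAt ℝ ∞ (fun x : ℝ => ξ (x : UnitAddCircle)) x := by
  have hc : Continuous fun x : ℝ => (x : UnitAddCircle) := isOpenQuotientMap_coe.continuous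
  exact h.smooth.contDiffAt ((isOpen_compl_singleton.preimage hc).mem_nhds hx)

theorem continuousAt (h : HasInvSqrtSingularity p ξ) {z : UnitAddCircle} (hz : z ≠ p) : ContinuousAt ξ z := by
  obtain ⟨x, rfl⟩ := QuotientAddGroup.mk_surjective z
  exact isOpenQuotientMap_coe.continuousAt_comp_iff.1 (h.contDiffAt hz).continuousAt

theorem aestronglyMeasurable (h : HasInvSqrtSingularity p ξ) : AEStronglyMeasurable ξ volume := by
  have h1 : ContinuousOn ξ {p}ᶜ := fun z hz => (h.continuousAt hz).continuousWithinAt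
  have h2 := h1.aestronglyMeasurable (μ := volume) (measurableSet_singleton p).compl
  rwa [Measure.restrict_eq_self_of_ae_mem] at h2
  exact compl_mem_ae_iff.2 (measure_singleton p)

theorem integrable (h : HasInvSqrtSingularity p ξ) : Integrable ξ := by
  have hloc : LocallyIntegrable ξ := by
    intro z
    by_cases hz : z = p
    · subst hz
      obtain ⟨C, hC⟩ := h.growth.1.bound
      rw [eventually_nhdsWithin_iff] at hC
      refine ⟨_, hC, ?_⟩
      have h1 := (integrable_norm_sub_rpow (r := -(1 / 2)) (by norm_num) z).const_mul C
      refine h1.integrableOn.mono' h.aestronglyMeasurable.restrict ?_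
      have h3 : ∀ᵐ w : UnitAddCircle, w ≠ z := compl_mem_ae_iff.2 (measure_singleton z)
      -- The neighbourhood on which the growth bound holds is given by the bound itself; up to the
      -- null set `{z}` it is the set where one measurable function is at most another.
      have hs : NullMeasurableSet {x | x ∈ ({z}ᶜ : Set UnitAddCircle) →
          ‖ξ x‖ ≤ C * ‖‖x - z‖ ^ (-(1 / 2) : ℝ)‖} volume := by
        have h4 : AEMeasurable (fun x => ‖ξ x‖) volume := h.aestronglyMeasurable.norm.aemeasurable
        have h5 : AEMeasurable (fun x : UnitAddCircle => C * ‖‖x - z‖ ^ (-(1 / 2) : ℝ)‖)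
          volume := by fun_prop
        refine (nullMeasurableSet_le h4 h5).congr ?_
        filter_upwards [h3] with w hw
        exact propext ⟨fun h _ => h, fun h => h hw⟩
      rw [ae_restrict_iff'₀ hs]
      filter_upwards [h3] with w hw hw'
      refine (hw' hw).trans_eq ?_
      rw [Real.norm_of_nonneg (by positivity)]
    · exact (h.continuousAt hz).integrableAtFilter
        ⟨Set.univ, univ_mem, h.aestronglyMeasurable.restrict⟩ (volume.finiteAt_nhds z)
  exact integrableOn_univ.1 (hloc.integrableOn_isCompact isCompact_univ)

theorem memLp_one (h : HasInvSqrtSingularity p ξ) : MemLp (fun z => (ξ z : ℂ)) 1 volume :=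
  memLp_one_iff_integrable.2 h.integrable.ofReal

/-- By the lower growth bound `ξ²` dominates a multiple of `|x - y|⁻¹` at a lift `y` of `p`, which
is not integrable there, even from one side. -/
theorem not_memLp_two (h : HasInvSqrtSingularity p ξ) : ¬ MemLp (fun z => (ξ z : ℂ)) 2 volume := by
  intro h2
  have h3 : Integrable (fun z => ξ z ^ 2) := by
    have := (memLp_two_iff_integrable_sq_norm h2.1).1 h2
    simpa using this
  obtain ⟨y, rfl⟩ := QuotientAddGroup.mk_surjective p
  have h4 := ((UnitAddCircle.measurePreserving_mk y).integrable_comp h3.1).2 h3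
  refine not_intervalIntegrable_of_sub_inv_isBigO_punctured
    (f := fun x : ℝ => ξ (x : UnitAddCircle) ^ 2) (c := y) ?_ (lt_add_one y).ne
    (Set.left_mem_uIcc) ((intervalIntegrable_iff_integrableOn_Ioc_of_le (by linarith)).2 h4)
  have hnear : ∀ᶠ x in 𝓝[≠] y, |x - y| ≤ 1 / 2 ∧ x ≠ y := by
    refine (eventually_nhdsWithin_of_eventually_nhds ?_).and eventually_mem_nhdsWithin
    have : Tendsto (fun x : ℝ => |x - y|) (𝓝 y) (𝓝 |y - y|) :=
      (by fun_prop : Continuous fun x : ℝ => |x - y|).tendsto y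
    rw [sub_self, abs_zero] at this
    exact this.eventually (ge_mem_nhds (by norm_num))
  have ht : Tendsto (fun x : ℝ => (x : UnitAddCircle)) (𝓝[≠] y) (𝓝[≠] (y : UnitAddCircle)) := by
    refine tendsto_nhdsWithin_iff.2
      ⟨(isOpenQuotientMap_coe.continuous.tendsto y).mono_left nhdsWithin_le_nhds, ?_⟩
    filter_upwards [hnear] with x hx hxy
    have h5 := norm_coe_sub hx.1
    rw [Set.mem_singleton_iff.1 hxy, sub_self, norm_zero] at h5
    exact hx.2 (sub_eq_zero.1 (abs_eq_zero.1 h5.symm))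
  refine Asymptotics.IsBigO.trans ?_ ((h.growth.2.comp_tendsto ht).pow 2)
  refine Asymptotics.IsBigO.of_bound 1 ?_
  filter_upwards [hnear] with x hx
  have h6 : 0 < |x - y| := abs_pos.2 (sub_ne_zero.2 hx.2)
  simp only [Function.comp_apply]
  rw [norm_coe_sub hx.1, one_mul, norm_inv, Real.norm_eq_abs, norm_pow,
    Real.norm_of_nonneg (by positivity), ← Real.rpow_natCast, ← Real.rpow_mul h6.le,
    ← Real.rpow_neg_one]
  norm_num

/-- Smooth cutoffs `f` that vanish near the singularity, such that `f ξ` has large norm in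
`L²(𝕋)`. -/
theorem exists_cutoff (h : HasInvSqrtSingularity p ξ) (C : ℝ) : ∃ f g : C(UnitAddCircle, ℂ), IsSmooth f ∧ IsSmooth g ∧ ‖f‖ ≤ 1 ∧
    (∀ z, g z = f z * ξ z) ∧ C < ∫ z, ‖g z‖ ^ 2 := by
  -- The cutoff is `0` where `k * chordSq ≤ 1`, a neighbourhood of `p`, and `1` where `k * chordSq ≥
  -- 2`; so `a k * ξ` is smooth and eventually equals `ξ` at each `z ≠ p`.
  let a : ℕ → UnitAddCircle → ℝ := fun k z => Real.smoothTransition (k * chordSq p z - 1)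
  have ha : ∀ k, ContDiff ℝ ∞ fun x : ℝ => (a k (x : UnitAddCircle) : ℂ) := fun k =>
    Complex.ofRealCLM.contDiff.comp (Real.smoothTransition.contDiff.comp
      ((contDiff_const.mul (contDiff_chordSq p)).sub contDiff_const))
  have hg : ∀ k, ContDiff ℝ ∞
      fun x : ℝ => (a k (x : UnitAddCircle) : ℂ) * (ξ (x : UnitAddCircle) : ℂ) := fun k => by
    refine contDiff_iff_contDiffAt.2 fun x => ?_
    by_cases hx : (x : UnitAddCircle) = p
    · have hc : Continuous fun x : ℝ => k * chordSq p (x : UnitAddCircle) - 1 :=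
        (continuous_const.mul (contDiff_chordSq p).continuous).sub continuous_const
      have h0 : ∀ᶠ y : ℝ in 𝓝 x, k * chordSq p (y : UnitAddCircle) - 1 < 0 := by
        refine hc.continuousAt.eventually (gt_mem_nhds ?_)
        simp [hx, chordSq]
      refine (contDiffAt_const (c := (0 : ℂ))).congr_of_eventuallyEq ?_
      filter_upwards [h0] with y hy
      simp only [a, Real.smoothTransition.zero_of_nonpos hy.le, Complex.ofReal_zero, zero_mul]
    · exact (ha k).contDiffAt.mul (Complex.ofRealCLM.contDiff.contDiffAt.comp x (h.contDiffAt hx))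
  choose f hf hf' using fun k => exists_isSmooth_of_contDiff
    (φ := fun z => (a k z : ℂ)) (ha k)
  choose g hg hg' using fun k => exists_isSmooth_of_contDiff
    (φ := fun z => (a k z : ℂ) * (ξ z : ℂ)) (hg k)
  -- If `C` bounded all these integrals, Fatou's lemma would put `ξ` into `L²`.
  by_contra! hC
  have hle : ∀ k, ∫ z, ‖g k z‖ ^ 2 ≤ C := fun k => by
    refine hC (f k) (g k) (hf k) (hg k) ?_ fun z => by rw [hg', hf']
    refine (ContinuousMap.norm_le _ zero_le_one).2 fun z => ?_
    rw [hf', Complex.norm_real, Real.norm_of_nonneg (Real.smoothTransition.nonneg _)]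
    exact Real.smoothTransition.le_one _
  refine h.not_memLp_two ((memLp_two_iff_integrable_sq_norm
    (Complex.continuous_ofReal.comp_aestronglyMeasurable h.aestronglyMeasurable)).2 ?_)
  have hlim : ∀ᵐ z, Tendsto (fun k => ‖g k z‖ ^ 2) atTop (𝓝 (‖(ξ z : ℂ)‖ ^ 2)) := by
    filter_upwards [show ∀ᵐ z : UnitAddCircle, z ≠ p from compl_mem_ae_iff.2 (measure_singleton p)]
      with z hz
    refine tendsto_const_nhds.congr' ?_
    filter_upwards [(tendsto_natCast_atTop_atTop.atTop_mul_const
      (chordSq_pos hz)).eventually_ge_atTop 2] with k hk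
    have : a k z = 1 := Real.smoothTransition.one_of_one_le (by linarith)
    rw [hg', this]; simp
  refine ⟨(Complex.continuous_ofReal.comp_aestronglyMeasurable h.aestronglyMeasurable).norm.pow 2,
    ?_⟩
  have h1 : ∫⁻ z, ‖‖(ξ z : ℂ)‖ ^ 2‖ₑ ≤ ENNReal.ofReal C := by
    calc ∫⁻ z, ‖‖(ξ z : ℂ)‖ ^ 2‖ₑ = ∫⁻ z, liminf (fun k => ‖‖g k z‖ ^ 2‖ₑ) atTop := by
          refine lintegral_congr_ae ?_
          filter_upwards [hlim] with z hz
          exact ((continuous_enorm.tendsto _).comp hz).liminf_eq.symm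
      _ ≤ liminf (fun k => ∫⁻ z, ‖‖g k z‖ ^ 2‖ₑ) atTop :=
          lintegral_liminf_le fun k => by fun_prop
      _ ≤ ENNReal.ofReal C := by
          refine liminf_le_of_le (by isBoundedDefault) fun b hb => ?_
          obtain ⟨k, hk⟩ := hb.exists
          refine hk.trans ?_
          have hi : Integrable fun z => ‖g k z‖ ^ 2 :=
            (by fun_prop : Continuous fun z => ‖g k z‖ ^ 2).integrable_of_hasCompactSupport
              (HasCompactSupport.of_compactSpace _)
          rw [← ofReal_integral_norm_eq_lintegral_enorm hi]
          refine ENNReal.ofReal_le_ofReal (le_trans (le_of_eq ?_) (hle k))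
          simp
  exact h1.trans_lt ENNReal.ofReal_lt_top

end HasInvSqrtSingularity

end RotationAlgebra

end

/-! ### The cyclic module of the singular vector. -/

noncomputable section

namespace RotationAlgebra

/-- Finitely many elements of a left ideal `L` of a `C^*`-algebra are almost annihilated from the
right by a contraction that is congruent to `1` modulo `L`. -/
theorem exists_approximate_annihilator {B : Type*} [CStarAlgebra B] (L : Submodule B B)
    (s : Finset B) (hs : ∀ x ∈ s, x ∈ L) {ε : ℝ} (hε : 0 < ε) :
    ∃ w : B, ‖w‖ ≤ 1 ∧ (∀ x ∈ s, ‖x * w‖ ≤ ε) ∧ 1 - w ∈ L := by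
  let _ := CStarAlgebra.spectralOrder B
  have := CStarAlgebra.spectralOrderedRing B
  set S : B := ∑ x ∈ s, star x * x with hS
  have hS0 : 0 ≤ S := Finset.sum_nonneg fun x _ => star_mul_self_nonneg x
  have hSL : S ∈ L := L.sum_mem fun x hx => L.smul_mem (star x) (hs x hx)
  have hSa : IsSelfAdjoint S := hS0.isSelfAdjoint
  have hsp : ∀ t ∈ spectrum ℝ S, 0 ≤ t := fun t ht => spectrum_nonneg_of_nonneg hS0 ht
  -- With `w = δ (δ + S)⁻¹`, the norm of `w S w` is at most the supremum of `δ² t / (δ + t)² ≤ δ`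
  -- over `t ≥ 0`. Since `star x * x ≤ S`, this bounds `‖x w‖²`, whence `δ = ε²`.
  set δ : ℝ := ε ^ 2
  have hδ : 0 < δ := by positivity
  have hc : ContinuousOn (fun t : ℝ => (δ + t)⁻¹) (spectrum ℝ S) :=
    (continuous_const.add continuous_id).continuousOn.inv₀ fun t ht => by
      have := hsp t ht
      change δ + t ≠ 0
      positivity
  set v : B := cfc (fun t : ℝ => (δ + t)⁻¹) S with hv
  have hw : cfc (fun t : ℝ => δ * (δ + t)⁻¹) S = δ • v := by
    rw [cfc_const_mul δ (fun t : ℝ => (δ + t)⁻¹) S hc]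
  set w : B := cfc (fun t : ℝ => δ * (δ + t)⁻¹) S with hw'
  have hwc : ContinuousOn (fun t : ℝ => δ * (δ + t)⁻¹) (spectrum ℝ S) := continuousOn_const.mul hc
  have hwa : star w = w := (cfc_predicate (fun t : ℝ => δ * (δ + t)⁻¹) S : IsSelfAdjoint _)
  refine ⟨w, ?_, fun x hx => ?_, ?_⟩
  · refine norm_cfc_le zero_le_one fun t ht => ?_
    have := hsp t ht
    rw [Real.norm_of_nonneg (by positivity), ← div_eq_mul_inv, div_le_one (by positivity)]
    linarith
  · have h1 : star x * x ≤ S := Finset.single_le_sum (f := fun x => star x * x)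
      (fun y _ => star_mul_self_nonneg y) hx
    have h2 : star w * (star x * x) * w ≤ star w * S * w := star_left_conjugate_le_conjugate h1 w
    have h3 : star w * S * w = cfc (fun t : ℝ => δ * (δ + t)⁻¹ * t * (δ * (δ + t)⁻¹)) S := by
      rw [cfc_mul (fun t : ℝ => δ * (δ + t)⁻¹ * t) (fun t : ℝ => δ * (δ + t)⁻¹) S
        (hwc.mul continuousOn_id) hwc,
        cfc_mul (fun t : ℝ => δ * (δ + t)⁻¹) (fun t : ℝ => t) S hwc continuousOn_id,
        cfc_id' ℝ S, hwa]
    have h4 : ‖star w * S * w‖ ≤ δ := by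
      rw [h3]
      refine norm_cfc_le hδ.le fun t ht => ?_
      have := hsp t ht
      rw [Real.norm_of_nonneg (by positivity)]
      have h5 : δ * (δ + t)⁻¹ ≤ 1 := by
        rw [← div_eq_mul_inv, div_le_one (by positivity)]; linarith
      have h6 : (δ + t)⁻¹ * t ≤ 1 := by
        rw [mul_comm, ← div_eq_mul_inv, div_le_one (by positivity)]; linarith
      calc δ * (δ + t)⁻¹ * t * (δ * (δ + t)⁻¹) = δ * ((δ + t)⁻¹ * t) * (δ * (δ + t)⁻¹) := by ring
        _ ≤ δ * 1 * 1 := by gcongr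
        _ = δ := by ring
    have h5 : ‖star w * (star x * x) * w‖ ≤ ‖star w * S * w‖ :=
      CStarAlgebra.norm_le_norm_of_nonneg_of_le
        (star_left_conjugate_nonneg (star_mul_self_nonneg x) w) h2
    have h6 : star w * (star x * x) * w = star (x * w) * (x * w) := by
      rw [star_mul]; simp only [mul_assoc]
    rw [h6, CStarRing.norm_star_mul_self, ← sq] at h5
    exact (pow_le_pow_iff_left₀ (norm_nonneg _) hε.le two_ne_zero).1 (h5.trans h4)
  -- Expanding the product gives `1 - w = v * S`, and `S` lies in the left ideal.
  · have h1 : (1 : B) = v * (algebraMap ℝ B δ + S) := by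
      have h2 : algebraMap ℝ B δ + S = cfc (fun t : ℝ => δ + t) S := by
        rw [cfc_const_add δ (fun t => t) S continuousOn_id, cfc_id' ℝ S]
      rw [h2, hv, ← cfc_mul _ _ S hc (by fun_prop), ← cfc_const_one ℝ S]
      refine cfc_congr fun t ht => ?_
      have := hsp t ht
      have h3 : δ + t ≠ 0 := by positivity
      simp [h3]
    have h2 : 1 - w = v * S := by
      conv_lhs => rw [h1]
      rw [hw, mul_add, ← Algebra.commutes, ← Algebra.smul_def, add_sub_cancel_left]
    rw [h2]
    exact L.smul_mem v hSL

theorem IsSmooth.sub {f g : C(UnitAddCircle, ℂ)} (hf : IsSmooth f) (hg : IsSmooth g) :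
    IsSmooth (f - g) := ContDiff.sub (f := lift f) (g := lift g) hf hg

namespace SmoothAlgebra

variable {θ : ℝ} {f g : C(UnitAddCircle, ℂ)}

theorem single_mul_single (m n : ℤ) (hf : IsSmooth f) (hg : IsSmooth g) :
    single θ m f hf * single θ n g hg =
      single θ (m + n) (f * rot θ m g) (hf.mul (hg.rot θ m)) := by
  refine coeff_injective (funext fun k => ?_)
  rw [coeff_mul, coeff_single, coeff_single, coeff_single, conv, tsum_eq_single m]
  · by_cases h : k = m + n
    · subst h; simp
    · have h' : k - m ≠ n := fun h1 => h (by rw [← h1]; ring)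
      simp [h, h']
  · intro l hl
    simp [hl]

theorem single_zero_one : single θ 0 1 IsSmooth.one = 1 := rfl

theorem star_single (n : ℤ) (hf : IsSmooth f) :
    star (single θ n f hf) = single θ (-n) (rot θ (-n) (star f)) (hf.star.rot θ (-n)) := by
  refine coeff_injective (funext fun k => ?_)
  rw [coeff_star, coeff_single, coeff_single, adj]
  by_cases h : k = -n
  · subst h; simp
  · have h' : -k ≠ n := fun h1 => h (by rw [← h1]; ring)
    simp [h, h']

theorem single_sub (n : ℤ) (hf : IsSmooth f) (hg : IsSmooth g) (hfg : IsSmooth (f - g)) :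
    single θ n (f - g) hfg = single θ n f hf - single θ n g hg := by
  refine coeff_injective (funext fun k => ?_)
  rw [coeff_sub, coeff_single, coeff_single, coeff_single, Pi.single_sub]

theorem single_smul (n : ℤ) (c : ℂ) (hf : IsSmooth f) (hcf : IsSmooth (c • f)) :
    single θ n (c • f) hcf = c • single θ n f hf := by
  refine coeff_injective (funext fun k => ?_)
  rw [coeff_smul, coeff_single, coeff_single]
  by_cases h : k = n
  · subst h; simp
  · rw [Pi.smul_apply, Pi.single_eq_of_ne h, Pi.single_eq_of_ne h]
    exact (smul_zero (A := C(UnitAddCircle, ℂ)) c).symm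

theorem single_sum {ι : Type*} (n : ℤ) (s : Finset ι) (f : ι → C(UnitAddCircle, ℂ))
    (hf : ∀ i, IsSmooth (f i)) (hs : IsSmooth (∑ i ∈ s, f i)) :
    single θ n (∑ i ∈ s, f i) hs = ∑ i ∈ s, single θ n (f i) (hf i) := by
  refine coeff_injective (funext fun k => ?_)
  rw [coeff_sum, coeff_single]
  by_cases h : k = n
  · subst h; simp [coeff_single]
  · simp [coeff_single, h]

end SmoothAlgebra

theorem isSmooth_sum {ι : Type*} (s : Finset ι) {f : ι → C(UnitAddCircle, ℂ)}
    (hf : ∀ i, IsSmooth (f i)) : IsSmooth (∑ i ∈ s, f i) := by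
  classical
  induction s using Finset.induction_on with
  | empty => exact IsSmooth.zero
  | insert a s ha ih => rw [Finset.sum_insert ha]; exact (hf a).add ih

theorem norm_inclusion_single_le {θ : ℝ} (n : ℤ) {f : C(UnitAddCircle, ℂ)} (hf : IsSmooth f) :
    ‖inclusion θ (SmoothAlgebra.single θ n f hf)‖ ≤ ‖f‖ := by
  change ‖(universalPair θ).integrated (SmoothAlgebra.single θ n f hf)‖ ≤ _
  rw [CovariantPair.integrated_single]
  exact (universalPair θ).norm_term_le f n

theorem norm_integral_sq (g : C(UnitAddCircle, ℂ)) :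
    ∫ z, (star g * g) z = ((∫ z, ‖g z‖ ^ 2 : ℝ) : ℂ) := by
  refine Eq.trans ?_ (integral_ofReal (𝕜 := ℂ) (f := fun z => ‖g z‖ ^ 2))
  refine integral_congr_ae (ae_of_all _ fun z => ?_)
  simp only [ContinuousMap.mul_apply, ContinuousMap.star_apply]
  rw [Complex.star_def, Complex.conj_mul']
  push_cast; rfl

section Singular

variable {θ : ℝ} {p : UnitAddCircle} {ξ : UnitAddCircle → ℝ} {e : L1}

theorem single_smul_eq_toL1 (he : e =ᵐ[volume] fun z => (ξ z : ℂ)) {f g : C(UnitAddCircle, ℂ)}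
    (hf : IsSmooth f) (hfg : ∀ z, g z = f z * ξ z) :
    SmoothAlgebra.single θ 0 f hf • e = toL1 g := by
  rw [single_smul_L1, show rotL1 θ 0 = 1 from (pairL1 θ).U_zero, one_apply_eq_self]
  apply Lp.ext
  filter_upwards [mulL1_coe f e, toL1_coe g, he] with z h1 h2 h3
  rw [h1, h2, h3, hfg]

/-- Uniform convergence of the averages of `|g|²` lets a finite average do: it is a nowhere
vanishing smooth function in the cyclic submodule, and multiplying by its reciprocal needs no
closure. -/
theorem toL1_one_mem_cyclicSubmodule (hθ : Irrational θ) (h : HasInvSqrtSingularity p ξ)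
    (he : e =ᵐ[volume] fun z => (ξ z : ℂ)) :
    toL1 1 ∈ cyclicSubmodule (SmoothAlgebra θ) e := by
  obtain ⟨f, g, hf, hg, -, hfg, hI⟩ := h.exists_cutoff 0
  set N := cyclicSubmodule (SmoothAlgebra θ) e
  set I : ℝ := ∫ z, ‖g z‖ ^ 2
  have h1 : toL1 (star g * g) ∈ N := by
    rw [← single_smul_eq_toL1 (θ := θ) he (hg.star.mul hf)
      (fun z => by rw [ContinuousMap.mul_apply, ContinuousMap.mul_apply, hfg]; ring)]
    exact ⟨_, rfl⟩
  have h2 := tendsto_average_rot hθ (star g * g)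
  rw [norm_integral_sq] at h2
  -- The radius is the limit value `I` itself, which is just enough to keep the average away from
  -- `0`.
  obtain ⟨M, hM⟩ := (h2.eventually (Metric.ball_mem_nhds _ hI)).exists
  set k := (M : ℂ)⁻¹ • ∑ n ∈ Finset.range M, rot θ n (star g * g) with hk
  have hks : IsSmooth k :=
    (isSmooth_sum _ (f := fun n : ℕ => rot θ n (star g * g)) fun n => (hg.star.mul hg).rot θ n).smul _
  have hk0 : ∀ z, k z ≠ 0 := fun z hz => by
    have h3 := (ContinuousMap.dist_apply_le_dist z).trans_lt (Metric.mem_ball.1 hM)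
    rw [hz] at h3
    simp at h3
    change |I| < I at h3
    rw [abs_of_pos hI] at h3
    exact lt_irrefl _ h3
  obtain ⟨l, hl, hl'⟩ := exists_isSmooth_of_contDiff (φ := fun z => (k z)⁻¹)
    (ContDiff.inv hks fun x => hk0 _)
  have h4 : toL1 k ∈ N := by
    rw [hk, map_smul, map_sum]
    refine N.smul_of_tower_mem _ (N.sum_mem fun n _ => ?_)
    have h5 := N.smul_mem (SmoothAlgebra.single θ n 1 IsSmooth.one) h1
    rwa [single_smul_L1, rotL1_toL1, mulL1_toL1, one_mul] at h5
  have h5 := N.smul_mem (SmoothAlgebra.single θ 0 l hl) h4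
  rw [single_smul_L1, rotL1_toL1, mulL1_toL1, rot_zero] at h5
  convert h5 using 2
  ext z
  simp [hl', hk0]

/-- The submodule generated by `1` separates: it is nonzero, and its elements are bounded by `∑
‖F(n, ·)‖`, whereas `ξ` is not even in `L²`. -/
theorem not_isSimpleModule_cyclicSubmodule (hθ : Irrational θ) (h : HasInvSqrtSingularity p ξ)
    (he : e =ᵐ[volume] fun z => (ξ z : ℂ)) :
    ¬ IsSimpleModule (SmoothAlgebra θ) (cyclicSubmodule (SmoothAlgebra θ) e) := by
  intro hs
  have h1 := toL1_one_mem_cyclicSubmodule hθ h he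
  have he1 : e ∈ cyclicSubmodule (SmoothAlgebra θ) e := ⟨1, one_smul _ e⟩
  rcases eq_bot_or_eq_top ((cyclicSubmodule (SmoothAlgebra θ) (toL1 1)).comap
    (cyclicSubmodule (SmoothAlgebra θ) e).subtype) with h2 | h2
  · have h3 : (⟨toL1 1, h1⟩ : cyclicSubmodule (SmoothAlgebra θ) e) ∈
        (cyclicSubmodule (SmoothAlgebra θ) (toL1 1)).comap
          (cyclicSubmodule (SmoothAlgebra θ) e).subtype := ⟨1, one_smul _ _⟩
    rw [h2, Submodule.mem_bot] at h3
    have h4 : toL1 1 = toL1 0 := (congrArg Subtype.val h3).trans (map_zero toL1).symm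
    exact one_ne_zero (toL1_injective h4)
  · have h3 : (⟨e, he1⟩ : cyclicSubmodule (SmoothAlgebra θ) e) ∈
        (cyclicSubmodule (SmoothAlgebra θ) (toL1 1)).comap
          (cyclicSubmodule (SmoothAlgebra θ) e).subtype := h2 ▸ Submodule.mem_top
    obtain ⟨F, hF⟩ : ∃ F : SmoothAlgebra θ, F • toL1 1 = e := h3
    refine h.not_memLp_two (MemLp.of_bound h.memLp_one.1 (∑' n, ‖F.coeff n‖) ?_)
    have h4 : ∀ᵐ z : UnitAddCircle, ∀ n : ℤ, toL1 1 (z - n • (θ : UnitAddCircle)) = 1 :=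
      ae_all_iff.2 fun n => (measurePreserving_rot θ n).quasiMeasurePreserving.ae
        (p := fun w => toL1 1 w = 1) (toL1_coe 1)
    filter_upwards [he, ae_hasSum_smul_L1 F (toL1 1), h4] with z hz hz' h4
    simp only [h4, mul_one, hF] at hz'
    rw [← hz, ← hz'.tsum_eq]
    exact tsum_of_norm_bounded F.isSchwartz.summable_norm.hasSum
      fun n => (F.coeff n).norm_coe_le_norm z

/-- The annihilator of the cyclic vector `ξ` in `A_θ^∞` is not the trace of a closed left ideal
of `A_θ`. -/
theorem false_of_leftIdeal (hθ : Irrational θ) (h : HasInvSqrtSingularity p ξ)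
    (he : e =ᵐ[volume] fun z => (ξ z : ℂ)) (L : Submodule (FullAlgebra θ) (FullAlgebra θ))
    (hL : IsClosed (L : Set (FullAlgebra θ)))
    (hLe : ∀ a : SmoothAlgebra θ, inclusion θ a ∈ L ↔ a • e = 0) : False := by
  obtain ⟨a, ha⟩ : ∃ a : SmoothAlgebra θ, a • e = toL1 1 := toL1_one_mem_cyclicSubmodule hθ h he
  set b := inclusion θ a with hb
  have hbL : b ∉ L := fun hbL => by
    rw [hLe, ha, ← map_zero toL1] at hbL
    exact one_ne_zero (toL1_injective hbL)
  set d := Metric.infDist b L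
  have hd : 0 < d := (hL.notMem_iff_infDist_pos ⟨0, L.zero_mem⟩).1 hbL
  -- The threshold contradicts the final estimate `I * ‖c‖ ^ 2 ≤ 5`, given `‖c‖ ≥ d`. There `5 = 2²
  -- + 1`: each average term has norm at most `4`, and the error of the average costs at most `δ *
  -- ‖b‖ ^ 2 ≤ 1`.
  obtain ⟨f, g, hf, hg, hf1, hfg, hI⟩ := h.exists_cutoff (5 / d ^ 2)
  set I : ℝ := ∫ z, ‖g z‖ ^ 2
  let i : ∀ k : C(UnitAddCircle, ℂ), IsSmooth k → FullAlgebra θ := fun k hk =>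
    inclusion θ (SmoothAlgebra.single θ 0 k hk)
  let V : ℤ → FullAlgebra θ := fun n => inclusion θ (SmoothAlgebra.single θ n 1 IsSmooth.one)
  -- Modulo `L`, the element `b` represents the constant function `1`: it is rotation invariant, and
  -- next, `g b ≡ f` because `g · 1 = f ξ`.
  have hVL : ∀ n, (V n - 1) * b ∈ L := fun n => by
    rw [← map_one (inclusion θ), ← map_sub, ← map_mul, hLe, mul_smul, ha, sub_smul, one_smul,
      single_smul_L1, rotL1_toL1, mulL1_toL1, one_mul, map_one, sub_self]
  have hgL : i g hg * b - i f hf ∈ L := by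
    rw [← map_mul, ← map_sub, hLe, sub_smul, mul_smul, ha, single_smul_eq_toL1 he hf hfg,
      single_smul_L1, rotL1_toL1, mulL1_toL1, map_one, mul_one, sub_self]
  obtain ⟨δ, hδ, hδb⟩ : ∃ δ : ℝ, 0 < δ ∧ δ * ‖b‖ ^ 2 ≤ 1 :=
    ⟨(1 + ‖b‖ ^ 2)⁻¹, by positivity, by
      rw [inv_mul_le_iff₀ (by positivity)]; linarith⟩
  have h2 := tendsto_average_rot hθ (star g * g)
  rw [norm_integral_sq] at h2
  obtain ⟨M, hM, hM0⟩ := ((h2.eventually (Metric.ball_mem_nhds _ hδ)).and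
    (eventually_gt_atTop 0)).exists
  -- Chosen so that both error terms in `hy`, `‖g‖ * ε` and `ε`, add up to `1`.
  obtain ⟨ε, hε, hε1⟩ : ∃ ε : ℝ, 0 < ε ∧ ε * (1 + ‖g‖) = 1 :=
    ⟨(1 + ‖g‖)⁻¹, by positivity, inv_mul_cancel₀ (by positivity)⟩
  classical
  obtain ⟨w, hw1, hwε, hwL⟩ := exists_approximate_annihilator L
    (insert (i g hg * b - i f hf) ((Finset.range M).image fun n : ℕ => (V (-n) - 1) * b))
    (fun x hx => by
      rcases Finset.mem_insert.1 hx with rfl | hx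
      · exact hgL
      · obtain ⟨n, -, rfl⟩ := Finset.mem_image.1 hx
        exact hVL _) hε
  -- Multiplying by `w` does not change the class of `b` modulo `L`, as `b - b * w = b * (1 - w)`.
  have hdw : d ≤ ‖b * w‖ := by
    have h3 := Metric.infDist_le_dist_of_mem (x := b) (L.smul_mem b hwL)
    rwa [dist_eq_norm, smul_eq_mul, mul_sub, mul_one, sub_sub_cancel] at h3
  have hy : ∀ n ∈ Finset.range M, ‖i g hg * V (-(n : ℤ)) * (b * w)‖ ≤ 2 := fun n hn => by
    have h3 : i g hg * V (-(n : ℤ)) * (b * w) = i g hg * ((V (-(n : ℤ)) - 1) * b * w) +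
        (i g hg * b - i f hf) * w + i f hf * w := by noncomm_ring
    have h4 : ‖(V (-(n : ℤ)) - 1) * b * w‖ ≤ ε :=
      hwε _ (Finset.mem_insert_of_mem (Finset.mem_image_of_mem _ hn))
    have h5 : ‖(i g hg * b - i f hf) * w‖ ≤ ε := hwε _ (Finset.mem_insert_self _ _)
    have h6 : ‖i g hg‖ ≤ ‖g‖ := norm_inclusion_single_le 0 hg
    have h7 : ‖i f hf‖ ≤ 1 := (norm_inclusion_single_le 0 hf).trans hf1
    have h8 : ‖i g hg * ((V (-(n : ℤ)) - 1) * b * w)‖ ≤ ‖g‖ * ε :=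
      (norm_mul_le _ _).trans (mul_le_mul h6 h4 (norm_nonneg _) (norm_nonneg _))
    have h9 : ‖i f hf * w‖ ≤ 1 * 1 :=
      (norm_mul_le _ _).trans (mul_le_mul h7 hw1 (norm_nonneg _) zero_le_one)
    rw [h3]
    refine (norm_add₃_le).trans ?_
    linarith
  set c := b * w with hc
  have hcb : ‖c‖ ≤ ‖b‖ := (norm_mul_le _ _).trans (mul_le_of_le_one_right (norm_nonneg _) hw1)
  -- Rotation is implemented by conjugation, `rot θ n |g|² = V n |g|² V (-n)`, so each term of the
  -- average becomes a square whose norm `hy` controls.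
  have hterm : ∀ n : ℕ, star c * i (rot θ n (star g * g)) ((hg.star.mul hg).rot θ n) * c =
      star (i g hg * V (-(n : ℤ)) * c) * (i g hg * V (-(n : ℤ)) * c) := fun n => by
    have h3 : i (rot θ n (star g * g)) ((hg.star.mul hg).rot θ n) =
        star (i g hg * V (-(n : ℤ))) * (i g hg * V (-(n : ℤ))) := by
      simp only [i, V]
      rw [← map_mul, ← map_star, ← map_mul]
      congr 1
      rw [SmoothAlgebra.single_mul_single, SmoothAlgebra.star_single,
        SmoothAlgebra.single_mul_single]
      refine SmoothAlgebra.coeff_injective ?_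
      simp only [SmoothAlgebra.coeff_single, mul_one, zero_add, neg_neg, map_mul, map_one,
        add_neg_cancel]
    rw [h3, star_mul (i g hg * V (-(n : ℤ))) c]
    simp only [mul_assoc]
  set k := (M : ℂ)⁻¹ • ∑ n ∈ Finset.range M, rot θ n (star g * g) with hk
  have hsum : IsSmooth (∑ n ∈ Finset.range M, rot θ n (star g * g)) :=
    isSmooth_sum _ (f := fun n : ℕ => rot θ n (star g * g)) fun n => (hg.star.mul hg).rot θ n
  have hks : IsSmooth k := hsum.smul _
  have hkc : ‖star c * i k hks * c‖ ≤ 4 := by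
    have h3 : i k hks = (M : ℂ)⁻¹ • ∑ n ∈ Finset.range M,
        i (rot θ n (star g * g)) ((hg.star.mul hg).rot θ n) := by
      simp only [i]
      rw [SmoothAlgebra.single_smul 0 _ hsum, map_smul,
        SmoothAlgebra.single_sum 0 _ (fun n : ℕ => rot θ n (star g * g)) (fun n => (hg.star.mul hg).rot θ n), map_sum]
    rw [h3, mul_smul_comm, smul_mul_assoc, Finset.mul_sum, Finset.sum_mul, norm_smul, norm_inv,
      Complex.norm_natCast, inv_mul_le_iff₀ (by positivity)]
    refine (norm_sum_le_of_le _ (f := fun n : ℕ => _) (n := fun _ => 4) fun n hn => ?_).trans_eq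
      (by simp)
    rw [hterm, CStarRing.norm_star_mul_self]
    nlinarith [hy n hn, norm_nonneg (i g hg * V (-(n : ℤ)) * c)]
  have hIs : IsSmooth ((I : ℂ) • (1 : C(UnitAddCircle, ℂ))) := IsSmooth.one.smul _
  have hdiff : ‖i k hks - (I : ℂ) • 1‖ ≤ δ := by
    have h3 : i k hks - (I : ℂ) • 1 =
        inclusion θ (SmoothAlgebra.single θ 0 (k - (I : ℂ) • 1) (hks.sub hIs)) := by
      rw [SmoothAlgebra.single_sub 0 hks hIs (hks.sub hIs), SmoothAlgebra.single_smul 0 _ IsSmooth.one,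
        SmoothAlgebra.single_zero_one, map_sub, map_smul, map_one]
    rw [h3]
    refine (norm_inclusion_single_le 0 _).trans ?_
    rw [← dist_eq_norm]
    exact (Metric.mem_ball.1 hM).le
  have hI0 : 0 < I := lt_of_le_of_lt (by positivity) hI
  have hfinal : I * ‖c‖ ^ 2 ≤ 5 := by
    have h3 : ((I : ℂ) • (star c * c)) =
        star c * i k hks * c - star c * (i k hks - (I : ℂ) • 1) * c := by
      rw [mul_sub, sub_mul, mul_smul_comm, smul_mul_assoc, mul_one, sub_sub_cancel]
    have h4 : ‖(I : ℂ) • (star c * c)‖ = I * ‖c‖ ^ 2 := by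
      rw [norm_smul, CStarRing.norm_star_mul_self, Complex.norm_real, Real.norm_of_nonneg hI0.le, sq]
    rw [← h4, h3]
    have h5 : ‖star c * (i k hks - (I : ℂ) • 1) * c‖ ≤ ‖b‖ * δ * ‖b‖ := by
      refine (norm_mul_le _ _).trans (mul_le_mul ((norm_mul_le _ _).trans
        (mul_le_mul ?_ hdiff (norm_nonneg _) (norm_nonneg _))) hcb (norm_nonneg _) (by positivity))
      rwa [norm_star]
    refine (norm_sub_le _ _).trans ?_
    nlinarith
  rw [div_lt_iff₀ (by positivity)] at hI
  have : I * d ^ 2 ≤ I * ‖c‖ ^ 2 := by gcongr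
  linarith

/-- The left ideal is the annihilator of the vector `J x`. It is closed because `π` is contractive,
and injectivity of `J` makes its trace on `A_θ^∞` the annihilator of `e`. -/
theorem not_cyclicContainedInStarRep (hθ : Irrational θ) (h : HasInvSqrtSingularity p ξ)
    (he : e =ᵐ[volume] fun z => (ξ z : ℂ)) {H : Type*} [NormedAddCommGroup H]
    [InnerProductSpace ℂ H] [CompleteSpace H] (π : FullAlgebra θ →⋆ₙₐ[ℂ] (H →L[ℂ] H)) :
    ¬ CyclicContainedInStarRep (inclusion θ : SmoothAlgebra θ →ₐ[ℂ] FullAlgebra θ) e π := by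
  rintro ⟨J, hJ, -, hJπ⟩
  let x : cyclicSubmodule (SmoothAlgebra θ) e := ⟨e, 1, one_smul _ e⟩
  let L : Submodule (FullAlgebra θ) (FullAlgebra θ) :=
    { carrier := {b | π b (J x) = 0}
      add_mem' := fun {b c} (hb : π b (J x) = 0) (hc : π c (J x) = 0) => by
        rw [Set.mem_ofPred_eq, map_add, add_apply, hb, hc, add_zero]
      zero_mem' := by simp
      smul_mem' := fun c b (hb : π b (J x) = 0) => by
        rw [Set.mem_ofPred_eq, smul_eq_mul, map_mul, mul_apply_eq_comp, hb, map_zero] }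
  have hπ : Continuous π := AddMonoidHomClass.continuous_of_bound π 1 fun b => by
    simpa using NonUnitalStarAlgHom.norm_apply_le π b
  refine false_of_leftIdeal hθ h he L
    (isClosed_eq (hπ.clm_apply continuous_const) continuous_const) fun a => ?_
  change π (inclusion θ a) (J x) = 0 ↔ _
  have h1 : π (inclusion θ a) (J x) = J (a • x) := (hJπ a x).symm
  rw [h1, map_eq_zero_iff J hJ, Subtype.ext_iff]
  rfl

/-- As for Hilbert spaces; here the annihilator is closed because the action is continuous and `X`
is Hausdorff. -/
theorem not_cyclicContainedInModule (hθ : Irrational θ) (h : HasInvSqrtSingularity p ξ)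
    (he : e =ᵐ[volume] fun z => (ξ z : ℂ)) {X : Type*} [AddCommGroup X] [Module ℂ X]
    [TopologicalSpace X] [T2Space X] [Module (FullAlgebra θ) X] [ContinuousSMul (FullAlgebra θ) X] :
    ¬ CyclicContainedInModule (inclusion θ : SmoothAlgebra θ →ₐ[ℂ] FullAlgebra θ) e X := by
  rintro ⟨J, hJ, -, hJX⟩
  let x : cyclicSubmodule (SmoothAlgebra θ) e := ⟨e, 1, one_smul _ e⟩
  refine false_of_leftIdeal hθ h he (LinearMap.toSpanSingleton (FullAlgebra θ) X (J x)).ker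
    (isClosed_eq (continuous_id.smul continuous_const) continuous_const) fun a => ?_
  have h1 : inclusion θ a • J x = J (a • x) := (hJX a x).symm
  rw [LinearMap.mem_ker, LinearMap.toSpanSingleton_apply, h1, map_eq_zero_iff J hJ,
    Subtype.ext_iff]
  rfl

theorem not_cyclicSubmodulesExtend.{w} (hθ : Irrational θ) :
    ¬ CyclicSubmodulesExtend.{0, w, 0, 1}
      (inclusion θ : SmoothAlgebra θ →ₐ[ℂ] FullAlgebra θ) := by
  intro hext
  obtain ⟨ξ, hξ⟩ := exists_hasInvSqrtSingularity 0
  obtain ⟨X, _, _, _, _, _, hX, _, hc⟩ :=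
    hext L1 (isTopologicallyIrreducible_L1 hθ) (hξ.memLp_one.toLp _)
  have := hX.t2
  exact not_cyclicContainedInModule hθ hξ (MemLp.coeFn_toLp hξ.memLp_one) hc

end Singular

end RotationAlgebra

end

/-! ### Orbit representations on `ℓ²(ℤ)`, injectivity and density of the inclusion. -/

noncomputable section

namespace RotationAlgebra

/-- The Hilbert space `ℓ²(ℤ)`. -/
abbrev Ell2 : Type := lp (fun _ : ℤ => ℂ) 2

/-- The standard basis vectors of `ℓ²(ℤ)`. -/
def basisVec (l : ℤ) : Ell2 := lp.single 2 l 1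

theorem basisVec_apply (l m : ℤ) : basisVec l m = if m = l then 1 else 0 := by
  rw [basisVec, lp.single_apply, Pi.single_apply]

theorem norm_basisVec (l : ℤ) : ‖basisVec l‖ = 1 := by
  rw [basisVec, lp.norm_single (by norm_num)]; simp

theorem clm_ext_basisVec {A B : Ell2 →L[ℂ] Ell2} (h : ∀ l m, A (basisVec l) m = B (basisVec l) m) :
    A = B := by
  ext1 x
  have hx := lp.hasSum_single (p := 2) (by norm_num) x
  have h1 : ∀ l, A (lp.single 2 l (x l)) = B (lp.single 2 l (x l)) := fun l => by
    have h2 : (lp.single 2 l (x l) : Ell2) = x l • basisVec l := by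
      rw [basisVec, ← lp.single_smul, smul_eq_mul, mul_one]
    rw [h2, map_smul, map_smul]
    congr 1
    exact lp.ext (funext (h l))
  refine (A.hasSum hx).unique ?_
  simpa only [h1] using B.hasSum hx

/-- The operator `x ↦ (m ↦ a(m) x(m - n))` on `ℓ²(ℤ)`, for a bounded sequence `a`. -/
def weightedShift (a : ℤ → ℂ) {C : ℝ} (ha : ∀ m, ‖a m‖ ≤ C) (n : ℤ) : Ell2 →L[ℂ] Ell2 :=
  have hC : 0 ≤ C := (norm_nonneg _).trans (ha 0)
  have hle : ∀ (x : Ell2) (m : ℤ), ‖a m * x (m - n)‖ ^ (2 : ℝ≥0∞).toReal ≤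
      C ^ (2 : ℝ≥0∞).toReal * ‖x (m - n)‖ ^ (2 : ℝ≥0∞).toReal := fun x m => by
    rw [norm_mul, Real.mul_rpow (norm_nonneg _) (norm_nonneg _)]
    gcongr
    exact ha m
  have hx : ∀ x : Ell2, HasSum (fun m => C ^ (2 : ℝ≥0∞).toReal * ‖x (m - n)‖ ^ (2 : ℝ≥0∞).toReal)
      ((C * ‖x‖) ^ (2 : ℝ≥0∞).toReal) := fun x => by
    rw [Real.mul_rpow hC (norm_nonneg _)]
    exact ((Equiv.subRight n).hasSum_iff.2 (lp.hasSum_norm (by norm_num) x)).mul_left _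
  have hs : ∀ x : Ell2, Summable fun m => ‖a m * x (m - n)‖ ^ (2 : ℝ≥0∞).toReal := fun x =>
    Summable.of_nonneg_of_le (fun _ => by positivity) (hle x) (hx x).summable
  LinearMap.mkContinuous
    { toFun := fun x => ⟨fun m => a m * x (m - n), memℓp_gen (hs x)⟩
      map_add' := fun x y => by
        ext m; exact mul_add _ _ _
      map_smul' := fun c x => by
        ext m; exact mul_left_comm _ _ _ } C fun x =>
    lp.norm_le_of_tsum_le (by norm_num) (by positivity)
      (((hs x).tsum_le_tsum (hle x) (hx x).summable).trans_eq (hx x).tsum_eq)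

theorem weightedShift_apply (a : ℤ → ℂ) {C : ℝ} (ha : ∀ m, ‖a m‖ ≤ C) (n : ℤ) (x : Ell2) (m : ℤ) :
    weightedShift a ha n x m = a m * x (m - n) := rfl

theorem star_weightedShift (a : ℤ → ℂ) {C : ℝ} (ha : ∀ m, ‖a m‖ ≤ C) (n : ℤ) :
    star (weightedShift a ha n) =
      weightedShift (fun m => star (a (m + n))) (fun m => by rw [norm_star]; exact ha _) (-n) := by
  rw [ContinuousLinearMap.star_eq_adjoint, eq_comm, ContinuousLinearMap.eq_adjoint_iff]
  intro x y
  rw [lp.inner_eq_tsum, lp.inner_eq_tsum, ← (Equiv.subRight n).tsum_eq]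
  congr 1; ext1 m
  simp only [weightedShift_apply, Equiv.subRight_apply, sub_neg_eq_add, sub_add_cancel,
    RCLike.inner_apply, map_mul, ← Complex.star_def, star_star]
  ring

variable (θ : ℝ)

/-- Multiplication by `m ↦ f(z + mθ)` on `ℓ²(ℤ)`. -/
def orbitMul (z : UnitAddCircle) (f : C(UnitAddCircle, ℂ)) : Ell2 →L[ℂ] Ell2 :=
  weightedShift (fun m => f (z + m • (θ : UnitAddCircle))) (fun _ => f.norm_coe_le_norm _) 0

theorem orbitMul_apply (z : UnitAddCircle) (f : C(UnitAddCircle, ℂ)) (x : Ell2) (m : ℤ) :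
    orbitMul θ z f x m = f (z + m • (θ : UnitAddCircle)) * x m := by
  rw [orbitMul, weightedShift_apply, sub_zero]

/-- The shift by `n` on `ℓ²(ℤ)`, multiplied by the value of a character of `ℤ`. -/
def charShift (u : UnitAddCircle) (n : ℤ) : Ell2 →L[ℂ] Ell2 :=
  weightedShift (C := 1) (fun _ => fourier n u) (fun _ => by rw [fourier_apply, Circle.norm_coe]) n

theorem charShift_apply (u : UnitAddCircle) (n : ℤ) (x : Ell2) (m : ℤ) :
    charShift u n x m = fourier n u * x (m - n) := rfl

theorem charShift_zero (u : UnitAddCircle) : charShift u 0 = 1 := by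
  ext x m
  rw [charShift_apply, fourier_zero, one_mul, sub_zero]; rfl

theorem charShift_add (u : UnitAddCircle) (n k : ℤ) :
    charShift u (n + k) = charShift u n * charShift u k := by
  ext x m
  rw [mul_apply_eq_comp, charShift_apply, charShift_apply, charShift_apply, fourier_add, mul_assoc,
    sub_sub]

theorem star_charShift (u : UnitAddCircle) (n : ℤ) : star (charShift u n) = charShift u (-n) := by
  ext x m
  rw [charShift, star_weightedShift, weightedShift_apply, charShift_apply, fourier_neg]; rfl

theorem charShift_mul_orbitMul (u z : UnitAddCircle) (n : ℤ) (f : C(UnitAddCircle, ℂ)) :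
    charShift u n * orbitMul θ z f = orbitMul θ z (rot θ n f) * charShift u n := by
  ext x m
  rw [mul_apply_eq_comp, mul_apply_eq_comp, charShift_apply, orbitMul_apply, orbitMul_apply,
    charShift_apply, rot_apply, sub_smul, ← add_sub_assoc]
  ring

theorem charShift_mem_unitary (u : UnitAddCircle) (n : ℤ) :
    charShift u n ∈ unitary (Ell2 →L[ℂ] Ell2) := by
  rw [Unitary.mem_iff, star_charShift, ← charShift_add, ← charShift_add, neg_add_cancel,
    add_neg_cancel, charShift_zero]
  exact ⟨rfl, rfl⟩

/-- The orbit representation of `(C(𝕋), ℤ)` on `ℓ²(ℤ)` at the point `z`, twisted by the character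
of `ℤ` that corresponds to `u`. -/
def orbitRep (u z : UnitAddCircle) : CovariantRep θ where
  H := Ell2
  nontrivial := ⟨basisVec 0, 0, fun h => by
    have := norm_basisVec 0
    rw [h, norm_zero] at this
    exact zero_ne_one this⟩
  π :=
    { toFun := orbitMul θ z
      map_one' := by
        ext x m; rw [orbitMul_apply, ContinuousMap.one_apply, one_mul]; rfl
      map_mul' := fun f g => by
        ext x m
        rw [mul_apply_eq_comp, orbitMul_apply, orbitMul_apply, orbitMul_apply,
          ContinuousMap.mul_apply, mul_assoc]
      map_zero' := by
        ext x m; rw [orbitMul_apply, ContinuousMap.zero_apply, zero_mul]; rfl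
      map_add' := fun f g => by
        ext x m; exact add_mul _ _ _
      commutes' := fun c => by
        ext x m; rw [orbitMul_apply]; rfl
      map_star' := fun f => by
        ext x m
        rw [orbitMul_apply, orbitMul, star_weightedShift, weightedShift_apply, add_zero, neg_zero,
          sub_zero]
        rfl }
  U :=
    { toFun := fun n => ⟨charShift u n.toAdd, charShift_mem_unitary u _⟩
      map_one' := Subtype.ext (charShift_zero u)
      map_mul' := fun n k => Subtype.ext (charShift_add u n.toAdd k.toAdd) }
  cov := fun n f => by
    change charShift u n * orbitMul θ z f * star (charShift u n) = orbitMul θ z (rot θ n f)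
    rw [charShift_mul_orbitMul, mul_assoc, (charShift_mem_unitary u n).2, mul_one]

variable {θ}

/-- A covariant representation as a covariant pair. -/
def CovariantRep.toPair (r : CovariantRep θ) : CovariantPair θ (r.H →L[ℂ] r.H) where
  π := r.π
  U n := r.U (.ofAdd n)
  norm_π_le := r.norm_π_le
  norm_U_le := r.norm_U_le
  U_zero := by simp
  U_add m n := by simp
  cov := r.cov'

theorem universalPair_integrated_apply (F : SmoothAlgebra θ) (r : CovariantRep θ) :
    (universalPair θ).integrated F r = r.toPair.integrated F :=
  (lp.evalCLM ℂ (fun r : CovariantRep θ => r.H →L[ℂ] r.H) ∞ r).map_tsum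
    ((universalPair θ).summable F)

/-- The image of an element of `A_θ^∞` in the orbit representation. -/
def orbitOp (u z : UnitAddCircle) : SmoothAlgebra θ →ₐ[ℂ] (Ell2 →L[ℂ] Ell2) :=
  (orbitRep θ u z).toPair.integrated

/-- In the series for `F` only the term `n = m - l` moves the basis vector `l` to the position `m`.
This makes the coefficients of `F` readable from the operators. -/
theorem orbitOp_basisVec (u z : UnitAddCircle) (F : SmoothAlgebra θ) (l m : ℤ) :
    orbitOp u z F (basisVec l) m =
      fourier (m - l) u * F.coeff (m - l) (z + m • (θ : UnitAddCircle)) := by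
  have h1 : HasSum (fun n => (orbitRep θ u z).toPair.π (F.coeff n) * (orbitRep θ u z).toPair.U n)
      (orbitOp u z F) := ((orbitRep θ u z).toPair.summable F).hasSum
  have h2 := ((lp.evalCLM ℂ (fun _ : ℤ => ℂ) 2 m).comp
    (ContinuousLinearMap.apply ℂ Ell2 (basisVec l))).hasSum h1
  have h3 : ∀ n, F.coeff n (z + m • (θ : UnitAddCircle)) *
      ((fourier n u : ℂ) * basisVec l (m - n)) =
      if n = m - l then fourier (m - l) u * F.coeff (m - l) (z + m • (θ : UnitAddCircle))
      else 0 := fun n => by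
    rw [basisVec_apply]
    by_cases h : n = m - l
    · subst h; simp [mul_comm]
    · have : ¬ (m - n = l) := fun h' => h (by rw [← h']; ring)
      rw [if_neg this, if_neg h, mul_zero, mul_zero]
  refine h2.unique ?_
  have h4 : ∀ n, ((orbitMul θ z (F.coeff n) * charShift u n) (basisVec l)) m =
      F.coeff n (z + m • (θ : UnitAddCircle)) * ((fourier n u : ℂ) * basisVec l (m - n)) :=
    fun n => by rw [mul_apply_eq_comp, orbitMul_apply, charShift_apply]
  refine HasSum.congr_fun ?_ h4
  change HasSum (fun n => F.coeff n (z + m • (θ : UnitAddCircle)) *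
      ((fourier n u : ℂ) * basisVec l (m - n))) _
  simp only [h3]
  exact hasSum_ite_eq _ _

theorem eq_of_orbitOp {F G : SmoothAlgebra θ} (h : ∀ z, orbitOp 0 z F = orbitOp 0 z G) : F = G := by
  refine SmoothAlgebra.coeff_injective (funext fun n => ContinuousMap.ext fun z => ?_)
  -- The base point is moved back by `nθ` so that row `n` evaluates `F(n, ·)` exactly at `z`.
  have h1 : orbitOp 0 (z - n • (θ : UnitAddCircle)) F (basisVec 0) n =
      orbitOp 0 (z - n • (θ : UnitAddCircle)) G (basisVec 0) n := by rw [h]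
  simpa [orbitOp_basisVec] using h1

theorem inclusion_injective : Function.Injective (inclusion θ) := by
  intro F G h
  refine eq_of_orbitOp fun z => ?_
  have h1 : (universalPair θ).integrated F = (universalPair θ).integrated G :=
    congrArg Subtype.val h
  exact (universalPair_integrated_apply F _).symm.trans
    ((congrArg (fun T : UniversalTarget θ => T (orbitRep θ 0 z)) h1).trans
      (universalPair_integrated_apply G _))

theorem continuous_inclusion : Continuous (inclusion θ) :=
  (universalPair θ).continuous_integrated.subtype_mk _

/-- It is enough to approximate the generators: the `Uⁿ` come from `A_θ^∞` itself, and a continuous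
function is a uniform limit of trigonometric polynomials. -/
theorem denseRange_inclusion : DenseRange (inclusion θ) := by
  let j : SmoothAlgebra θ →⋆ₐ[ℂ] UniversalTarget θ := (crossedProduct θ).subtype.comp (inclusion θ)
  have hj : ∀ F, j F = (universalPair θ).integrated F := fun _ => rfl
  have hle : crossedProduct θ ≤ j.range.topologicalClosure := by
    refine StarSubalgebra.topologicalClosure_minimal ?_
      (StarSubalgebra.isClosed_topologicalClosure _)
    rw [StarAlgebra.adjoin_le_iff]
    rintro _ (⟨f, rfl⟩ | ⟨n, rfl⟩)
    · have h1 : ∀ g ∈ Submodule.span ℂ (Set.range (fourier (T := 1))),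
          (universalPair θ).π g ∈ j.range.topologicalClosure := fun g hg => by
        induction hg using Submodule.span_induction with
        | mem x hx =>
          obtain ⟨k, rfl⟩ := hx
          refine StarSubalgebra.le_topologicalClosure _
            ⟨SmoothAlgebra.single θ 0 _ (isSmooth_fourier k), ?_⟩
          change (universalPair θ).integrated _ = _
          rw [CovariantPair.integrated_single, (universalPair θ).U_zero, mul_one]
        | zero => rw [map_zero]; exact zero_mem _
        | add x y _ _ hx hy => rw [map_add]; exact add_mem hx hy
        | smul c x _ hx => rw [map_smul]; exact SMulMemClass.smul_mem c hx
      exact closure_minimal (t := (universalPair θ).π ⁻¹' (j.range.topologicalClosure : Set (UniversalTarget θ)))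
        (fun g hg => h1 g hg)
        ((StarSubalgebra.isClosed_topologicalClosure _).preimage (universalPair θ).continuous_π)
        (dense_span_fourier f)
    · refine StarSubalgebra.le_topologicalClosure _
        ⟨SmoothAlgebra.single θ n 1 IsSmooth.one, ?_⟩
      change (universalPair θ).integrated _ = _
      rw [CovariantPair.integrated_single, map_one, one_mul]
  intro b
  refine closure_subtype.2 ?_
  have h2 : b.1 ∈ closure (j.range : Set (UniversalTarget θ)) := hle b.2
  convert h2 using 2
  ext x
  constructor
  · rintro ⟨_, ⟨F, rfl⟩, rfl⟩; exact ⟨F, rfl⟩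
  · rintro ⟨F, rfl⟩; exact ⟨_, ⟨F, rfl⟩, rfl⟩

end RotationAlgebra

end

/-! ### Smooth dependence of the orbit operators on their parameters. -/

noncomputable section

namespace RotationAlgebra

/-- The translate `z ↦ f(z + s)`. -/
def translate (f : C(UnitAddCircle, ℂ)) (s : ℝ) : C(UnitAddCircle, ℂ) :=
  f.comp ⟨fun z => z + (s : UnitAddCircle), by fun_prop⟩

theorem translate_apply (f : C(UnitAddCircle, ℂ)) (s : ℝ) (z : UnitAddCircle) :
    translate f s z = f (z + (s : UnitAddCircle)) := rfl

theorem norm_translate_le (f : C(UnitAddCircle, ℂ)) (s : ℝ) : ‖translate f s‖ ≤ ‖f‖ :=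
  (ContinuousMap.norm_le _ (norm_nonneg _)).2 fun _ => f.norm_coe_le_norm _

theorem continuous_translate (f : C(UnitAddCircle, ℂ)) : Continuous (translate f) := by
  refine ContinuousMap.continuous_of_continuous_uncurry _ ?_
  have : Continuous fun x : ℝ => (x : UnitAddCircle) := isOpenQuotientMap_coe.continuous
  change Continuous fun p : ℝ × UnitAddCircle => f (p.2 + (p.1 : UnitAddCircle))
  fun_prop

theorem periodic_deriv {g : ℝ → ℂ} (hg : Function.Periodic g 1) : Function.Periodic (deriv g) 1 :=
  fun x => by
    rw [← deriv_comp_add_const, show (fun x => g (x + 1)) = g from funext hg]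

theorem IsSmooth.exists_deriv {f : C(UnitAddCircle, ℂ)} (hf : IsSmooth f) :
    ∃ g, IsSmooth g ∧ lift g = deriv (lift f) := by
  have hp := periodic_deriv (lift_periodic f)
  have h1 : (fun x : ℝ => hp.lift (x : UnitAddCircle)) = deriv (lift f) :=
    funext fun x => hp.lift_coe x
  obtain ⟨g, hg, hg'⟩ := exists_isSmooth_of_contDiff (φ := hp.lift)
    (by rw [h1]; exact (contDiff_infty_iff_deriv.1 hf).2)
  exact ⟨g, hg, by rw [← h1]; exact funext fun x => hg' _⟩

/-- The derivative is taken in the sup norm. The fundamental theorem of calculus, checked by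
evaluating at points, writes the translate as a `C(𝕋)`-valued integral with continuous integrand. -/
theorem hasDerivAt_translate {f g : C(UnitAddCircle, ℂ)} (hf : IsSmooth f)
    (hfg : lift g = deriv (lift f)) (s : ℝ) : HasDerivAt (translate f) (translate g s) s := by
  have hg := continuous_translate g
  have h1 : ∀ s, translate f s = translate f 0 + ∫ u in (0 : ℝ)..s, translate g u := by
    intro s
    ext z
    obtain ⟨x, rfl⟩ := QuotientAddGroup.mk_surjective z
    have h2 := (ContinuousMap.evalCLM ℂ (x : UnitAddCircle)).intervalIntegral_comp_comm
      (hg.intervalIntegrable (μ := volume) 0 s)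
    have h3 : ∫ u in (0 : ℝ)..s, lift g (x + u) = lift f (x + s) - lift f (x + 0) := by
      refine intervalIntegral.integral_eq_sub_of_hasDerivAt (f := fun u => lift f (x + u))
        (fun u _ => ?_) ?_
      · rw [hfg]
        have h4 : HasDerivAt (lift f) (deriv (lift f) (x + u)) (x + u) :=
          (hf.differentiable (by simp) _).hasDerivAt
        exact h4.comp_const_add x u
      · have : Continuous (lift g) := g.continuous.comp isOpenQuotientMap_coe.continuous
        exact (this.comp (continuous_const.add continuous_id)).intervalIntegrable _ _
    have h5 : (∫ u in (0 : ℝ)..s, translate g u) (x : UnitAddCircle) =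
        ∫ u in (0 : ℝ)..s, lift g (x + u) := by
      refine h2.symm.trans ?_
      congr 1
    change translate f s (x : UnitAddCircle) = translate f 0 (x : UnitAddCircle) +
      (∫ u in (0 : ℝ)..s, translate g u) (x : UnitAddCircle)
    rw [h5, h3]
    change lift f (x + s) = lift f (x + 0) + _
    ring
  have h2 : translate f = fun s => translate f 0 + ∫ u in (0 : ℝ)..s, translate g u := funext h1
  rw [h2]
  exact (hg.integral_hasStrictDerivAt 0 s).hasDerivAt.const_add _

theorem contDiff_translate {f : C(UnitAddCircle, ℂ)} (hf : IsSmooth f) :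
    ContDiff ℝ ∞ (translate f) := by
  refine contDiff_infty.2 fun n => ?_
  induction n generalizing f with
  | zero => exact contDiff_zero.2 (continuous_translate f)
  | succ n ih =>
    obtain ⟨g, hg, hfg⟩ := hf.exists_deriv
    have h1 := hasDerivAt_translate hf hfg
    have h2 : deriv (translate f) = translate g := funext fun s => (h1 s).deriv
    push_cast
    rw [contDiff_succ_iff_deriv, h2]
    exact ⟨fun s => (h1 s).differentiableAt, by simp, ih hg⟩

theorem norm_iteratedDeriv_translate_le {f : C(UnitAddCircle, ℂ)} (hf : IsSmooth f) (j : ℕ)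
    (s : ℝ) : ‖iteratedDeriv j (translate f) s‖ ≤ derivSup j f := by
  induction j generalizing f with
  | zero => rw [iteratedDeriv_zero]; exact (norm_translate_le f s).trans (norm_le_derivSup hf)
  | succ j ih =>
    obtain ⟨g, hg, hfg⟩ := hf.exists_deriv
    have h2 : deriv (translate f) = translate g :=
      funext fun s => (hasDerivAt_translate hf hfg s).deriv
    rw [iteratedDeriv_succ', h2]
    refine (ih hg).trans_eq ?_
    rw [derivSup, derivSup, hfg]
    simp only [iteratedDeriv_succ']

theorem iteratedDeriv_fourier (n : ℤ) (i : ℕ) :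
    iteratedDeriv i (fun t : ℝ => (fourier n (t : UnitAddCircle) : ℂ)) =
      fun t : ℝ => (2 * Real.pi * Complex.I * n) ^ i * fourier n (t : UnitAddCircle) := by
  induction i with
  | zero => simp
  | succ i ih =>
    rw [iteratedDeriv_succ, ih]
    ext t
    have h := (hasDerivAt_fourier 1 n t).const_mul ((2 * Real.pi * Complex.I * n) ^ i)
    rw [h.deriv, pow_succ]
    push_cast; ring

theorem norm_two_pi_I_mul (n : ℤ) : ‖(2 * Real.pi * Complex.I * n : ℂ)‖ = 2 * Real.pi * |(n : ℝ)| := by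
  simp [abs_of_pos Real.pi_pos]

theorem norm_iteratedFDeriv_comp_clm_le {E F G : Type*} [NormedAddCommGroup E] [NormedSpace ℝ E]
    [NormedAddCommGroup F] [NormedSpace ℝ F] [NormedAddCommGroup G] [NormedSpace ℝ G]
    {f : E → F} (hf : ContDiff ℝ ∞ f) (L : G →L[ℝ] E) (hL : ‖L‖ ≤ 1) (i : ℕ) (x : G) :
    ‖iteratedFDeriv ℝ i (fun y => f (L y)) x‖ ≤ ‖iteratedFDeriv ℝ i f (L x)‖ := by
  have h := L.iteratedFDeriv_comp_right hf x (i := i) (by exact_mod_cast le_top)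
  change ‖iteratedFDeriv ℝ i (f ∘ L) x‖ ≤ _
  rw [h]
  refine (ContinuousMultilinearMap.norm_compContinuousLinearMap_le _ _).trans ?_
  refine mul_le_of_le_one_right (norm_nonneg _) ?_
  exact Finset.prod_le_one (fun _ _ => norm_nonneg _) fun _ _ => hL

variable {θ : ℝ}

/-- The map `f ↦ π(f) Uⁿ` for the orbit representation at `0`. -/
def orbitTerm (θ : ℝ) (n : ℤ) : C(UnitAddCircle, ℂ) →L[ℂ] (Ell2 →L[ℂ] Ell2) :=
  LinearMap.mkContinuous
    { toFun := fun f => orbitMul θ 0 f * charShift 0 n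
      map_add' := fun f g => by
        have h : orbitMul θ 0 (f + g) = orbitMul θ 0 f + orbitMul θ 0 g :=
          map_add (orbitRep θ 0 0).π f g
        rw [h, add_mul]
      map_smul' := fun c f => by
        have h : orbitMul θ 0 (c • f) = c • orbitMul θ 0 f := map_smul (orbitRep θ 0 0).π c f
        rw [h, RingHom.id_apply, smul_mul_assoc] } 1 fun f => by
    rw [one_mul]; exact (orbitRep θ 0 0).toPair.norm_term_le f n

/-- Separates the parameters: `t` enters through scalars only, and `s` through translates of the
coefficients in one fixed representation. -/
theorem orbitOp_eq_tsum (F : SmoothAlgebra θ) (t s : ℝ) :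
    orbitOp t s F = ∑' n, (fourier n (t : UnitAddCircle) : ℂ) •
      orbitTerm θ n (translate (F.coeff n) s) := by
  change ∑' n, orbitMul θ s (F.coeff n) * charShift t n = _
  congr 1; ext1 n
  ext x m
  change (orbitMul θ s (F.coeff n) * charShift t n) x m =
    fourier n (t : UnitAddCircle) *
      ((orbitMul θ 0 (translate (F.coeff n) s) * charShift 0 n) x m)
  rw [mul_apply_eq_comp, mul_apply_eq_comp, orbitMul_apply, orbitMul_apply, charShift_apply,
    charShift_apply, translate_apply, fourier_eval_zero, zero_add,
    add_comm (m • (θ : UnitAddCircle))]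
  ring

/-- Each `t`-derivative costs a factor `2π|n|` and each `s`-derivative differentiates a coefficient
of `F`; the seminorms of `A_θ^∞` make the resulting Leibniz majorants summable. -/
theorem contDiff_orbitOp (F : SmoothAlgebra θ) :
    ContDiff ℝ ∞ fun x : ℝ × ℝ => orbitOp (x.1 : UnitAddCircle) (x.2 : UnitAddCircle) F := by
  simp only [orbitOp_eq_tsum]
  let a : ℤ → ℝ → ℂ := fun n t => fourier n (t : UnitAddCircle)
  have ha : ∀ n, ContDiff ℝ ∞ (a n) := fun n => isSmooth_fourier n
  let g : ℤ → ℝ → (Ell2 →L[ℂ] Ell2) := fun n s => orbitTerm θ n (translate (F.coeff n) s)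
  have hg : ∀ n, ContDiff ℝ ∞ (g n) := fun n =>
    ((orbitTerm θ n).restrictScalars ℝ).contDiff.comp (contDiff_translate (F.isSchwartz.smooth n))
  have hg' : ∀ n j s, ‖iteratedFDeriv ℝ j (g n) s‖ ≤ derivSup j (F.coeff n) := fun n j s => by
    have h1 := ((orbitTerm θ n).restrictScalars ℝ).norm_iteratedFDeriv_comp_left (N := ∞) (n := j)
      (contDiff_translate (F.isSchwartz.smooth n)).contDiffAt (x := s) (by exact_mod_cast le_top)
    refine h1.trans ?_
    rw [norm_iteratedFDeriv_eq_norm_iteratedDeriv]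
    refine (mul_le_of_le_one_left (norm_nonneg _) ?_).trans
      (norm_iteratedDeriv_translate_le (F.isSchwartz.smooth n) j s)
    rw [ContinuousLinearMap.norm_restrictScalars]
    exact LinearMap.mkContinuous_norm_le _ zero_le_one _
  have ha' : ∀ n i t, ‖iteratedFDeriv ℝ i (a n) t‖ ≤ (2 * Real.pi) ^ i * wt i n := fun n i t => by
    rw [norm_iteratedFDeriv_eq_norm_iteratedDeriv, iteratedDeriv_fourier, norm_mul, norm_pow,
      norm_two_pi_I_mul, fourier_apply, Circle.norm_coe, mul_one, mul_pow]
    refine mul_le_mul_of_nonneg_left ?_ (by positivity)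
    exact pow_le_pow_left₀ (abs_nonneg _) (by linarith [abs_nonneg (n : ℝ)]) i
  refine contDiff_tsum (N := ⊤) (v := fun k n => ∑ i ∈ Finset.range (k + 1), (k.choose i : ℝ) *
    ((2 * Real.pi) ^ i * wt i n) * derivSup (k - i) (F.coeff n)) (fun n => ?_) (fun k _ => ?_)
    fun k n x _ => ?_
  · exact ((ha n).comp contDiff_fst).smul ((hg n).comp contDiff_snd)
  · refine summable_sum fun i _ => ?_
    refine ((F.isSchwartz.decay (k - i) i).mul_left ((k.choose i : ℝ) * (2 * Real.pi) ^ i)).congr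
      fun n => ?_
    ring
  · refine (norm_iteratedFDeriv_smul_le (N := ∞) ((ha n).comp contDiff_fst)
      ((hg n).comp contDiff_snd) x (n := k) (by exact_mod_cast le_top)).trans ?_
    refine Finset.sum_le_sum fun i _ => ?_
    have h1 := norm_iteratedFDeriv_comp_clm_le (ha n) (ContinuousLinearMap.fst ℝ ℝ ℝ)
      (ContinuousLinearMap.norm_fst_le ..) i x
    have h2 := norm_iteratedFDeriv_comp_clm_le (hg n) (ContinuousLinearMap.snd ℝ ℝ ℝ)
      (ContinuousLinearMap.norm_snd_le ..) (k - i) x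
    exact mul_le_mul (mul_le_mul_of_nonneg_left (h1.trans (ha' _ _ _)) (Nat.cast_nonneg _))
      (h2.trans (hg' _ _ _)) (norm_nonneg _)
      (mul_nonneg (Nat.cast_nonneg _) (mul_nonneg (by positivity) (wt_pos _ _).le))

end RotationAlgebra

end

/-! ### Spectral invariance. -/

noncomputable section

namespace RotationAlgebra

theorem ringInverse_mul_eq {M : Type*} [MonoidWithZero M] {a b w : M} (ha : IsUnit a)
    (hb : IsUnit b) (h : a * w = w * b) : Ring.inverse a * w = w * Ring.inverse b := by
  calc Ring.inverse a * w = Ring.inverse a * (w * b) * Ring.inverse b := by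
        rw [mul_assoc, mul_assoc, Ring.mul_inverse_cancel b hb, mul_one]
    _ = w * Ring.inverse b := by
        rw [← h, ← mul_assoc, Ring.inverse_mul_cancel a ha, one_mul]

/-- The diagonal operator on `ℓ²(ℤ)` with entries `m ↦ e(mu)`. -/
def charDiag (u : UnitAddCircle) : Ell2 →L[ℂ] Ell2 :=
  weightedShift (C := 1) (fun m => fourier m u) (fun _ => by rw [fourier_apply, Circle.norm_coe]) 0

theorem charDiag_apply (u : UnitAddCircle) (x : Ell2) (m : ℤ) :
    charDiag u x m = fourier m u * x m := by
  rw [charDiag, weightedShift_apply, sub_zero]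

theorem charDiag_basisVec (u : UnitAddCircle) (l : ℤ) :
    charDiag u (basisVec l) = (fourier l u : ℂ) • basisVec l := by
  ext m
  rw [charDiag_apply, lp.coeFn_smul, Pi.smul_apply, smul_eq_mul, basisVec_apply]
  split_ifs with h
  · rw [h]
  · rw [mul_zero, mul_zero]

theorem charShift_basisVec (k l : ℤ) : charShift 0 k (basisVec l) = basisVec (l + k) := by
  ext m
  rw [charShift_apply, fourier_eval_zero, one_mul, basisVec_apply, basisVec_apply]
  simp only [sub_eq_iff_eq_add]

variable {θ : ℝ}

/-- The twist by `u` is conjugation by a diagonal unitary. The relation passes to inverses and makes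
their `u`-dependence explicit. -/
theorem orbitOp_mul_charDiag (F : SmoothAlgebra θ) (u z : UnitAddCircle) :
    orbitOp u z F * charDiag u = charDiag u * orbitOp 0 z F := by
  refine clm_ext_basisVec fun l m => ?_
  rw [mul_apply_eq_comp, mul_apply_eq_comp, charDiag_basisVec, map_smul, charDiag_apply,
    lp.coeFn_smul, Pi.smul_apply, smul_eq_mul, orbitOp_basisVec, orbitOp_basisVec,
    fourier_eval_zero, one_mul, ← mul_assoc, ← fourier_add, add_sub_cancel]

/-- Moving the base point along its orbit is conjugation by a shift; for the inverse, this recovers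
all matrix entries from row `0`. -/
theorem orbitOp_mul_charShift (F : SmoothAlgebra θ) (z : UnitAddCircle) (k : ℤ) :
    orbitOp 0 z F * charShift 0 k = charShift 0 k * orbitOp 0 (z + k • (θ : UnitAddCircle)) F := by
  refine clm_ext_basisVec fun l m => ?_
  rw [mul_apply_eq_comp, mul_apply_eq_comp, charShift_basisVec, charShift_apply,
    orbitOp_basisVec, orbitOp_basisVec, fourier_eval_zero, fourier_eval_zero, fourier_eval_zero,
    add_assoc, ← add_smul, one_mul, one_mul, one_mul, add_sub_cancel]
  congr 2; ring

theorem isUnit_orbitOp {F : SmoothAlgebra θ} (h : IsUnit (inclusion θ F)) (u z : UnitAddCircle) :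
    IsUnit (orbitOp u z F) := by
  obtain ⟨b, hb, hb'⟩ := isUnit_iff_exists.1 h
  have h0 : (inclusion θ F).1 (orbitRep θ u z) = orbitOp u z F := universalPair_integrated_apply F _
  have h1 := congrArg (fun x : FullAlgebra θ => x.1 (orbitRep θ u z)) hb
  have h2 := congrArg (fun x : FullAlgebra θ => x.1 (orbitRep θ u z)) hb'
  refine isUnit_iff_exists.2 ⟨b.1 (orbitRep θ u z), ?_, ?_⟩
  · rw [← h0]; exact h1
  · rw [← h0]; exact h2

/-- The matrix entry `A ↦ ⟨A δ₋ₙ, δ₀⟩`. -/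
def entry (n : ℤ) : (Ell2 →L[ℂ] Ell2) →L[ℂ] ℂ :=
  (lp.evalCLM ℂ (fun _ : ℤ => ℂ) 2 0).comp (ContinuousLinearMap.apply ℂ Ell2 (basisVec (-n)))

theorem entry_apply (n : ℤ) (A : Ell2 →L[ℂ] Ell2) : entry n A = A (basisVec (-n)) 0 := rfl

theorem norm_entry_le (n : ℤ) : ‖entry n‖ ≤ 1 := by
  refine ContinuousLinearMap.opNorm_le_bound _ zero_le_one fun A => ?_
  rw [entry_apply, one_mul]
  refine (lp.norm_apply_le_norm (by norm_num) _ _).trans ?_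
  simpa [norm_basisVec] using A.le_opNorm (basisVec (-n))

section

variable {F : SmoothAlgebra θ}

theorem entry_inverse (hF : ∀ u z, IsUnit (orbitOp u z F)) (u z : UnitAddCircle) (n : ℤ) :
    entry n (Ring.inverse (orbitOp u z F)) =
      fourier n u * entry n (Ring.inverse (orbitOp 0 z F)) := by
  have h := ringInverse_mul_eq (hF u z) (hF 0 z) (orbitOp_mul_charDiag F u z)
  have h1 := congrArg (fun A : Ell2 →L[ℂ] Ell2 => A (basisVec (-n)) 0) h
  simp only [mul_apply_eq_comp, charDiag_basisVec, map_smul, charDiag_apply, lp.coeFn_smul,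
    Pi.smul_apply, smul_eq_mul, fourier_zero, one_mul] at h1
  rw [entry_apply, entry_apply, ← h1, ← mul_assoc, ← fourier_add, add_neg_cancel, fourier_zero,
    one_mul]

theorem inverse_basisVec (hF : ∀ u z, IsUnit (orbitOp u z F)) (z : UnitAddCircle) (l m : ℤ) :
    Ring.inverse (orbitOp 0 z F) (basisVec l) m =
      entry (m - l) (Ring.inverse (orbitOp 0 (z + m • (θ : UnitAddCircle)) F)) := by
  have h := ringInverse_mul_eq (hF _ _) (hF _ _) (orbitOp_mul_charShift F z m)
  have h1 := congrArg (fun A : Ell2 →L[ℂ] Ell2 => A (basisVec (l - m)) m) h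
  simp only [mul_apply_eq_comp, charShift_basisVec, charShift_apply, fourier_eval_zero, one_mul,
    sub_self, sub_add_cancel] at h1
  rw [h1, entry_apply, neg_sub]

theorem contDiff_inverse (hF : ∀ u z, IsUnit (orbitOp u z F)) : ContDiff ℝ ∞ fun x : ℝ × ℝ =>
    Ring.inverse (orbitOp (x.1 : UnitAddCircle) (x.2 : UnitAddCircle) F) := by
  refine contDiff_iff_contDiffAt.2 fun x => ?_
  have h := contDiffAt_ringInverse ℝ (n := ∞) (hF (x.1 : UnitAddCircle) (x.2 : UnitAddCircle)).unit
  exact ContDiffAt.comp x h (contDiff_orbitOp F).contDiffAt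

/-- `B` is the `k`-th `t`-derivative of the inverse. It stays operator-valued, so that one norm
bound on `B` controls the entries for all `n` at once. -/
theorem exists_contDiff_entry (hF : ∀ u z, IsUnit (orbitOp u z F)) (k : ℕ) :
    ∃ B : ℝ × ℝ → (Ell2 →L[ℂ] Ell2), ContDiff ℝ ∞ B ∧ ∀ n t s, entry n (B (t, s)) =
      (2 * Real.pi * Complex.I * n) ^ k * fourier n (t : UnitAddCircle) *
        entry n (Ring.inverse (orbitOp 0 (s : UnitAddCircle) F)) := by
  induction k with
  | zero => exact ⟨_, contDiff_inverse hF, fun n t s => by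
      rw [pow_zero, one_mul]; exact entry_inverse hF _ _ _⟩
  | succ k ih =>
    obtain ⟨B, hB, hB'⟩ := ih
    refine ⟨fun x => fderiv ℝ B x (1, 0),
      (hB.fderiv_right (m := ∞) (by simp)).clm_apply contDiff_const, fun n t s => ?_⟩
    have h1 : HasFDerivAt B (fderiv ℝ B (t, s)) (t, s) :=
      (hB.differentiable (by simp) _).hasFDerivAt
    have h2 : HasDerivAt (fun t : ℝ => (t, s)) ((1 : ℝ), (0 : ℝ)) t :=
      (hasDerivAt_id t).prodMk (hasDerivAt_const t s)
    have h3 := ((entry n).restrictScalars ℝ).hasFDerivAt.comp_hasDerivAt t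
      (h1.comp_hasDerivAt t h2)
    have h4 := ((hasDerivAt_fourier 1 n t).const_mul ((2 * Real.pi * Complex.I * n) ^ k)).mul_const
      (entry n (Ring.inverse (orbitOp 0 (s : UnitAddCircle) F)))
    refine (h3.unique (h4.congr_of_eventuallyEq (Eventually.of_forall fun t => hB' n t s))).trans ?_
    rw [pow_succ]; push_cast; ring

end

theorem exists_forall_norm_iteratedDeriv_le {F : SmoothAlgebra θ}
    (hF : ∀ u z, IsUnit (orbitOp u z F)) (j k : ℕ) : ∃ C, ∀ (n : ℤ) (s : ℝ),
      (2 * Real.pi * |(n : ℝ)|) ^ k * ‖iteratedDeriv j (fun s : ℝ =>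
        entry n (Ring.inverse (orbitOp 0 (s : UnitAddCircle) F))) s‖ ≤ C := by
  obtain ⟨B, hB, hB'⟩ := exists_contDiff_entry hF k
  have hH : ContDiff ℝ ∞ fun s : ℝ => B (0, s) := hB.comp (contDiff_const.prodMk contDiff_id)
  obtain ⟨C, hC⟩ := (isCompact_Icc (a := (0 : ℝ)) (b := 1)).exists_bound_of_continuousOn
    (hH.continuous_iteratedFDeriv (m := j) (by exact_mod_cast le_top)).continuousOn
  refine ⟨C, fun n s => ?_⟩
  let g : ℝ → ℂ := fun s => entry n (Ring.inverse (orbitOp 0 (s : UnitAddCircle) F))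
  have hp : Function.Periodic (iteratedDeriv j g) 1 := fun x => by
    have h := congrFun (iteratedDeriv_comp_add_const j g 1) x
    have h2 : (fun z => g (z + 1)) = g := funext fun x => by simp [g]
    rw [h2] at h
    exact h.symm
  -- The entries are 1-periodic in `s`, so the bound on the compact interval `[0, 1]` is global.
  obtain ⟨y, hy, hxy⟩ := hp.exists_mem_Ico₀ one_pos s
  change _ * ‖iteratedDeriv j g s‖ ≤ _
  rw [hxy, ← norm_two_pi_I_mul, ← norm_pow, ← norm_mul, ← smul_eq_mul,
    ← iteratedDeriv_const_smul_field]
  have h1 : (2 * Real.pi * Complex.I * n : ℂ) ^ k • g =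
      ((entry n).restrictScalars ℝ) ∘ fun s : ℝ => B (0, s) := funext fun s => by
    have := hB' n 0 s
    rw [QuotientAddGroup.mk_zero, fourier_eval_zero, mul_one] at this
    exact this.symm
  rw [h1, ← norm_iteratedFDeriv_eq_norm_iteratedDeriv]
  refine (((entry n).restrictScalars ℝ).norm_iteratedFDeriv_comp_left (N := ∞) (n := j)
    hH.contDiffAt (by exact_mod_cast le_top)).trans ?_
  rw [ContinuousLinearMap.norm_restrictScalars]
  exact (mul_le_of_le_one_left (norm_nonneg _) (norm_entry_le n)).trans
    (hC y ⟨hy.1, hy.2.le⟩)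

theorem wt_le_pow {n : ℤ} (hn : n ≠ 0) (k : ℕ) : wt k n ≤ (2 * Real.pi * |(n : ℝ)|) ^ k := by
  have h : (1 : ℝ) ≤ |(n : ℝ)| := by exact_mod_cast Int.one_le_abs hn
  refine pow_le_pow_left₀ (by positivity) ?_ k
  nlinarith [Real.pi_gt_three]

theorem summable_inv_wt_two : Summable fun n : ℤ => (wt 2 n)⁻¹ := by
  refine Summable.of_norm_bounded_eventually (Real.summable_one_div_int_pow (p := 2).2 one_lt_two)
    ?_
  filter_upwards [(Set.finite_singleton (0 : ℤ)).compl_mem_cofinite] with n hn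
  have hn : n ≠ 0 := hn
  have : (0 : ℝ) < |(n : ℝ)| := by positivity
  rw [Real.norm_of_nonneg (inv_nonneg.2 (wt_pos _ _).le), one_div, ← sq_abs (n : ℝ)]
  refine inv_anti₀ (by positivity) (pow_le_pow_left₀ this.le (by linarith) 2)

/-- The row-`0` entries of the inverses, as functions of the base point, are the coefficients of the
candidate inverse. Its orbit operators at `u = 0` are the inverses, and these operators separate
`A_θ^∞`. -/
theorem isUnit_of_isUnit_orbitOp {F : SmoothAlgebra θ} (hF : ∀ u z, IsUnit (orbitOp u z F)) :
    IsUnit F := by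
  have hsm : ∀ n, ContDiff ℝ ∞ fun s : ℝ =>
      entry n (Ring.inverse (orbitOp 0 (s : UnitAddCircle) F)) := fun n => by
    have h := (contDiff_inverse hF).comp ((contDiff_const (c := (0 : ℝ))).prodMk contDiff_id)
    exact ((entry n).restrictScalars ℝ).contDiff.comp h
  choose g hg hg' using fun n => exists_isSmooth_of_contDiff
    (φ := fun z => entry n (Ring.inverse (orbitOp 0 z F))) (hsm n)
  have hl : ∀ n, lift (g n) = fun s : ℝ =>
      entry n (Ring.inverse (orbitOp 0 (s : UnitAddCircle) F)) := fun n => funext fun s => hg' n _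
  have hS : IsSchwartz g := by
    refine ⟨hg, fun j k => ?_⟩
    -- Two additional powers of `n` pay for summability over `ℤ`; the term `n = 0`, where the power
    -- gives no control, is dropped by a cofinite bound.
    obtain ⟨C, hC⟩ := exists_forall_norm_iteratedDeriv_le hF j (k + 2)
    refine Summable.of_norm_bounded_eventually (summable_inv_wt_two.mul_left C) ?_
    filter_upwards [(Set.finite_singleton (0 : ℤ)).compl_mem_cofinite] with n hn
    rw [Real.norm_of_nonneg (mul_nonneg (wt_pos _ _).le (derivSup_nonneg _ _)),
      le_mul_inv_iff₀ (wt_pos _ _), mul_right_comm, wt, wt, ← pow_add]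
    change wt (k + 2) n * _ ≤ C
    rw [← le_div_iff₀' (wt_pos _ _)]
    refine derivSup_le fun s => ?_
    rw [le_div_iff₀' (wt_pos _ _), hl]
    exact (mul_le_mul_of_nonneg_right (wt_le_pow hn _) (norm_nonneg _)).trans (hC n s)
  have h1 : ∀ z, orbitOp 0 z (SmoothAlgebra.mk g hS : SmoothAlgebra θ) =
      Ring.inverse (orbitOp 0 z F) := fun z => clm_ext_basisVec fun l m => by
    rw [orbitOp_basisVec, inverse_basisVec hF, fourier_eval_zero, one_mul]
    exact hg' _ _
  refine isUnit_iff_exists.2 ⟨SmoothAlgebra.mk g hS, eq_of_orbitOp fun z => ?_,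
    eq_of_orbitOp fun z => ?_⟩
  · rw [map_mul, map_one, h1, Ring.mul_inverse_cancel _ (hF 0 z)]
  · rw [map_mul, map_one, h1, Ring.inverse_mul_cancel _ (hF 0 z)]

theorem isSpectralInvariant_inclusion :
    IsSpectralInvariant (inclusion θ : SmoothAlgebra θ →ₐ[ℂ] FullAlgebra θ) := fun _ =>
  ⟨fun h => h.map _, fun h => isUnit_of_isUnit_orbitOp (isUnit_orbitOp h)⟩

end RotationAlgebra

end

theorem mainTheorem4 (θ : ℝ) (hθ : Irrational θ) :
    -- `A_θ^∞` is an `m`-convex Fréchet algebra, and a dense `⋆`-subalgebra of `A_θ`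
    IsMConvexFrechetAlgebra (SmoothAlgebra θ) ∧
    Function.Injective (inclusion θ) ∧ Continuous (inclusion θ) ∧ DenseRange (inclusion θ) ∧
    -- it is spectral invariant in `A_θ`
    IsSpectralInvariant (inclusion θ : SmoothAlgebra θ →ₐ[ℂ] FullAlgebra θ) ∧
    -- `L¹(𝕋)` is a Banach module, with the stated action, and topologically irreducible
    ContinuousSMul (SmoothAlgebra θ) L1 ∧
    (∀ (F : SmoothAlgebra θ) (ψ : L1), ∀ᵐ z : UnitAddCircle,
      HasSum (fun n : ℤ => F.coeff n z * ψ (z - n • (θ : UnitAddCircle))) ((F • ψ : L1) z)) ∧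
    IsTopologicallyIrreducible (SmoothAlgebra θ) L1 ∧
    -- the cyclic submodules generated by functions with an inverse square root singularity
    (∀ p : UnitAddCircle, ∃ ξ, HasInvSqrtSingularity p ξ) ∧
    (∀ (p : UnitAddCircle) (ξ : UnitAddCircle → ℝ), HasInvSqrtSingularity p ξ →
      MemLp (fun z => (ξ z : ℂ)) 1 volume ∧ ¬ MemLp (fun z => (ξ z : ℂ)) 2 volume ∧
      ∀ e : L1, (e =ᵐ[volume] fun z => (ξ z : ℂ)) →
        e ∈ cyclicSubmodule (SmoothAlgebra θ) e ∧
        ¬ IsSimpleModule (SmoothAlgebra θ) (cyclicSubmodule (SmoothAlgebra θ) e) ∧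
        ∀ (H : Type u) [NormedAddCommGroup H] [InnerProductSpace ℂ H] [CompleteSpace H]
          (π : FullAlgebra θ →⋆ₙₐ[ℂ] (H →L[ℂ] H)),
          ¬ CyclicContainedInStarRep (inclusion θ : SmoothAlgebra θ →ₐ[ℂ] FullAlgebra θ) e π) ∧
    -- the extension property does not hold, although `A_θ^∞` is spectral invariant
    ¬ CyclicSubmodulesExtend.{0, v, 0, 1}
        (inclusion θ : SmoothAlgebra θ →ₐ[ℂ] FullAlgebra θ) := by
  refine ⟨SmoothAlgebra.isMConvexFrechetAlgebra, inclusion_injective, continuous_inclusion,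
    denseRange_inclusion, isSpectralInvariant_inclusion, inferInstance, ae_hasSum_smul_L1,
    isTopologicallyIrreducible_L1 hθ, exists_hasInvSqrtSingularity, fun p ξ h =>
    ⟨h.memLp_one, h.not_memLp_two, fun e he => ⟨⟨1, one_smul _ e⟩,
      not_isSimpleModule_cyclicSubmodule hθ h he, fun H _ _ _ π => ?_⟩⟩,
    not_cyclicSubmodulesExtend hθ⟩
  exact not_cyclicContainedInStarRep hθ h he π
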